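/- Let $q$ be a fixed odd prime power. For $g\ge 0$ let $\mathcal H_{2g+2,q}$ be the set of monic square-free polynomials of degree $2g+2$ in $\mathbb F_q[x]$, with the uniform probability measure. For a monic irreducible polynomial $P\in\mathbb F_q[x]$ put $\|P\|=q^{\deg P}$, and for $Q\in\mathbb F_q[x]$ let $\chi_Q(P)=\left(\frac QP\right)$ be the quadratic residue symbol: it is $0$ if $P\mid Q$, and otherwise the element of $\{1,-1\}$ congruent to $Q^{(\|P\|-1)/2}$ modulo $P$. For $0<\beta<1$ and an integer $K\ge 0$, a Beurling–Selberg polynomial $I_K^{+}$ (respectively $I_K^-$) for the interval $\mathcal I=[-\beta/2,\beta/2]$ is a real-valued even trigonometric polynomial $\sum_{|k|\le K}c_k e^{2\pi i kx}$ of degree at most $K$ such that $\mathbf 1_{\mathcal I}\le I_K^+$ (respectively $I_K^-\le\mathbf 1_{\mathcal I}$) on $\mathbb R/\mathbb Z$ and $\int_0^1 I_K^{\pm}(x)\,dx=\beta\pm\frac1{K+1}$. Let $\widehat I_K^{\pm}(k)=\int_0^1 I_K^{\pm}(x)e^{-2\pi i kx}\,dx$ be its Fourier coefficients, and set $$T_K^{\pm}(Q)=-2\sum_{P}\frac{\widehat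 I_K^{\pm}(\deg P)\,\deg P}{\sqrt{\|P\|}}\,\chi_Q(P),$$ the sum being over all monic irreducible $P$ (only those with $\deg P\le K$ contribute). Let $g\to\infty$, and let $\beta=\beta(g)\in(0,1)$ either be fixed (independent of $g$), or satisfy $\beta\to0$ and $\beta g\to\infty$. Let $K=K(g)$ be non-negative integers with $K\asymp g/\log\log(g\beta)$ as $g\to\infty$, and for each $g$ let $I_K^{\pm}$ be any Beurling–Selberg polynomials for $\mathcal I=[-\beta/2,\beta/2]$. Then, for each choice of the sign, the random variable $$\frac{T_K^{\pm}(Q)}{\sqrt{\frac{2}{\pi^2}\log(g\beta)}},\qquad Q\in\mathcal H_{2g+2,q}\text{ uniformly random},$$ converges in distribution to the standard Gaussian $N(0,1)$ as $g\to\infty$. -/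

import Mathlib

open MeasureTheory ProbabilityTheory Filter Topology Asymptotics Polynomial

noncomputable section

namespace HyperellipticFamily

/-! ### Primes, quadratic symbols and the family of square-free polynomials -/

section Family

variable (F : Type*) [Field F]

theorem finite_natDegree_le [Finite F] (n : ℕ) : {P : F[X] | P.natDegree ≤ n}.Finite := by
  have h : {P : F[X] | P.natDegree ≤ n} ⊆ (Polynomial.degreeLT F (n + 1) : Set F[X]) := by
    intro P hP
    rw [SetLike.mem_coe, Polynomial.mem_degreeLT]
    exact lt_of_le_of_lt Polynomial.degree_le_natDegree
      (by exact_mod_cast Nat.lt_succ_of_le hP)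
  have : Finite (Polynomial.degreeLT F (n + 1)) :=
    Finite.of_equiv _ (Polynomial.degreeLTEquiv F (n + 1)).symm.toEquiv
  exact (Set.toFinite _).subset h

/-- The primes (monic irreducible polynomials) of degree at most `n` in `F[X]`. -/
def primesUpTo [Finite F] (n : ℕ) : Finset F[X] :=
  ((finite_natDegree_le F n).subset
    (fun _ h => h.2.2 : {P : F[X] | P.Monic ∧ Irreducible P ∧ P.natDegree ≤ n} ⊆ _)).toFinset

/-- The set of monic square-free polynomials of degree `d` in `F[X]`. -/
def squarefreeFamily (d : ℕ) : Set F[X] :=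
  {Q | Q.Monic ∧ Squarefree Q ∧ Q.natDegree = d}

instance squarefreeFamily_finite [Finite F] (d : ℕ) : Finite (squarefreeFamily F d) :=
  (finite_natDegree_le F d).subset (fun _ h => h.2.2.le)

instance squarefreeFamily_nonempty (d : ℕ) : Nonempty (squarefreeFamily F d) := by
  rcases Nat.eq_zero_or_pos d with rfl | hd
  · exact ⟨1, monic_one, squarefree_one, natDegree_one⟩
  by_cases h : (d : F) = 0
  · have hd1 : 1 < d := by
      rcases Nat.lt_or_ge 1 d with h1 | h1
      · exact h1
      · obtain rfl : d = 1 := le_antisymm h1 hd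
        simp at h
    have hdeg : (X : F[X]).degree < (d : WithBot ℕ) := by
      rw [degree_X]; exact_mod_cast hd1
    refine ⟨X ^ d - X, monic_X_pow_sub hdeg, Separable.squarefree ?_, ?_⟩
    · refine ⟨0, -1, ?_⟩
      simp [derivative_X_pow, h]
    · rw [natDegree_sub_eq_left_of_natDegree_lt] <;> simp [hd1]
  · exact ⟨X ^ d - C 1, monic_X_pow_sub_C _ hd.ne',
      (separable_X_pow_sub_C 1 h one_ne_zero).squarefree, natDegree_X_pow_sub_C⟩

instance squarefreeFamily_measurableSpace (d : ℕ) : MeasurableSpace (squarefreeFamily F d) := ⊤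

variable {F}

open Classical in
/-- The quadratic residue symbol `(f / P)` for a prime `P`: it is `0` if `P` divides `f`, and
otherwise the element of `{1, -1}` congruent to `f ^ ((‖P‖ - 1) / 2)` modulo `P`. -/
def residueSymbol (f P : F[X]) : ℝ :=
  if P ∣ f then 0
  else if P ∣ f ^ ((Nat.card F ^ P.natDegree - 1) / 2) - 1 then 1 else -1

end Family

/-! ### Beurling–Selberg polynomials -/

section BeurlingSelberg

/-- `f` is a real-valued trigonometric polynomial of period `1` and of degree at most `K`. -/
def IsTrigPoly (K : ℕ) (f : ℝ → ℝ) : Prop :=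
  ∃ c : ℤ → ℂ, ∀ x : ℝ,
    (f x : ℂ) = ∑ k ∈ Finset.Icc (-(K : ℤ)) K, c k * Complex.exp (2 * Real.pi * Complex.I * k * x)

/-- The indicator function of `[-β/2, β/2]`, as a function on `ℝ/ℤ`, that is, extended
periodically. -/
def arcIndicator (β : ℝ) : ℝ → ℝ :=
  Set.indicator {x : ℝ | ∃ n : ℤ, x - n ∈ Set.Icc (-(β / 2)) (β / 2)} 1

/-- `f` is a Beurling–Selberg majorant `I_K^+` of degree `K` for the interval `[-β/2, β/2]`. -/
structure IsSelbergMajorant (β : ℝ) (K : ℕ) (f : ℝ → ℝ) : Prop where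
  isTrigPoly : IsTrigPoly K f
  even : ∀ x, f (-x) = f x
  majorant : ∀ x, arcIndicator β x ≤ f x
  integral : ∫ x in (0 : ℝ)..1, f x = β + 1 / ((K : ℝ) + 1)

/-- `f` is a Beurling–Selberg minorant `I_K^-` of degree `K` for the interval `[-β/2, β/2]`. -/
structure IsSelbergMinorant (β : ℝ) (K : ℕ) (f : ℝ → ℝ) : Prop where
  isTrigPoly : IsTrigPoly K f
  even : ∀ x, f (-x) = f x
  minorant : ∀ x, f x ≤ arcIndicator β x
  integral : ∫ x in (0 : ℝ)..1, f x = β - 1 / ((K : ℝ) + 1)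

/-- The `k`-th Fourier coefficient of `f` on `ℝ/ℤ`. The coefficients of the even real functions to
which this is applied are real, so the real part loses nothing. -/
def fourierCoefficient (f : ℝ → ℝ) (k : ℤ) : ℝ :=
  (∫ x in (0 : ℝ)..1, (f x : ℂ) * Complex.exp (-(2 * Real.pi * Complex.I * k * x))).re

end BeurlingSelberg

/-- The sum over primes `T(Q) = -2 ∑_P Î(deg P) deg P ‖P‖^{-1/2} χ_Q(P)` attached to a
trigonometric polynomial `I` of degree at most `K`, where `χ_Q(P) = (Q / P)` and
`‖P‖ = q ^ deg P`. Since `Î(k) = 0` for `k > K`, only primes of degree at most `K` occur. -/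
def primeSum {F : Type*} [Field F] [Finite F] (K : ℕ) (I : ℝ → ℝ) (Q : F[X]) : ℝ :=
  -2 * ∑ P ∈ primesUpTo F K,
    fourierCoefficient I P.natDegree * P.natDegree / √((Nat.card F : ℝ) ^ P.natDegree)
      * residueSymbol Q P

/-! ### Existence of Beurling–Selberg polynomials

Majorants and minorants as above exist for all `0 < β < 1` and all `K`; they are built from a
trigonometric polynomial that interpolates the sawtooth function `x - 1/2` at the points
`j / (K + 1)`. -/

section Existence

/-- `E x = e^{2πix}`. -/
def circleExp (x : ℝ) : ℂ := Complex.exp (2 * Real.pi * Complex.I * x)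

theorem circleExp_ne_zero (x : ℝ) : circleExp x ≠ 0 := Complex.exp_ne_zero _

theorem circleExp_hasDerivAt (x : ℝ) :
    HasDerivAt circleExp (2 * Real.pi * Complex.I * circleExp x) x := by
  have h : HasDerivAt (fun y : ℝ => 2 * Real.pi * Complex.I * (y : ℂ))
      (2 * Real.pi * Complex.I * 1) x := (Complex.ofRealCLM.hasDerivAt (x := x)).const_mul _
  have h2 := h.cexp
  rw [mul_one, mul_comm (Complex.exp _)] at h2
  exact h2

theorem circleExp_injOn : Set.InjOn circleExp (Set.Ico 0 1) := by
  intro x hx y hy h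
  obtain ⟨n, hn⟩ := Complex.exp_eq_exp_iff_exists_int.1 h
  have h2 : (2 * Real.pi * Complex.I : ℂ) ≠ 0 := by simp [Real.pi_ne_zero]
  have h3 : (x : ℂ) = y + n := by
    apply mul_left_cancel₀ h2; rw [hn]; ring
  have h4 : x = y + n := by exact_mod_cast h3
  have h5 : ((n : ℤ) : ℝ) < 1 := by linarith [hx.2, hy.1]
  have h6 : (-1 : ℝ) < ((n : ℤ) : ℝ) := by linarith [hx.1, hy.2]
  have h7 : n < 1 := by exact_mod_cast h5
  have h8 : -1 < n := by exact_mod_cast h6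
  obtain rfl : n = 0 := by omega
  simpa using h4

theorem circleExp_add_one (x : ℝ) : circleExp (x + 1) = circleExp x := by
  unfold circleExp
  have := Complex.exp_periodic (2 * Real.pi * Complex.I * x)
  rw [← this]; congr 1; push_cast; ring

theorem conj_circleExp (x : ℝ) : (starRingEnd ℂ) (circleExp x) = (circleExp x)⁻¹ := by
  unfold circleExp
  rw [← Complex.exp_conj, ← Complex.exp_neg]
  congr 1
  simp [Complex.conj_ofNat]

/-- `p` represents the real trigonometric polynomial `f` of degree at most `K`. -/
def Represents (K : ℕ) (p : ℂ[X]) (f : ℝ → ℝ) : Prop :=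
  p.natDegree ≤ 2 * K ∧ ∀ x, (f x : ℂ) * circleExp x ^ K = p.eval (circleExp x)

theorem Represents.isTrigPoly {K : ℕ} {p : ℂ[X]} {f : ℝ → ℝ} (h : Represents K p f) :
    IsTrigPoly K f := by
  refine ⟨fun k => p.coeff (k + K).toNat, fun x => ?_⟩
  apply mul_right_cancel₀ (pow_ne_zero K (circleExp_ne_zero x))
  rw [h.2 x, eval_eq_sum_range' (Nat.lt_succ_of_le h.1), Finset.sum_mul]
  symm
  refine Finset.sum_bij' (fun k _ => (k + K).toNat) (fun n _ => (n : ℤ) - K) ?_ ?_ ?_ ?_ ?_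
  · intro k hk; rw [Finset.mem_Icc] at hk; rw [Finset.mem_range]; omega
  · intro n hn; rw [Finset.mem_range] at hn; rw [Finset.mem_Icc]; omega
  · intro k hk; rw [Finset.mem_Icc] at hk; omega
  · intro n hn; omega
  · intro k hk
    rw [Finset.mem_Icc] at hk
    obtain ⟨n, hn⟩ : ∃ n : ℕ, k + K = n := ⟨(k + K).toNat, by omega⟩
    simp only [hn, Int.toNat_natCast]
    rw [mul_assoc]
    congr 1
    unfold circleExp
    rw [← Complex.exp_nat_mul, ← Complex.exp_nat_mul, ← Complex.exp_add]
    congr 1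
    have : (k : ℂ) = n - K := by
      have : k = n - K := by omega
      rw [this]; push_cast; ring
    rw [this]; ring

theorem Represents.periodic {K : ℕ} {p : ℂ[X]} {f : ℝ → ℝ} (h : Represents K p f) :
    Function.Periodic f 1 := by
  intro x
  have h1 := h.2 (x + 1)
  rw [circleExp_add_one, ← h.2 x] at h1
  exact_mod_cast mul_right_cancel₀ (pow_ne_zero K (circleExp_ne_zero x)) h1

theorem exists_represents (K : ℕ) (p : ℂ[X]) (hp : p.natDegree ≤ 2 * K) :
    ∃ r, Represents K r (fun x => (p.eval (circleExp x) / circleExp x ^ K).re) := by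
  set p' := reflect (2 * K) (p.map (starRingEnd ℂ)) with hp'
  refine ⟨C (1 / 2) * (p + p'), ?_, fun x => ?_⟩
  · refine (natDegree_C_mul_le _ _).trans ((natDegree_add_le _ _).trans (max_le hp ?_))
    rw [hp', natDegree_le_iff_coeff_eq_zero]
    intro n hn
    rw [coeff_reflect, revAt_eq_self_of_lt hn, coeff_map, coeff_eq_zero_of_natDegree_lt (by omega),
      map_zero]
  · have hz := circleExp_ne_zero x
    have h1 : p'.eval (circleExp x) =
        (starRingEnd ℂ) (p.eval (circleExp x)) * circleExp x ^ (2 * K) := by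
      let _ : Invertible (circleExp x)⁻¹ := invertibleOfNonzero (inv_ne_zero hz)
      have h2 := eval₂_reflect_mul_pow (RingHom.id ℂ) (circleExp x)⁻¹ (2 * K)
        (p.map (starRingEnd ℂ)) (by rwa [natDegree_map])
      rw [invOf_eq_inv, inv_inv, ← hp', ← eval, ← eval, ← conj_circleExp, eval_map_apply] at h2
      rw [← h2, conj_circleExp, mul_assoc, ← mul_pow, inv_mul_cancel₀ hz, one_pow, mul_one]
    rw [eval_mul, eval_add, eval_C, h1, Complex.re_eq_add_conj, map_div₀, map_pow, conj_circleExp, inv_pow]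
    have hzK : circleExp x ^ K ≠ 0 := pow_ne_zero K hz
    rw [mul_comm 2 K, pow_mul]
    generalize circleExp x ^ K = w at hzK ⊢
    field_simp

theorem hasDerivAt_eval_circleExp (K : ℕ) (p : ℂ[X]) (x : ℝ) :
    HasDerivAt (fun y => p.eval (circleExp y) * (circleExp y ^ K)⁻¹)
      ((C (2 * Real.pi * Complex.I) * (X * derivative p - C (K : ℂ) * p)).eval (circleExp x) *
        ((circleExp x) ^ K)⁻¹) x := by
  have hz := circleExp_ne_zero x
  have h1 : HasDerivAt (fun y => p.eval (circleExp y))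
      ((derivative p).eval (circleExp x) * (2 * Real.pi * Complex.I * circleExp x)) x :=
    (p.hasDerivAt (circleExp x)).comp x (circleExp_hasDerivAt x)
  have h2 := h1.mul (((circleExp_hasDerivAt x).pow K).inv (pow_ne_zero K hz))
  refine h2.congr_deriv ?_
  rcases K with _ | K
  · simp; ring
  · simp only [Pi.pow_apply, Pi.inv_apply, eval_mul, eval_C, eval_sub, eval_X]
    simp only [Nat.add_sub_cancel]
    field_simp
    ring

theorem Represents.deriv {K : ℕ} {p : ℂ[X]} {f : ℝ → ℝ} (h : Represents K p f) :
    ∃ (r : ℂ[X]) (f' : ℝ → ℝ), Represents K r f' ∧ ∀ x, HasDerivAt f (f' x) x := by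
  have hf : (fun x => (f x : ℂ)) = fun x => p.eval (circleExp x) * ((circleExp x) ^ K)⁻¹ := by
    funext x
    rw [← h.2 x, mul_inv_cancel_right₀ (pow_ne_zero K (circleExp_ne_zero x))]
  have hf' := hasDerivAt_eval_circleExp K p
  rw [← hf] at hf'
  have hre : ∀ x, HasDerivAt f
      ((C (2 * Real.pi * Complex.I) * (X * derivative p - C (K : ℂ) * p)).eval (circleExp x) *
        ((circleExp x) ^ K)⁻¹).re x := fun x =>
    (Complex.reCLM.hasFDerivAt.comp_hasDerivAt x (hf' x))
  refine ⟨C (2 * Real.pi * Complex.I) * (X * derivative p - C (K : ℂ) * p), _, ⟨?_, fun x => ?_⟩,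
    hre⟩
  · refine (natDegree_C_mul_le _ _).trans ((natDegree_sub_le _ _).trans (max_le ?_ ?_))
    · rw [natDegree_le_iff_coeff_eq_zero]
      rintro (_ | n) hn
      · omega
      · rw [coeff_X_mul, coeff_derivative, coeff_eq_zero_of_natDegree_lt (by have := h.1; omega),
          zero_mul]
    · exact (natDegree_C_mul_le _ _).trans h.1
  · rw [(hre x).ofReal_comp.unique (hf' x),
      inv_mul_cancel_right₀ (pow_ne_zero K (circleExp_ne_zero x))]

theorem Represents.eq_zero {K : ℕ} {p : ℂ[X]} {f f' : ℝ → ℝ} (h : Represents K p f)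
    (hf : ∀ x, HasDerivAt f (f' x) x) (S D : Finset ℝ) (hS : ∀ x ∈ S, 0 ≤ x ∧ x < 1 ∧ f x = 0)
    (hDS : D ⊆ S) (hD : ∀ x ∈ D, f' x = 0) (hcard : 2 * K < S.card + D.card) : ∀ x, f x = 0 := by
  have hp : p = 0 := by
    by_contra hp
    have hroot : ∀ x, f x = 0 → p.IsRoot (circleExp x) := fun x hx => by
      rw [IsRoot, ← h.2 x, hx, Complex.ofReal_zero, zero_mul]
    have hroot' : ∀ x, f x = 0 → f' x = 0 → (derivative p).IsRoot (circleExp x) := by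
      intro x hx hx'
      have h1 : HasDerivAt (fun y => p.eval (circleExp y))
          ((derivative p).eval (circleExp x) * (2 * Real.pi * Complex.I * circleExp x)) x :=
        (p.hasDerivAt (circleExp x)).comp x (circleExp_hasDerivAt x)
      have h2 := (hf x).ofReal_comp.mul ((circleExp_hasDerivAt x).pow K)
      have h3 : (fun y => p.eval (circleExp y)) = (fun y => (f y : ℂ)) * (circleExp ^ K) := by
        funext y
        exact (h.2 y).symm
      rw [h3] at h1
      have h4 := h1.unique h2
      simp only [hx, hx', Complex.ofReal_zero, zero_mul, add_zero] at h4
      refine (mul_eq_zero.1 h4).resolve_right ?_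
      simp [Real.pi_ne_zero, circleExp_ne_zero]
    have hinj : Set.InjOn circleExp S := by
      refine circleExp_injOn.mono ?_
      intro x hx
      exact ⟨(hS x hx).1, (hS x hx).2.1⟩
    have hle : (S.image circleExp).val + (D.image circleExp).val ≤ p.roots := by
      rw [Multiset.le_iff_count]
      intro z
      rw [Multiset.count_add, count_roots]
      by_cases hzD : z ∈ D.image circleExp
      · obtain ⟨x, hxD, rfl⟩ := Finset.mem_image.1 hzD
        have := (one_lt_rootMultiplicity_iff_isRoot hp).2
          ⟨hroot x (hS x (hDS hxD)).2.2, hroot' x (hS x (hDS hxD)).2.2 (hD x hxD)⟩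
        have h1 := Multiset.nodup_iff_count_le_one.1 (S.image circleExp).nodup (circleExp x)
        have h2 := Multiset.nodup_iff_count_le_one.1 (D.image circleExp).nodup (circleExp x)
        omega
      · rw [Multiset.count_eq_zero_of_notMem (s := (D.image circleExp).val) hzD, add_zero]
        by_cases hzS : z ∈ S.image circleExp
        · obtain ⟨x, hxS, rfl⟩ := Finset.mem_image.1 hzS
          have := (rootMultiplicity_pos hp).2 (hroot x (hS x hxS).2.2)
          have h1 := Multiset.nodup_iff_count_le_one.1 (S.image circleExp).nodup (circleExp x)
          omega
        · rw [Multiset.count_eq_zero_of_notMem (s := (S.image circleExp).val) hzS]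
          exact Nat.zero_le _
    have h1 := Multiset.card_le_card hle
    rw [Multiset.card_add, Finset.card_val, Finset.card_val, Finset.card_image_of_injOn hinj,
      Finset.card_image_of_injOn (hinj.mono hDS)] at h1
    have h2 := p.card_roots'
    have h3 := h.1
    omega
  intro x
  have := h.2 x
  rw [hp, eval_zero] at this
  exact_mod_cast (mul_eq_zero.1 this).resolve_right (pow_ne_zero K (circleExp_ne_zero x))

theorem circleExp_pow_eq_one (K j : ℕ) : circleExp ((j : ℝ) / (K + 1)) ^ (K + 1) = 1 := by
  unfold circleExp
  rw [← Complex.exp_nat_mul, Complex.exp_eq_one_iff]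
  refine ⟨j, ?_⟩
  have : (K + 1 : ℂ) ≠ 0 := by exact_mod_cast Nat.succ_ne_zero K
  push_cast
  field_simp

theorem node_mem_Ico {K j : ℕ} (hj : j < K + 1) : (j : ℝ) / (K + 1) ∈ Set.Ico (0 : ℝ) 1 := by
  have hN : (0 : ℝ) < K + 1 := by positivity
  refine ⟨by positivity, ?_⟩
  rw [div_lt_one hN]
  exact_mod_cast hj

/-- Hermite interpolation at the points `j / (K + 1)`: double at `1 ≤ j ≤ K`, simple at `0`. -/
theorem exists_hermite (K : ℕ) : ∃ (p : ℂ[X]) (f f' : ℝ → ℝ), Represents K p f ∧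
    (∀ x, HasDerivAt f (f' x) x) ∧ f 0 = 1 / 2 ∧
    (∀ j : ℕ, 0 < j → j < K + 1 → f ((j : ℝ) / (K + 1)) = (j : ℝ) / (K + 1) - 1 / 2) ∧
    (∀ j : ℕ, 0 < j → j < K + 1 → f' ((j : ℝ) / (K + 1)) = 1) := by
  set v : ℕ → ℂ := fun j => circleExp ((j : ℝ) / (K + 1)) with hv
  set s : ℕ → ℝ := fun j => if j = 0 then 1 / 2 else (j : ℝ) / (K + 1) - 1 / 2 with hs
  have hinj : Set.InjOn v (Finset.range (K + 1)) := by
    intro i hi j hj hij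
    have h1 := circleExp_injOn (node_mem_Ico (by simpa using hi)) (node_mem_Ico (by simpa using hj))
      hij
    have hN : (K + 1 : ℝ) ≠ 0 := by positivity
    have h2 : (i : ℝ) = j := by
      field_simp at h1
      exact h1
    exact_mod_cast h2
  have hvz : ∀ j, v j ≠ 0 := fun j => circleExp_ne_zero _
  set L := Lagrange.interpolate (Finset.range (K + 1)) v (fun j => (s j : ℂ) * v j ^ K) with hL
  set W : ℂ[X] := X ^ (K + 1) - 1 with hW
  set t : ℕ → ℂ := fun j =>
    (v j)⁻¹ * (v j ^ K / (2 * Real.pi * Complex.I) + K * ((s j : ℂ) * v j ^ K)) with ht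
  set M := Lagrange.interpolate ((Finset.range (K + 1)).erase 0) v
    (fun j => (t j - (derivative L).eval (v j)) / (derivative W).eval (v j)) with hM
  have hinj' : Set.InjOn v ((Finset.range (K + 1)).erase 0 : Finset ℕ) :=
    hinj.mono (by exact_mod_cast Finset.erase_subset _ _)
  have hWv : ∀ j, W.eval (v j) = 0 := fun j => by
    simp only [hW, eval_sub, eval_pow, eval_X, eval_one, hv, circleExp_pow_eq_one, sub_self]
  have hW'v : ∀ j, (derivative W).eval (v j) ≠ 0 := fun j => by
    simp only [hW, derivative_sub, derivative_X_pow, derivative_one, sub_zero, eval_mul, eval_C,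
      eval_pow, eval_X]
    exact mul_ne_zero (by exact_mod_cast Nat.succ_ne_zero K) (pow_ne_zero _ (hvz j))
  have hLv : ∀ j < K + 1, L.eval (v j) = (s j : ℂ) * v j ^ K := fun j hj =>
    Lagrange.eval_interpolate_at_node _ hinj (by simpa using hj)
  have hpv : ∀ j < K + 1, (L + M * W).eval (v j) = (s j : ℂ) * v j ^ K := fun j hj => by
    rw [eval_add, eval_mul, hWv, mul_zero, add_zero, hLv j hj]
  have hp'v : ∀ j, 0 < j → j < K + 1 → (derivative (L + M * W)).eval (v j) = t j := by
    intro j hj0 hj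
    rw [derivative_add, derivative_mul, eval_add, eval_add, eval_mul, eval_mul, hWv, mul_zero,
      zero_add, hM, Lagrange.eval_interpolate_at_node _ hinj'
        (by simp [hj, hj0.ne']), div_mul_cancel₀ _ (hW'v j)]
    ring
  have hdeg : (L + M * W).natDegree ≤ 2 * K := by
    refine (natDegree_add_le _ _).trans (max_le ?_ ?_)
    · have h1 : L.degree < ((Finset.range (K + 1)).card : WithBot ℕ) :=
        Lagrange.degree_interpolate_lt _ hinj
      rw [Finset.card_range] at h1
      have h2 : L.natDegree ≤ K := natDegree_le_iff_degree_le.2 (Order.le_of_lt_succ h1)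
      omega
    · by_cases hM0 : M = 0
      · rw [hM0, zero_mul, natDegree_zero]
        exact Nat.zero_le _
      · have h1 : M.degree < (((Finset.range (K + 1)).erase 0).card : WithBot ℕ) :=
          Lagrange.degree_interpolate_lt _ hinj'
        rw [Finset.card_erase_of_mem (by simp), Finset.card_range, Nat.add_sub_cancel,
          ← natDegree_lt_iff_degree_lt hM0] at h1
        have h2 : W.natDegree ≤ K + 1 := by
          rw [hW, ← C_1, natDegree_X_pow_sub_C]
        have h3 := natDegree_mul_le (p := M) (q := W)
        omega
  obtain ⟨r, hr⟩ := exists_represents K _ hdeg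
  obtain ⟨r', f', -, hf'⟩ := hr.deriv
  refine ⟨r, _, f', hr, hf', ?_, ?_, ?_⟩
  · have := hpv 0 (Nat.succ_pos K)
    have hv0 : circleExp 0 = v 0 := by simp [hv]
    change ((L + M * W).eval (circleExp 0) / circleExp 0 ^ K).re = _
    rw [hv0, this, mul_div_cancel_right₀ _ (pow_ne_zero _ (hvz 0)), Complex.ofReal_re]
    simp [hs]
  · intro j hj0 hj
    have := hpv j hj
    change ((L + M * W).eval (v j) / v j ^ K).re = _
    rw [this, mul_div_cancel_right₀ _ (pow_ne_zero _ (hvz j)), Complex.ofReal_re]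
    simp [hs, hj0.ne']
  · intro j hj0 hj
    have h1 := Complex.reCLM.hasFDerivAt.comp_hasDerivAt ((j : ℝ) / (K + 1))
      (hasDerivAt_eval_circleExp K (L + M * W) ((j : ℝ) / (K + 1)))
    refine ((hf' _).unique h1).trans ?_
    change ((C (2 * Real.pi * Complex.I) *
      (X * derivative (L + M * W) - C (K : ℂ) * (L + M * W))).eval (v j) * (v j ^ K)⁻¹).re = 1
    rw [eval_mul, eval_sub, eval_mul, eval_mul, eval_C, eval_C, eval_X, hpv j hj, hp'v j hj0 hj]
    have h2 : 2 * Real.pi * Complex.I * (v j * t j - K * ((s j : ℂ) * v j ^ K)) * (v j ^ K)⁻¹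
        = 1 := by
      have h3 : (2 * Real.pi * Complex.I : ℂ) ≠ 0 := by simp [Real.pi_ne_zero]
      have h4 := pow_ne_zero K (hvz j)
      simp only [ht]
      rw [mul_inv_cancel_left₀ (hvz j), add_sub_cancel_right, mul_div_cancel₀ _ h3,
        mul_inv_cancel₀ h4]
    rw [h2, Complex.one_re]

theorem pos_of_ne_zero_on {f : ℝ → ℝ} (hf : Continuous f) {a b x₀ : ℝ} (hx₀ : x₀ ∈ Set.Ioo a b)
    (h0 : 0 < f x₀) (hne : ∀ x ∈ Set.Ioo a b, f x ≠ 0) : ∀ x ∈ Set.Ioo a b, 0 < f x := by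
  intro x hx
  by_contra hneg
  obtain ⟨c, hc, hc0⟩ := isPreconnected_Ioo.intermediate_value hx hx₀ hf.continuousOn
    ⟨not_lt.1 hneg, h0.le⟩
  exact hne c hc hc0

/-- A trigonometric polynomial of degree `K` that majorizes the sawtooth function. -/
theorem exists_sawtooth_majorant (K : ℕ) : ∃ f : ℝ → ℝ, IsTrigPoly K f ∧
    Function.Periodic f 1 ∧ Continuous f ∧ f 0 = 1 / 2 ∧
    (∀ j : ℕ, 0 < j → j < K + 1 → f ((j : ℝ) / (K + 1)) = (j : ℝ) / (K + 1) - 1 / 2) ∧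
    ∀ x ∈ Set.Ico (0 : ℝ) 1, x - 1 / 2 ≤ f x := by
  obtain ⟨p, f, f', hp, hf', hf0, hfj, hf'j⟩ := exists_hermite K
  have hcont : Continuous f := continuous_iff_continuousAt.2 fun x => (hf' x).continuousAt
  refine ⟨f, hp.isTrigPoly, hp.periodic, hcont, hf0, hfj, ?_⟩
  have hN : (0 : ℝ) < K + 1 := by positivity
  set u : ℕ → ℝ := fun j => (j : ℝ) / (K + 1) with hu
  have hu_lt : ∀ {i j : ℕ}, i < j → u i < u j := fun {i j} hij => by
    simp only [hu]; gcongr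
  have hu_le : ∀ {i j : ℕ}, i ≤ j → u i ≤ u j := fun {i j} hij => by
    simp only [hu]; gcongr
  have hu0 : u 0 = 0 := by simp [hu]
  have hu1 : u (K + 1) = 1 := by simp only [hu]; push_cast; exact div_self hN.ne'
  set D : ℝ → ℝ := fun x => f x - (x - 1 / 2) with hD
  set d : ℝ → ℝ := fun x => f' x - 1 with hd
  have hDd : ∀ x, HasDerivAt D (d x) x := fun x =>
    (hf' x).sub ((hasDerivAt_id x).sub_const (1 / 2))
  have hDc : Continuous D := continuous_iff_continuousAt.2 fun x => (hDd x).continuousAt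
  have hD0 : D 0 = 1 := by simp only [hD, hf0]; norm_num
  have hDu : ∀ j, 0 < j → j ≤ K + 1 → D (u j) = 0 := by
    intro j hj0 hj
    rcases hj.lt_or_eq with h | rfl
    · simp only [hD, hu, hfj j hj0 h, sub_self]
    · have : f 1 = f 0 := by simpa using hp.periodic 0
      rw [hu1]
      simp only [hD, this, hf0]
      norm_num
  have hdu : ∀ j, 0 < j → j < K + 1 → d (u j) = 0 := fun j hj0 hj => by
    simp only [hd, hu, hf'j j hj0 hj, sub_self]
  obtain ⟨r, f₁, hr, hf₁⟩ := hp.deriv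
  have hr' : Represents K (r - X ^ K) d := by
    refine ⟨(natDegree_sub_le _ _).trans (max_le hr.1 ?_), fun x => ?_⟩
    · rw [natDegree_X_pow]; omega
    · rw [eval_sub, ← hr.2 x, eval_pow, eval_X]
      simp only [hd, (hf' x).unique (hf₁ x)]
      push_cast; ring
  obtain ⟨-, d', -, hd'⟩ := hr'.deriv
  have hdne : ¬ ∀ x, d x = 0 := by
    intro h
    have h1 : D 0 = D 1 := is_const_of_deriv_eq_zero (fun x => (hDd x).differentiableAt)
      (fun x => by rw [(hDd x).deriv, h x]) 0 1
    have h2 := hDu (K + 1) K.succ_pos le_rfl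
    rw [hu1, ← h1, hD0] at h2
    exact one_ne_zero h2
  have hrolle : ∀ {a b : ℝ}, a < b → D a = D b → ∃ c ∈ Set.Ioo a b, d c = 0 := fun {a b} hab h =>
    exists_hasDerivAt_eq_zero hab hDc.continuousOn h fun x _ => hDd x
  have hz : ∀ j, ∃ c, 0 < j → j < K + 1 → c ∈ Set.Ioo (u j) (u (j + 1)) ∧ d c = 0 := by
    intro j
    by_cases hj : 0 < j ∧ j < K + 1
    · obtain ⟨c, hc⟩ := hrolle (hu_lt (Nat.lt_succ_self j))
        ((hDu j hj.1 hj.2.le).trans (hDu (j + 1) j.succ_pos hj.2).symm)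
      exact ⟨c, fun _ _ => hc⟩
    · exact ⟨0, fun h1 h2 => absurd ⟨h1, h2⟩ hj⟩
  choose z hz using hz
  set J := (Finset.range (K + 1)).erase 0 with hJ
  have hJm : ∀ {j}, j ∈ J ↔ 0 < j ∧ j < K + 1 := fun {j} => by
    simp [hJ, Nat.pos_iff_ne_zero]
  have hJc : J.card = K := by
    rw [hJ, Finset.card_erase_of_mem (by simp), Finset.card_range, Nat.add_sub_cancel]
  set S := J.image u ∪ J.image z with hS
  have hzinj : ∀ i ∈ J, ∀ j ∈ J, i < j → z i < z j := fun i hi j hj hij =>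
    ((hz i (hJm.1 hi).1 (hJm.1 hi).2).1.2.trans_le (hu_le hij)).trans
      (hz j (hJm.1 hj).1 (hJm.1 hj).2).1.1
  have hSc : S.card = 2 * K := by
    rw [hS, Finset.card_union_of_disjoint, Finset.card_image_of_injOn, Finset.card_image_of_injOn,
      hJc, two_mul]
    · intro i hi j hj hij
      rcases lt_trichotomy i j with h | h | h
      · exact absurd hij (hzinj i hi j hj h).ne
      · exact h
      · exact absurd hij (hzinj j hj i hi h).ne'
    · intro i _ j _ hij
      rcases lt_trichotomy i j with h | h | h
      · exact absurd hij (hu_lt h).ne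
      · exact h
      · exact absurd hij (hu_lt h).ne'
    · rw [Finset.disjoint_left]
      intro x hx hx'
      obtain ⟨i, hi, rfl⟩ := Finset.mem_image.1 hx
      obtain ⟨j, hj, hij⟩ := Finset.mem_image.1 hx'
      have h1 := (hz j (hJm.1 hj).1 (hJm.1 hj).2).1
      rw [hij] at h1
      rcases Nat.lt_or_ge j i with h | h
      · exact absurd (hu_le h) (not_le.2 h1.2)
      · exact absurd (hu_le h) (not_le.2 h1.1)
  have hSI : ∀ x ∈ S, 0 ≤ x ∧ x < 1 ∧ d x = 0 := by
    intro x hx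
    rcases Finset.mem_union.1 hx with h | h
    · obtain ⟨j, hj, rfl⟩ := Finset.mem_image.1 h
      have hj' := hJm.1 hj
      exact ⟨hu0 ▸ hu_le (Nat.zero_le j), hu1 ▸ hu_lt hj'.2, hdu j hj'.1 hj'.2⟩
    · obtain ⟨j, hj, rfl⟩ := Finset.mem_image.1 h
      have hj' := hJm.1 hj
      obtain ⟨h1, h2⟩ := hz j hj'.1 hj'.2
      exact ⟨(hu0 ▸ hu_le (Nat.zero_le j) : (0 : ℝ) ≤ u j).trans h1.1.le,
        h1.2.trans_le (hu1 ▸ hu_le hj'.2), h2⟩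
  have key : ∀ c, 0 ≤ c → c < 1 → d c = 0 → c ∈ S := by
    intro c h0 h1 hc
    by_contra hcS
    refine hdne (hr'.eq_zero hd' (insert c S) ∅ ?_ (Finset.empty_subset _) (by simp) ?_)
    · intro x hx
      rcases Finset.mem_insert.1 hx with rfl | h
      · exact ⟨h0, h1, hc⟩
      · exact hSI x h
    · rw [Finset.card_insert_of_notMem hcS, hSc]; simp
  have key2 : ∀ j, 0 < j → j < K + 1 → d' (u j) ≠ 0 := by
    intro j hj0 hj h
    have hmem : u j ∈ S := Finset.mem_union_left _ (Finset.mem_image_of_mem u (hJm.2 ⟨hj0, hj⟩))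
    refine hdne (hr'.eq_zero hd' S {u j} hSI (by simpa using hmem) (by simpa using h) ?_)
    rw [hSc]; simp
  -- zeros of `d` strictly between consecutive nodes
  have hbetween : ∀ n ≤ K, ∀ c ∈ Set.Ioo (u n) (u (n + 1)), d c = 0 → 0 < n ∧ c = z n := by
    intro n hn c hc hdc
    have hcS : c ∈ S := key c ((hu0 ▸ hu_le (Nat.zero_le n) : (0 : ℝ) ≤ u n).trans hc.1.le)
      (hc.2.trans_le (hu1 ▸ hu_le (Nat.succ_le_succ hn))) hdc
    rcases Finset.mem_union.1 hcS with h | h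
    · obtain ⟨j, hj, rfl⟩ := Finset.mem_image.1 h
      rcases Nat.lt_or_ge n j with h | h
      · exact absurd (hu_le h) (not_le.2 hc.2)
      · exact absurd (hu_le h) (not_le.2 hc.1)
    · obtain ⟨j, hj, rfl⟩ := Finset.mem_image.1 h
      have hj' := hJm.1 hj
      obtain ⟨h1, h2⟩ := hz j hj'.1 hj'.2
      rcases lt_trichotomy n j with h | rfl | h
      · exact absurd (hu_le h) (not_le.2 (h1.1.trans hc.2))
      · exact ⟨hj'.1, rfl⟩
      · exact absurd (hu_le h) (not_le.2 (hc.1.trans h1.2))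
  have hDne : ∀ n ≤ K, ∀ x ∈ Set.Ioo (u n) (u (n + 1)), D x ≠ 0 := by
    intro n hn x hx h0
    obtain ⟨c, hc, hdc⟩ := hrolle hx.2 (h0.trans (hDu (n + 1) n.succ_pos (by omega)).symm)
    obtain ⟨hn0, hcz⟩ := hbetween n hn c ⟨hx.1.trans hc.1, hc.2⟩ hdc
    obtain ⟨c', hc', hdc'⟩ := hrolle hx.1 ((hDu n hn0 (by omega)).trans h0.symm)
    obtain ⟨-, hcz'⟩ := hbetween n hn c' ⟨hc'.1, hc'.2.trans hx.2⟩ hdc'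
    rw [hcz] at hc
    rw [hcz'] at hc'
    exact absurd (hc.1.trans hc'.2) (lt_irrefl _)
  have hpos : ∀ n ≤ K, ∀ x ∈ Set.Ioo (u n) (u (n + 1)), 0 < D x := by
    intro n
    induction n with
    | zero =>
      intro hn
      have h1 : ∀ᶠ x in 𝓝[>] (u 0), 0 < D x := by
        refine nhdsWithin_le_nhds (hDc.continuousAt.eventually (lt_mem_nhds ?_))
        rw [hu0, hD0]; exact one_pos
      obtain ⟨x₀, hx₀, hx₀'⟩ := (h1.and (Ioo_mem_nhdsGT (hu_lt (Nat.lt_succ_self 0)))).exists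
      exact pos_of_ne_zero_on hDc hx₀' hx₀ (hDne 0 hn)
    | succ n ih =>
      intro hn
      have ih := ih (by omega)
      have hderiv : deriv D = d := funext fun x => (hDd x).deriv
      have hd0 : deriv D (u (n + 1)) = 0 := by
        rw [hderiv]; exact hdu (n + 1) n.succ_pos (by omega)
      have hDn := hDu (n + 1) n.succ_pos (by omega)
      have hdd : deriv (deriv D) (u (n + 1)) = d' (u (n + 1)) := by
        rw [hderiv, (hd' _).deriv]
      rcases lt_or_gt_of_ne (key2 (n + 1) n.succ_pos (by omega)) with h | h
      · have hmax := isLocalMax_of_deriv_deriv_neg (hdd ▸ h) hd0 hDc.continuousAt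
        have h1 : ∀ᶠ x in 𝓝[<] (u (n + 1)), D x ≤ D (u (n + 1)) := nhdsWithin_le_nhds hmax
        obtain ⟨x₀, hx₀, hx₀'⟩ := (h1.and (Ioo_mem_nhdsLT (hu_lt (Nat.lt_succ_self n)))).exists
        exact absurd (ih x₀ hx₀') (not_lt.2 (hDn ▸ hx₀))
      · have hmin := isLocalMin_of_deriv_deriv_pos (hdd ▸ h) hd0 hDc.continuousAt
        have h1 : ∀ᶠ x in 𝓝[>] (u (n + 1)), D (u (n + 1)) ≤ D x := nhdsWithin_le_nhds hmin
        obtain ⟨x₀, hx₀, hx₀'⟩ :=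
          (h1.and (Ioo_mem_nhdsGT (hu_lt (Nat.lt_succ_self (n + 1))))).exists
        rw [hDn] at hx₀
        exact pos_of_ne_zero_on hDc hx₀' (lt_of_le_of_ne hx₀ (hDne (n + 1) hn x₀ hx₀').symm)
          (hDne (n + 1) hn)
  intro x hx
  suffices h : 0 ≤ D x by
    simp only [hD] at h; linarith
  -- locate `x` between consecutive nodes
  set n := ⌊x * (K + 1)⌋₊ with hn
  have h1 : (n : ℝ) ≤ x * (K + 1) := Nat.floor_le (mul_nonneg hx.1 hN.le)
  have h2 : x * (K + 1) < n + 1 := Nat.lt_floor_add_one _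
  have h3 : n < K + 1 := by
    have : (n : ℝ) < ((K + 1 : ℕ) : ℝ) := by push_cast; nlinarith [hx.2]
    exact_mod_cast this
  have h4 : u n ≤ x := by simp only [hu]; rwa [div_le_iff₀ hN]
  have h5 : x < u (n + 1) := by simp only [hu]; rw [lt_div_iff₀ hN]; push_cast; exact h2
  rcases h4.lt_or_eq with h | h
  · exact (hpos n (by omega) x ⟨h, h5⟩).le
  · rw [← h]
    rcases Nat.eq_zero_or_pos n with h6 | h6
    · rw [h6, hu0, hD0]; exact zero_le_one
    · rw [hDu n h6 h3.le]

theorem IsTrigPoly.continuous {K : ℕ} {f : ℝ → ℝ} (h : IsTrigPoly K f) : Continuous f := by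
  obtain ⟨c, hc⟩ := h
  have : f = fun x : ℝ => (∑ k ∈ Finset.Icc (-(K : ℤ)) K,
      c k * Complex.exp (2 * Real.pi * Complex.I * k * x)).re := by
    funext x; rw [← hc, Complex.ofReal_re]
  rw [this]
  fun_prop

/-- Quadrature for trigonometric polynomials of degree at most `K`. -/
theorem IsTrigPoly.integral_eq {K : ℕ} {f : ℝ → ℝ} (h : IsTrigPoly K f) :
    ∫ x in (0 : ℝ)..1, f x = (∑ j ∈ Finset.range (K + 1), f ((j : ℝ) / (K + 1))) / (K + 1) := by
  obtain ⟨c, hc⟩ := h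
  have hN : (K + 1 : ℂ) ≠ 0 := by exact_mod_cast Nat.succ_ne_zero K
  have h0 : (0 : ℤ) ∈ Finset.Icc (-(K : ℤ)) K := by simp
  have h1 : ((∫ x in (0 : ℝ)..1, f x : ℝ) : ℂ) = c 0 := by
    rw [← intervalIntegral.integral_ofReal]
    simp only [hc]
    rw [intervalIntegral.integral_finsetSum fun k _ => Continuous.intervalIntegrable (by fun_prop) _ _,
      Finset.sum_eq_single_of_mem 0 h0]
    · simp
    · intro k _ hk
      have h2 : (2 * Real.pi * Complex.I * k : ℂ) ≠ 0 := by
        simp [Real.pi_ne_zero, hk]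
      rw [intervalIntegral.integral_const_mul, integral_exp_mul_complex h2]
      have h3 : Complex.exp (2 * Real.pi * Complex.I * k) = 1 := by
        rw [Complex.exp_eq_one_iff]; exact ⟨k, by ring⟩
      simp [h3]
  have h2 : ∑ j ∈ Finset.range (K + 1), ((f ((j : ℝ) / (K + 1)) : ℝ) : ℂ) = c 0 * (K + 1) := by
    simp only [hc]
    rw [Finset.sum_comm, Finset.sum_eq_single_of_mem 0 h0]
    · simp; ring
    · intro k hk hk0
      rw [← Finset.mul_sum]
      set w := Complex.exp (2 * Real.pi * Complex.I * k / (K + 1)) with hw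
      have h3 : ∀ j ∈ Finset.range (K + 1), Complex.exp (2 * Real.pi * Complex.I * k *
          (((j : ℝ) / (K + 1) : ℝ) : ℂ)) = w ^ j := by
        intro j _
        rw [hw, ← Complex.exp_nat_mul]
        congr 1
        push_cast
        ring
      have h4 : w ^ (K + 1) = 1 := by
        rw [hw, ← Complex.exp_nat_mul, Complex.exp_eq_one_iff]
        refine ⟨k, ?_⟩
        push_cast
        field_simp
      have h5 : w ≠ 1 := by
        rw [hw, Ne, Complex.exp_eq_one_iff]
        rintro ⟨n, hn⟩
        have h6 : (k : ℂ) = n * (K + 1) := by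
          have h7 : (2 * Real.pi * Complex.I : ℂ) ≠ 0 := by simp [Real.pi_ne_zero]
          apply mul_left_cancel₀ h7
          field_simp at hn
          linear_combination (2 * Real.pi * Complex.I : ℂ) * hn
        have h8 : k = n * (K + 1) := by exact_mod_cast h6
        rw [Finset.mem_Icc] at hk
        have h9 : (K + 1 : ℤ) ∣ k := ⟨n, by rw [h8]; ring⟩
        have h10 := Int.le_of_dvd (abs_pos.2 hk0) ((dvd_abs _ _).2 h9)
        have h11 : |k| ≤ K := abs_le.2 hk
        omega
      rw [Finset.sum_congr rfl h3, geom_sum_eq h5, h4, sub_self, zero_div, mul_zero]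
  have h3 : ((∫ x in (0 : ℝ)..1, f x : ℝ) : ℂ) =
      (((∑ j ∈ Finset.range (K + 1), f ((j : ℝ) / (K + 1))) / (K + 1) : ℝ) : ℂ) := by
    rw [h1]
    push_cast at h2 ⊢
    rw [h2, mul_div_cancel_right₀ _ hN]
  exact_mod_cast h3

theorem IsTrigPoly.comp_add {K : ℕ} {f : ℝ → ℝ} (h : IsTrigPoly K f) (t : ℝ) :
    IsTrigPoly K (fun x => f (x + t)) := by
  obtain ⟨c, hc⟩ := h
  refine ⟨fun k => c k * Complex.exp (2 * Real.pi * Complex.I * k * t), fun x => ?_⟩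
  rw [hc]
  refine Finset.sum_congr rfl fun k _ => ?_
  rw [mul_assoc (c k), ← Complex.exp_add]
  congr 2
  push_cast
  ring

theorem IsTrigPoly.comp_neg {K : ℕ} {f : ℝ → ℝ} (h : IsTrigPoly K f) :
    IsTrigPoly K (fun x => f (-x)) := by
  obtain ⟨c, hc⟩ := h
  refine ⟨fun k => c (-k), fun x => ?_⟩
  rw [hc]
  refine Finset.sum_nbij' (fun k => -k) (fun k => -k) ?_ ?_ ?_ ?_ ?_
  · intro k hk; rw [Finset.mem_Icc] at hk ⊢; omega
  · intro k hk; rw [Finset.mem_Icc] at hk ⊢; omega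
  · simp
  · simp
  · intro k _
    push_cast
    rw [neg_neg]
    congr 2
    ring

theorem IsTrigPoly.linear {K : ℕ} {f h : ℝ → ℝ} (hf : IsTrigPoly K f) (hh : IsTrigPoly K h)
    (a s : ℝ) : IsTrigPoly K (fun x => a + s * (f x + h x)) := by
  obtain ⟨c, hc⟩ := hf
  obtain ⟨c', hc'⟩ := hh
  refine ⟨fun k => (if k = 0 then (a : ℂ) else 0) + s * (c k + c' k), fun x => ?_⟩
  have h0 : (a : ℂ) = ∑ k ∈ Finset.Icc (-(K : ℤ)) K,
      (if k = 0 then (a : ℂ) else 0) * Complex.exp (2 * Real.pi * Complex.I * k * x) := by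
    rw [Finset.sum_eq_single_of_mem (0 : ℤ) (by simp)]
    · simp
    · intro k _ hk
      rw [if_neg hk, zero_mul]
  push_cast
  rw [hc, hc']
  nth_rewrite 1 [h0]
  rw [← Finset.sum_add_distrib, Finset.mul_sum, ← Finset.sum_add_distrib]
  refine Finset.sum_congr rfl fun k _ => ?_
  ring

theorem sum_nodes {f : ℝ → ℝ} (K : ℕ) (h0 : f 0 = 1 / 2)
    (hf : ∀ j : ℕ, 0 < j → j < K + 1 → f ((j : ℝ) / (K + 1)) = (j : ℝ) / (K + 1) - 1 / 2) :
    ∑ j ∈ Finset.range (K + 1), f ((j : ℝ) / (K + 1)) = 1 / 2 := by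
  have hN : (K + 1 : ℝ) ≠ 0 := by positivity
  have h1 : ∀ m, m < K + 1 → ∑ j ∈ Finset.range (m + 1), f ((j : ℝ) / (K + 1)) =
      1 / 2 + (m * (m + 1) / (2 * (K + 1)) - m / 2) := by
    intro m
    induction m with
    | zero => intro _; simp [h0]
    | succ m ih =>
      intro hm
      rw [Finset.sum_range_succ, ih (by omega), hf (m + 1) m.succ_pos hm]
      push_cast
      field_simp
      ring
  rw [h1 K (Nat.lt_succ_self K)]
  field_simp
  ring

/-- Beurling–Selberg majorants and minorants exist for all `0 < β < 1` and all `K`. -/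
theorem exists_isSelbergMajorant_isSelbergMinorant {β : ℝ} (h0 : 0 < β) (h1 : β < 1) (K : ℕ) :
    (∃ f, IsSelbergMajorant β K f) ∧ ∃ f, IsSelbergMinorant β K f := by
  obtain ⟨B, htrig, hper, hcont, hB0, hBj, hBge⟩ := exists_sawtooth_majorant K
  have hint : ∫ x in (0 : ℝ)..1, B x = 1 / 2 / (K + 1) := by
    rw [htrig.integral_eq, sum_nodes K hB0 hBj]
  have hper' : ∀ t : ℝ, ∫ x in t..(t + 1), B x = 1 / 2 / (K + 1) := fun t => by
    rw [hper.intervalIntegral_add_eq t 0, zero_add, hint]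
  have hintL : ∀ t : ℝ, ∫ x in (0 : ℝ)..1, B (x + t) = 1 / 2 / (K + 1) := fun t => by
    rw [intervalIntegral.integral_comp_add_right, zero_add, add_comm, hper']
  have hintR : ∀ t : ℝ, ∫ x in (0 : ℝ)..1, B (-x + t) = 1 / 2 / (K + 1) := fun t => by
    simp only [neg_add_eq_sub]
    rw [intervalIntegral.integral_comp_sub_left, sub_zero]
    have := hper' (t - 1)
    rwa [sub_add_cancel] at this
  have htR : ∀ t : ℝ, IsTrigPoly K (fun x => B (-x + t)) := fun t => (htrig.comp_add t).comp_neg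
  have hL2 : ∀ y : ℝ, -1 < y → y ≤ 0 → y + 1 / 2 ≤ B y := by
    intro y hy hy0
    rcases hy0.lt_or_eq with h | rfl
    · have := hBge (y + 1) ⟨by linarith, by linarith⟩
      rw [hper y] at this
      linarith
    · rw [hB0, zero_add]
  have hshift : ∀ (y : ℝ) (n : ℤ), B (y + n) = B y := fun y n => by
    simpa using hper.int_mul n y
  have hred : ∀ x : ℝ, ∃ (n : ℤ) (y : ℝ), x = y + n ∧
      ((-(β / 2) ≤ y ∧ y ≤ β / 2 ∧ arcIndicator β x = 1) ∨
        (β / 2 < y ∧ y < 1 - β / 2 ∧ arcIndicator β x = 0)) := by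
    intro x
    refine ⟨⌊x + β / 2⌋, x - ⌊x + β / 2⌋, by ring, ?_⟩
    have ha := Int.floor_le (x + β / 2)
    have hb := Int.lt_floor_add_one (x + β / 2)
    rcases le_or_gt (x - ⌊x + β / 2⌋) (β / 2) with h | h
    · refine Or.inl ⟨by linarith, h, ?_⟩
      rw [arcIndicator, Set.indicator_of_mem, Pi.one_apply]
      exact ⟨_, by linarith, h⟩
    · refine Or.inr ⟨h, by linarith, ?_⟩
      rw [arcIndicator, Set.indicator_of_notMem]
      rintro ⟨m, hm1, hm2⟩
      have h3 : (m : ℝ) < ⌊x + β / 2⌋ + 1 := by linarith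
      have h4 : (⌊x + β / 2⌋ : ℝ) < m := by linarith
      have h5 : m < ⌊x + β / 2⌋ + 1 := by exact_mod_cast h3
      have h6 : ⌊x + β / 2⌋ < m := by exact_mod_cast h4
      omega
  refine ⟨⟨fun x => β + 1 * (B (x + -(β / 2)) + B (-x + -(β / 2))), ?_, ?_, ?_, ?_⟩,
    ⟨fun x => β + (-1) * (B (x + β / 2) + B (-x + β / 2)), ?_, ?_, ?_, ?_⟩⟩
  · exact (htrig.comp_add _).linear (htR _) β 1
  · intro x
    simp only [neg_neg]
    ring
  · intro x
    obtain ⟨n, y, rfl, h⟩ := hred x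
    have e1 : B (y + n + -(β / 2)) = B (y + -(β / 2)) := by
      rw [← hshift (y + -(β / 2)) n]; ring_nf
    have e2 : B (-(y + n) + -(β / 2)) = B (-y + -(β / 2)) := by
      rw [← hshift (-y + -(β / 2)) (-n)]; push_cast; ring_nf
    rw [e1, e2]
    rcases h with ⟨ha, hb, hc⟩ | ⟨ha, hb, hc⟩
    · have := hL2 (y + -(β / 2)) (by linarith) (by linarith)
      have := hL2 (-y + -(β / 2)) (by linarith) (by linarith)
      rw [hc]; linarith
    · have := hBge (y + -(β / 2)) ⟨by linarith, by linarith⟩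
      have := hL2 (-y + -(β / 2)) (by linarith) (by linarith)
      rw [hc]; linarith
  · rw [intervalIntegral.integral_add (by simp), intervalIntegral.integral_const_mul,
      intervalIntegral.integral_add, hintL, hintR]
    · simp; field_simp; ring
    all_goals exact Continuous.intervalIntegrable (by fun_prop) _ _
  · exact (htrig.comp_add _).linear (htR _) β (-1)
  · intro x
    simp only [neg_neg]
    ring
  · intro x
    obtain ⟨n, y, rfl, h⟩ := hred x
    have e1 : B (y + n + β / 2) = B (y + β / 2) := by
      rw [← hshift (y + β / 2) n]; ring_nf
    have e2 : B (-(y + n) + β / 2) = B (-y + β / 2) := by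
      rw [← hshift (-y + β / 2) (-n)]; push_cast; ring_nf
    rw [e1, e2]
    rcases h with ⟨ha, hb, hc⟩ | ⟨ha, hb, hc⟩
    · have := hBge (y + β / 2) ⟨by linarith, by linarith⟩
      have := hBge (-y + β / 2) ⟨by linarith, by linarith⟩
      rw [hc]; linarith
    · have := hBge (y + β / 2) ⟨by linarith, by linarith⟩
      have := hL2 (-y + β / 2) (by linarith) (by linarith)
      rw [hc]; linarith
  · rw [intervalIntegral.integral_add (by simp), intervalIntegral.integral_const_mul,
      intervalIntegral.integral_add, hintL, hintR]
    · simp; field_simp; ring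
    all_goals exact Continuous.intervalIntegrable (by fun_prop) _ _

end Existence

end HyperellipticFamily

end

noncomputable section

namespace HyperellipticFamily

open scoped BigOperators

/-! ### Characteristic functions, moments and Rademacher sums -/

section Probability

/-! Divided by σ = √((2/π²) log(gβ)), the prime sum is Σ b_P χ_Q(P) with b_P = -2 Î(deg P) deg P
‖P‖^(-1/2) / σ. The theorem holds because, for random square-free Q, the symbols χ_Q(P) behave like
independent random signs ε_P, while Σ b_P ε_P has variance tending to 1 and uniformly small
coefficients.

The comparison is made on moments. Expand the r-th power over r-tuples of primes. If some prime
occurs an odd number of times, the product of symbols is a nontrivial character modulo a polynomial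
of degree at most rK, so its sums over the monic polynomials of each degree at least rK vanish
(`sum_monicsOfDegree_prod_residueSymbol_eq_zero`). The unique factorization Q = D²M transfers this
to square-free Q at the cost of a recursion (`abs_sum_squarefreesOfDegree_le`), and the mean is
O(q^(rK) (2/q)^(g+1)). As q ≥ 3 and K = o(g), this stays negligible after summation over all tuples.
If every prime occurs an even number of times, the product is 1 unless one of the primes divides Q,
which has probability at most 2/‖P‖. Since b_P = O(‖P‖^(-1/2)/σ) and Σ ‖P‖^(-3/2) is bounded, these
tuples cost only O(1/σ) (`abs_expect_pow_sub_expect_rademacherSum_pow_le`).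

Gaussian moments are never computed. The characteristic functions of the two sums are compared by
Taylor expansion, with a remainder controlled by exponential moments of the Rademacher sum
(`tendsto_expect_cexp_of_moments`). The Rademacher characteristic function is ∏ cos(t b_P), which is
close to exp(-t² Σ b_P² / 2). Lévy's theorem concludes.

For the variance, I - 1 on the arc has constant sign and integral of absolute value 1/(K+1), so Î(d)
= sin(πdβ)/(πd) + O(1/K) (`abs_fourierCoefficient_sub_le`). Counting primes by degree, σ² Σ b_P² is
4 Σ d Î(d)² + O(1) = (4/π²) Σ sin²(πdβ)/d + O(1) = (2/π²) log(Kβ) + O(1)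
(`abs_variance_sub_log_le`), and log(Kβ) ~ log(gβ) because K is smaller than g only by an iterated
logarithm (`tendsto_log_div_log`). -/

theorem norm_exp_mul_I_sub_sum_le_of_nonneg (m : ℕ) {x : ℝ} (hx : 0 ≤ x) :
    ‖Complex.exp (x * Complex.I) - ∑ k ∈ Finset.range m, (x * Complex.I) ^ k / (k.factorial : ℂ)‖
      ≤ x ^ m / m.factorial := by
  induction m generalizing x with
  | zero => simp [Complex.norm_exp_ofReal_mul_I]
  | succ m ih =>
    -- The derivative of the Taylor remainder of order m + 1 is i times the remainder of order m, so
    -- the inductive bound can be integrated from 0.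
    have hd : ∀ y : ℝ, HasDerivAt (fun y : ℝ => Complex.exp (y * Complex.I) -
        ∑ k ∈ Finset.range (m + 1), (y * Complex.I) ^ k / (k.factorial : ℂ))
        (Complex.I * (Complex.exp (y * Complex.I) -
          ∑ k ∈ Finset.range m, (y * Complex.I) ^ k / (k.factorial : ℂ))) y := by
      intro y
      have h1 : HasDerivAt (fun y : ℝ => (y : ℂ) * Complex.I) Complex.I y := by
        simpa using (Complex.ofRealCLM.hasDerivAt (x := y)).mul_const Complex.I
      have h2 := h1.cexp
      have h3 : HasDerivAt (fun y : ℝ => ∑ k ∈ Finset.range (m + 1),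
          (y * Complex.I) ^ k / (k.factorial : ℂ))
          (∑ k ∈ Finset.range (m + 1),
            (k : ℂ) * (y * Complex.I) ^ (k - 1) * Complex.I / (k.factorial : ℂ)) y :=
        HasDerivAt.fun_sum fun k _ => (h1.pow k).div_const _
      refine (h2.sub h3).congr_deriv ?_
      rw [Finset.sum_range_succ', mul_sub, Finset.mul_sum]
      simp only [Nat.cast_zero, zero_mul, zero_div, add_zero, Nat.add_sub_cancel]
      congr 1
      · ring
      · refine Finset.sum_congr rfl fun k _ => ?_
        rw [Nat.factorial_succ]
        have h4 : (k.factorial : ℂ) ≠ 0 := by exact_mod_cast k.factorial_ne_zero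
        have h5 : ((k + 1 : ℕ) : ℂ) ≠ 0 := by exact_mod_cast k.succ_ne_zero
        push_cast at h5 ⊢
        field_simp
    have hB : ∀ y : ℝ, HasDerivAt (fun y : ℝ => y ^ (m + 1) / ((m + 1).factorial : ℝ))
        (y ^ m / (m.factorial : ℝ)) y := by
      intro y
      refine ((hasDerivAt_pow (m + 1) y).div_const _).congr_deriv ?_
      rw [Nat.factorial_succ]
      have h4 : (m.factorial : ℝ) ≠ 0 := by exact_mod_cast m.factorial_ne_zero
      have h5 : ((m + 1 : ℕ) : ℝ) ≠ 0 := by exact_mod_cast m.succ_ne_zero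
      push_cast at h5 ⊢
      field_simp
    refine image_norm_le_of_norm_deriv_right_le_deriv_boundary (a := 0) (b := x)
      (fun y _ => (hd y).continuousAt.continuousWithinAt)
      (fun y _ => (hd y).hasDerivWithinAt) ?_ hB ?_ ⟨hx, le_rfl⟩
    · rw [Finset.sum_range_succ']
      simp
    · intro y hy
      rw [norm_mul, Complex.norm_I, one_mul]
      exact ih hy.1

theorem norm_exp_mul_I_sub_sum_le (m : ℕ) (x : ℝ) :
    ‖Complex.exp (x * Complex.I) - ∑ k ∈ Finset.range m, (x * Complex.I) ^ k / (k.factorial : ℂ)‖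
      ≤ |x| ^ m / m.factorial := by
  rcases le_total 0 x with hx | hx
  · rw [abs_of_nonneg hx]
    exact norm_exp_mul_I_sub_sum_le_of_nonneg m hx
  · rw [abs_of_nonpos hx]
    have h := norm_exp_mul_I_sub_sum_le_of_nonneg m (neg_nonneg.2 hx)
    -- Conjugation replaces x by -x and preserves the norm.
    rw [← Complex.norm_conj] at h
    convert h using 3
    rw [map_sub, map_sum, ← Complex.exp_conj]
    simp

variable {Ω Ω' ι : Type*} [Fintype Ω] [Fintype Ω'] [Fintype ι] [DecidableEq ι]

theorem norm_expect_le (f : Ω → ℂ) : ‖𝔼 ω, f ω‖ ≤ 𝔼 ω, ‖f ω‖ :=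
  Finset.le_expect_of_subadditive norm_zero norm_add_le
    (fun c a => by
      have h : ((c : ℚ≥0)⁻¹) • a = ((c : ℝ)⁻¹) • a := by
        rw [NNRat.smul_def, Complex.real_smul]; push_cast; rfl
      have h' : ((c : ℚ≥0)⁻¹) • ‖a‖ = ((c : ℝ)⁻¹) * ‖a‖ := by
        rw [NNRat.smul_def]; push_cast; rfl
      rw [h, norm_smul, h', Real.norm_of_nonneg (by positivity)])

theorem expect_ofReal (f : Ω → ℝ) : ((𝔼 ω, f ω : ℝ) : ℂ) = 𝔼 ω, (f ω : ℂ) := by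
  rw [Fintype.expect_eq_sum_div_card, Fintype.expect_eq_sum_div_card]
  push_cast
  rfl

/-- The order of the expansion is even so that |X|^(2m) = X^(2m): the remainder is then itself a
moment. -/
theorem norm_expect_exp_sub_sum_le (X : Ω → ℝ) (t : ℝ) (m : ℕ) :
    ‖𝔼 ω, Complex.exp ((t * X ω : ℝ) * Complex.I) -
      ∑ k ∈ Finset.range (2 * m), (t * Complex.I) ^ k / (k.factorial : ℂ) * (𝔼 ω, X ω ^ k : ℝ)‖
      ≤ |t| ^ (2 * m) / (2 * m).factorial * 𝔼 ω, X ω ^ (2 * m) := by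
  have h1 : ∑ k ∈ Finset.range (2 * m), (t * Complex.I) ^ k / (k.factorial : ℂ) *
      (𝔼 ω, X ω ^ k : ℝ) = 𝔼 ω, ∑ k ∈ Finset.range (2 * m),
        (((t * X ω : ℝ) : ℂ) * Complex.I) ^ k / (k.factorial : ℂ) := by
    rw [Finset.expect_sum_comm]
    refine Finset.sum_congr rfl fun k _ => ?_
    rw [expect_ofReal, Finset.mul_expect]
    refine Finset.expect_congr rfl fun ω _ => ?_
    push_cast
    ring
  rw [h1, ← Finset.expect_sub_distrib, Finset.mul_expect]
  refine (norm_expect_le _).trans (Finset.expect_le_expect fun ω _ => ?_)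
  refine (norm_exp_mul_I_sub_sum_le _ _).trans (le_of_eq ?_)
  rw [abs_mul, mul_pow, (even_two_mul m).pow_abs (X ω)]
  ring

/-- The top moment of X in the remainder is rewritten as that of Y plus a difference. Hence only
differences of moments and one moment of Y, the explicit model, remain to be estimated. -/
theorem norm_expect_exp_sub_expect_exp_le (X : Ω → ℝ) (Y : Ω' → ℝ) (t : ℝ) (m : ℕ) :
    ‖𝔼 ω, Complex.exp ((t * X ω : ℝ) * Complex.I) -
        𝔼 ω, Complex.exp ((t * Y ω : ℝ) * Complex.I)‖
      ≤ ∑ k ∈ Finset.range (2 * m), |t| ^ k / k.factorial * |𝔼 ω, X ω ^ k - 𝔼 ω, Y ω ^ k| +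
        |t| ^ (2 * m) / (2 * m).factorial *
          ((𝔼 ω, X ω ^ (2 * m) - 𝔼 ω, Y ω ^ (2 * m)) + 2 * 𝔼 ω, Y ω ^ (2 * m)) := by
  have hX := norm_expect_exp_sub_sum_le X t m
  have hY := norm_expect_exp_sub_sum_le Y t m
  set A := 𝔼 ω, Complex.exp ((t * X ω : ℝ) * Complex.I)
  set B := 𝔼 ω, Complex.exp ((t * Y ω : ℝ) * Complex.I)
  have h3 : A - B = (A - ∑ k ∈ Finset.range (2 * m), (t * Complex.I) ^ k / (k.factorial : ℂ) *
      (𝔼 ω, X ω ^ k : ℝ)) - (B - ∑ k ∈ Finset.range (2 * m), (t * Complex.I) ^ k /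
      (k.factorial : ℂ) * (𝔼 ω, Y ω ^ k : ℝ)) + ∑ k ∈ Finset.range (2 * m),
      (t * Complex.I) ^ k / (k.factorial : ℂ) * ((𝔼 ω, X ω ^ k - 𝔼 ω, Y ω ^ k : ℝ) : ℂ) := by
    push_cast
    simp only [mul_sub, Finset.sum_sub_distrib]
    ring
  have h4 : ‖∑ k ∈ Finset.range (2 * m), (t * Complex.I) ^ k / (k.factorial : ℂ) *
      ((𝔼 ω, X ω ^ k - 𝔼 ω, Y ω ^ k : ℝ) : ℂ)‖ ≤ ∑ k ∈ Finset.range (2 * m),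
      |t| ^ k / k.factorial * |𝔼 ω, X ω ^ k - 𝔼 ω, Y ω ^ k| := by
    refine (norm_sum_le _ _).trans (le_of_eq (Finset.sum_congr rfl fun k _ => ?_))
    rw [norm_mul, Complex.norm_real, Real.norm_eq_abs]
    simp
  rw [h3]
  refine (norm_add_le _ _).trans ?_
  refine (add_le_add ((norm_sub_le _ _).trans (add_le_add hX hY)) h4).trans (le_of_eq ?_)
  ring

/-- The sign `±1` of a Boolean. -/
def boolSign (t : Bool) : ℝ := if t then 1 else -1

/-- The Rademacher sum `∑ bᵢ εᵢ`, for signs `ε`. -/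
def rademacherSum (b : ι → ℝ) (ε : ι → Bool) : ℝ := ∑ i, b i * boolSign (ε i)

/-- Independence of the coordinates of a uniform sign vector. -/
theorem expect_prod_eq_prod_expect {R : Type*} [Field R] [CharZero R]
    (f : ι → Bool → R) : 𝔼 ε : ι → Bool, ∏ i, f i (ε i) = ∏ i, (f i true + f i false) / 2 := by
  rw [Fintype.expect_eq_sum_div_card, Finset.prod_div_distrib]
  have h := Finset.prod_univ_sum (fun _ : ι => (Finset.univ : Finset Bool)) f
  rw [Fintype.piFinset_univ] at h
  rw [← h]
  simp

theorem expect_exp_rademacherSum (b : ι → ℝ) (t : ℝ) :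
    𝔼 ε, Real.exp (t * rademacherSum b ε) = ∏ i, Real.cosh (t * b i) := by
  simp only [rademacherSum, Finset.mul_sum, Real.exp_sum]
  rw [expect_prod_eq_prod_expect (fun i x => Real.exp (t * (b i * boolSign x)))]
  refine Finset.prod_congr rfl fun i _ => ?_
  simp [boolSign, Real.cosh_eq]

theorem expect_cexp_rademacherSum (b : ι → ℝ) (t : ℝ) :
    𝔼 ε, Complex.exp ((t * rademacherSum b ε : ℝ) * Complex.I) =
      ((∏ i, Real.cos (t * b i) : ℝ) : ℂ) := by
  simp only [rademacherSum, Finset.mul_sum, Complex.ofReal_sum, Finset.sum_mul, Complex.exp_sum]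
  rw [expect_prod_eq_prod_expect
    (fun i x => Complex.exp ((t * (b i * boolSign x) : ℝ) * Complex.I))]
  rw [Complex.ofReal_prod]
  refine Finset.prod_congr rfl fun i _ => ?_
  simp [boolSign, Complex.cos]

/-- Chernoff-type bound: y^(2m) ≤ (2m)!/L^(2m) · (e^(Ly) + e^(-Ly)), and cosh x ≤ e^(x²/2) bounds
the exponential moments. The parameter L stays free; taking it larger than 2|t| makes the Taylor
remainder at t decay geometrically in m. -/
theorem expect_rademacherSum_pow_le (b : ι → ℝ) (m : ℕ) {L : ℝ} (hL : 0 < L) :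
    𝔼 ε, rademacherSum b ε ^ (2 * m) ≤
      2 * (2 * m).factorial / L ^ (2 * m) * Real.exp (L ^ 2 * (∑ i, b i ^ 2) / 2) := by
  have hexp : ∀ s : ℝ, s ^ 2 = L ^ 2 → 𝔼 ε, Real.exp (s * rademacherSum b ε) ≤
      Real.exp (L ^ 2 * (∑ i, b i ^ 2) / 2) := by
    intro s hs
    rw [expect_exp_rademacherSum, ← hs, Finset.mul_sum, Finset.sum_div, Real.exp_sum]
    refine Finset.prod_le_prod (fun i _ => (Real.cosh_pos _).le) fun i _ => ?_
    rw [← mul_pow]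
    exact Real.cosh_le_exp_half_sq _
  have hpt : ∀ ε, rademacherSum b ε ^ (2 * m) ≤ (2 * m).factorial / L ^ (2 * m) *
      (Real.exp (L * rademacherSum b ε) + Real.exp (-L * rademacherSum b ε)) := by
    intro ε
    set y := rademacherSum b ε
    have h1 : (L * y) ^ (2 * m) / (2 * m).factorial ≤ Real.exp |L * y| := by
      rw [← (even_two_mul m).pow_abs]
      exact Real.pow_div_factorial_le_exp _ (abs_nonneg _) _
    have h2 : Real.exp |L * y| ≤ Real.exp (L * y) + Real.exp (-L * y) := by
      rw [neg_mul]
      exact Real.exp_abs_le _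
    have h3 := h1.trans h2
    rw [div_le_iff₀ (by positivity), mul_pow] at h3
    rw [div_mul_eq_mul_div, le_div_iff₀ (by positivity)]
    linarith
  refine (Finset.expect_le_expect fun ε _ => hpt ε).trans ?_
  rw [← Finset.mul_expect, Finset.expect_add_distrib]
  have h1 := hexp L rfl
  have h2 := hexp (-L) (neg_sq L)
  have h3 : (0 : ℝ) ≤ (2 * m).factorial / L ^ (2 * m) := by positivity
  calc _ ≤ (2 * m).factorial / L ^ (2 * m) * (Real.exp (L ^ 2 * (∑ i, b i ^ 2) / 2) +
        Real.exp (L ^ 2 * (∑ i, b i ^ 2) / 2)) := by gcongr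
    _ = _ := by ring

theorem abs_prod_sub_prod_le {κ : Type*} (s : Finset κ) {a b : κ → ℝ} (ha : ∀ i ∈ s, |a i| ≤ 1)
    (hb : ∀ i ∈ s, |b i| ≤ 1) : |∏ i ∈ s, a i - ∏ i ∈ s, b i| ≤ ∑ i ∈ s, |a i - b i| := by
  classical
  induction s using Finset.induction_on with
  | empty => simp
  | insert j s hj ih =>
    rw [Finset.prod_insert hj, Finset.prod_insert hj, Finset.sum_insert hj]
    have h1 := ih (fun i hi => ha i (Finset.mem_insert_of_mem hi))
      (fun i hi => hb i (Finset.mem_insert_of_mem hi))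
    have h2 : |∏ i ∈ s, b i| ≤ 1 := by
      rw [Finset.abs_prod]
      exact Finset.prod_le_one (fun i _ => abs_nonneg _)
        (fun i hi => hb i (Finset.mem_insert_of_mem hi))
    have h3 := ha j (Finset.mem_insert_self j s)
    calc |a j * ∏ i ∈ s, a i - b j * ∏ i ∈ s, b i|
        = |(a j - b j) * ∏ i ∈ s, b i + a j * (∏ i ∈ s, a i - ∏ i ∈ s, b i)| := by ring_nf
      _ ≤ |a j - b j| * |∏ i ∈ s, b i| + |a j| * |∏ i ∈ s, a i - ∏ i ∈ s, b i| := by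
          rw [← abs_mul, ← abs_mul]; exact abs_add_le _ _
      _ ≤ |a j - b j| * 1 + 1 * ∑ i ∈ s, |a i - b i| := by gcongr
      _ = _ := by ring

/-- Both functions are 1 - x²/2 up to a multiple of x⁴: 5/96 for the cosine, 1/4 for the
exponential. -/
theorem abs_cos_sub_exp_le {x : ℝ} (hx : |x| ≤ 1) :
    |Real.cos x - Real.exp (-(x ^ 2 / 2))| ≤ x ^ 4 := by
  have h1 := Real.cos_bound hx
  have h5 : x ^ 2 ≤ 1 := by rw [← sq_abs]; exact pow_le_one₀ (abs_nonneg _) hx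
  have h2 : |-(x ^ 2 / 2)| ≤ 1 := by
    rw [abs_neg, abs_of_nonneg (by positivity)]; linarith
  have h3 := Real.abs_exp_sub_one_sub_id_le h2
  have h4 : |x| ^ 4 = x ^ 4 := (by decide : Even 4).pow_abs x
  rw [h4] at h1
  have h0 : 0 ≤ x ^ 4 := by positivity
  rw [abs_le] at h1 h3 ⊢
  constructor <;> nlinarith [h1.1, h1.2, h3.1, h3.2]

theorem abs_prod_cos_sub_exp_le {κ : Type*} [Fintype κ] (b : κ → ℝ) (t : ℝ) {δ : ℝ}
    (hb : ∀ i, |b i| ≤ δ) (hδ : |t| * δ ≤ 1) :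
    |∏ i, Real.cos (t * b i) - Real.exp (-(t ^ 2 * (∑ i, b i ^ 2) / 2))| ≤
      t ^ 4 * δ ^ 2 * ∑ i, b i ^ 2 := by
  have h1 : Real.exp (-(t ^ 2 * (∑ i, b i ^ 2) / 2)) = ∏ i, Real.exp (-((t * b i) ^ 2 / 2)) := by
    rw [← Real.exp_sum, Finset.sum_neg_distrib, ← Finset.sum_div]
    simp only [mul_pow, Finset.mul_sum]
  rw [h1]
  refine (abs_prod_sub_prod_le _ (fun i _ => Real.abs_cos_le_one _) fun i _ => ?_).trans ?_
  · rw [Real.abs_exp, Real.exp_le_one_iff]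
    have := sq_nonneg (t * b i)
    linarith
  · rw [Finset.mul_sum]
    refine Finset.sum_le_sum fun i _ => ?_
    have h2 : |t * b i| ≤ 1 := by
      rw [abs_mul]
      exact (mul_le_mul_of_nonneg_left (hb i) (abs_nonneg t)).trans hδ
    refine (abs_cos_sub_exp_le h2).trans ?_
    have h3 : b i ^ 2 ≤ δ ^ 2 := by
      rw [← sq_abs (b i)]; exact pow_le_pow_left₀ (abs_nonneg _) (hb i) 2
    calc (t * b i) ^ 4 = t ^ 4 * b i ^ 2 * b i ^ 2 := by ring
      _ ≤ t ^ 4 * δ ^ 2 * b i ^ 2 := by gcongr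

end Probability

/-! ### Convergence to the Gaussian by comparison of moments -/

section Convergence

variable {Ω ι : ℕ → Type*} [∀ g, Fintype (Ω g)] [∀ g, Fintype (ι g)]
  [∀ g, DecidableEq (ι g)]

theorem tendsto_expect_cexp_rademacherSum (b : ∀ g, ι g → ℝ)
    (hV : Tendsto (fun g => ∑ i, b g i ^ 2) atTop (𝓝 1)) {δ : ℕ → ℝ} (hδ : Tendsto δ atTop (𝓝 0))
    (hb : ∀ᶠ g in atTop, ∀ i, |b g i| ≤ δ g) (t : ℝ) :
    Tendsto (fun g => 𝔼 ε, Complex.exp ((t * rademacherSum (b g) ε : ℝ) * Complex.I)) atTop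
      (𝓝 ((Real.exp (-(t ^ 2 / 2)) : ℝ) : ℂ)) := by
  simp only [expect_cexp_rademacherSum]
  refine (Complex.continuous_ofReal.tendsto _).comp ?_
  have h1 : Tendsto (fun g => Real.exp (-(t ^ 2 * (∑ i, b g i ^ 2) / 2))) atTop
      (𝓝 (Real.exp (-(t ^ 2 / 2)))) := by
    have h := (((hV.const_mul (t ^ 2)).div_const 2).neg).rexp
    rwa [mul_one] at h
  have h2 : Tendsto (fun g => t ^ 4 * δ g ^ 2 * ∑ i, b g i ^ 2) atTop (𝓝 0) := by
    have h := ((hδ.pow 2).const_mul (t ^ 4)).mul hV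
    simpa using h
  have h3 : Tendsto (fun g => ∏ i, Real.cos (t * b g i) -
      Real.exp (-(t ^ 2 * (∑ i, b g i ^ 2) / 2))) atTop (𝓝 0) := by
    refine squeeze_zero_norm' ?_ h2
    have h4 : Tendsto (fun g => |t| * δ g) atTop (𝓝 0) := by simpa using hδ.const_mul |t|
    filter_upwards [hb, h4.eventually_le_const zero_lt_one] with g hg hg'
    exact abs_prod_cos_sub_exp_le (b g) t hg hg'
  simpa using h3.add h1

/-- A sequence whose moments are asymptotic to those of Rademacher sums of asymptotic variance `1`
with uniformly small coefficients has Gaussian limiting characteristic function. -/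
theorem tendsto_expect_cexp_of_moments (X : ∀ g, Ω g → ℝ) (b : ∀ g, ι g → ℝ)
    (hV : Tendsto (fun g => ∑ i, b g i ^ 2) atTop (𝓝 1)) {δ : ℕ → ℝ} (hδ : Tendsto δ atTop (𝓝 0))
    (hb : ∀ᶠ g in atTop, ∀ i, |b g i| ≤ δ g)
    (hmom : ∀ r : ℕ, Tendsto (fun g => 𝔼 ω, X g ω ^ r - 𝔼 ε, rademacherSum (b g) ε ^ r) atTop
      (𝓝 0)) (t : ℝ) :
    Tendsto (fun g => 𝔼 ω, Complex.exp ((t * X g ω : ℝ) * Complex.I)) atTop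
      (𝓝 ((Real.exp (-(t ^ 2 / 2)) : ℝ) : ℂ)) := by
  have h0 := tendsto_expect_cexp_rademacherSum b hV hδ hb t
  suffices h : Tendsto (fun g => 𝔼 ω, Complex.exp ((t * X g ω : ℝ) * Complex.I) -
      𝔼 ε, Complex.exp ((t * rademacherSum (b g) ε : ℝ) * Complex.I)) atTop (𝓝 0) by
    simpa using h.add h0
  rw [Metric.tendsto_nhds]
  intro η hη
  -- This L gives |t|/L ≤ 1/2. Once Σ b² ≤ 2, the Rademacher part of the remainder is at most 4
  -- e^(L²) (1/2)^(2m), uniformly in g, so m can be fixed before g tends to infinity.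
  set L := 2 * |t| + 1 with hL
  have hLpos : 0 < L := by positivity
  have hratio : |t| / L ≤ 1 / 2 := by
    rw [div_le_div_iff₀ hLpos two_pos]; linarith
  obtain ⟨m, hm⟩ : ∃ m : ℕ, 4 * Real.exp (L ^ 2) * (1 / 2 : ℝ) ^ (2 * m) < η / 2 := by
    have h1 : Tendsto (fun m : ℕ => 4 * Real.exp (L ^ 2) * ((1 / 2 : ℝ) ^ 2) ^ m) atTop (𝓝 0) := by
      have h := (tendsto_pow_atTop_nhds_zero_of_lt_one (r := (1 / 2 : ℝ) ^ 2) (by norm_num)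
        (by norm_num)).const_mul (4 * Real.exp (L ^ 2))
      rwa [mul_zero] at h
    obtain ⟨m, hm⟩ := (h1.eventually_lt_const (half_pos hη)).exists
    exact ⟨m, by rwa [pow_mul]⟩
  have hlim : Tendsto (fun g => ∑ k ∈ Finset.range (2 * m), |t| ^ k / k.factorial *
      |𝔼 ω, X g ω ^ k - 𝔼 ε, rademacherSum (b g) ε ^ k| +
      |t| ^ (2 * m) / (2 * m).factorial *
        (𝔼 ω, X g ω ^ (2 * m) - 𝔼 ε, rademacherSum (b g) ε ^ (2 * m))) atTop (𝓝 0) := by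
    have h1 := (tendsto_finsetSum (Finset.range (2 * m)) fun k _ =>
      ((hmom k).abs.const_mul (|t| ^ k / k.factorial))).add
      ((hmom (2 * m)).const_mul (|t| ^ (2 * m) / (2 * m).factorial))
    simpa using h1
  filter_upwards [hlim.eventually_lt_const (half_pos hη), hV.eventually_le_const one_lt_two]
    with g hg1 hg2
  rw [dist_zero_right]
  refine (norm_expect_exp_sub_expect_exp_le _ _ t m).trans_lt ?_
  have h1 := expect_rademacherSum_pow_le (b g) m hLpos
  have h2 : |t| ^ (2 * m) / (2 * m).factorial * (2 * 𝔼 ε, rademacherSum (b g) ε ^ (2 * m)) ≤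
      4 * Real.exp (L ^ 2) * (1 / 2 : ℝ) ^ (2 * m) := by
    have h3 : Real.exp (L ^ 2 * (∑ i, b g i ^ 2) / 2) ≤ Real.exp (L ^ 2) := by
      rw [Real.exp_le_exp]
      nlinarith [sq_nonneg L]
    calc _ ≤ |t| ^ (2 * m) / (2 * m).factorial * (2 * (2 * (2 * m).factorial / L ^ (2 * m) *
          Real.exp (L ^ 2))) := by
          gcongr
          exact h1.trans (by gcongr)
      _ = 4 * Real.exp (L ^ 2) * (|t| / L) ^ (2 * m) := by
          have : ((2 * m).factorial : ℝ) ≠ 0 := by exact_mod_cast Nat.factorial_ne_zero _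
          rw [div_pow]
          field_simp
          ring
      _ ≤ _ := by gcongr
  rw [mul_add]
  linarith

theorem integral_uniformOn_univ {Ω : Type*} [Fintype Ω] [Nonempty Ω] [MeasurableSpace Ω]
    [MeasurableSingletonClass Ω] (f : Ω → ℂ) : ∫ ω, f ω ∂(uniformOn Set.univ) = 𝔼 ω, f ω := by
  rw [uniformOn, ProbabilityTheory.cond, Measure.restrict_univ, integral_smul_measure,
    integral_countable (by simp), Fintype.expect_eq_sum_div_card]
  simp [Measure.count_univ, div_eq_inv_mul]

theorem tendstoInDistribution_gaussian_of_moments [∀ g, Nonempty (Ω g)]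
    [∀ g, MeasurableSpace (Ω g)] [∀ g, DiscreteMeasurableSpace (Ω g)]
    (X : ∀ g, Ω g → ℝ) (b : ∀ g, ι g → ℝ)
    (hV : Tendsto (fun g => ∑ i, b g i ^ 2) atTop (𝓝 1)) {δ : ℕ → ℝ} (hδ : Tendsto δ atTop (𝓝 0))
    (hb : ∀ᶠ g in atTop, ∀ i, |b g i| ≤ δ g)
    (hmom : ∀ r : ℕ, Tendsto (fun g => 𝔼 ω, X g ω ^ r - 𝔼 ε, rademacherSum (b g) ε ^ r) atTop
      (𝓝 0)) :
    TendstoInDistribution X atTop (id : ℝ → ℝ) (fun _ => uniformOn Set.univ)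
      (gaussianReal 0 1) where
  forall_aemeasurable g := Measurable.of_discrete.aemeasurable
  aemeasurable_limit := aemeasurable_id
  tendsto := by
    -- Lévy's continuity theorem.
    refine ProbabilityMeasure.tendsto_iff_tendsto_charFun.2 fun t => ?_
    have h := tendsto_expect_cexp_of_moments X b hV hδ hb hmom t
    simp only [ProbabilityMeasure.coe_mk, Measure.map_id, charFun_gaussianReal]
    convert h using 2 with g
    · rw [charFun_apply_real, integral_map Measurable.of_discrete.aemeasurable (by fun_prop),
        integral_uniformOn_univ]
      simp
    · push_cast
      congr 1
      simp

end Convergence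

/-! ### The quadratic residue symbol -/

section ResidueSymbol

variable {F : Type*} [Field F]

theorem residueSymbol_eq_zero {f P : F[X]} (h : P ∣ f) : residueSymbol f P = 0 := if_pos h

theorem residueSymbol_sq {f P : F[X]} (h : ¬P ∣ f) : residueSymbol f P ^ 2 = 1 := by
  unfold residueSymbol
  rw [if_neg h]
  split_ifs <;> simp

theorem abs_residueSymbol_le (f P : F[X]) : |residueSymbol f P| ≤ 1 := by
  unfold residueSymbol
  split_ifs <;> simp

theorem natCard_adjoinRoot {P : F[X]} (hP : Irreducible P) :
    Nat.card (AdjoinRoot P) = Nat.card F ^ P.natDegree := by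
  have := (AdjoinRoot.powerBasis hP.ne_zero).finite
  rw [Module.natCard_eq_pow_finrank (K := F), (AdjoinRoot.powerBasis hP.ne_zero).finrank,
    AdjoinRoot.powerBasis_dim]

variable [Finite F]

theorem three_le_natCard_of_odd (hF : Odd (Nat.card F)) : 3 ≤ Nat.card F := by
  have := Finite.one_lt_card (α := F)
  obtain ⟨k, hk⟩ := hF
  omega

/-- Euler's criterion in the finite field F[X]/(P), whose order is odd. Multiplicativity, dependence
on the class modulo P alone and the existence of non-residues all follow from this identification.
-/
theorem exists_quadraticChar_eq_residueSymbol (hF : Odd (Nat.card F)) {P : F[X]}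
    (hP : Irreducible P) :
    ∃ χ : MulChar (AdjoinRoot P) ℤ, (∀ f, residueSymbol f P = χ (AdjoinRoot.mk P f)) ∧
      (∃ u, χ u = -1) := by
  classical
  have : Fact (Irreducible P) := ⟨hP⟩
  have := (AdjoinRoot.powerBasis hP.ne_zero).finite
  have : Finite (AdjoinRoot P) := Module.finite_of_finite F
  let _ : Fintype (AdjoinRoot P) := Fintype.ofFinite _
  have hcard : Fintype.card (AdjoinRoot P) = Nat.card F ^ P.natDegree := by
    rw [← Nat.card_eq_fintype_card, natCard_adjoinRoot hP]
  have hodd : Odd (Nat.card F ^ P.natDegree) := hF.pow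
  have hchar : ringChar (AdjoinRoot P) ≠ 2 := by
    rw [Ne, FiniteField.even_card_iff_char_two, hcard]
    have := Nat.odd_iff.1 hodd
    omega
  refine ⟨quadraticChar (AdjoinRoot P), fun f => ?_, quadraticChar_exists_neg_one hchar⟩
  unfold residueSymbol
  split_ifs with h1 h2
  · rw [AdjoinRoot.mk_eq_zero.2 h1, quadraticChar_zero, Int.cast_zero]
  all_goals
    rw [quadraticChar_eq_pow_of_char_ne_two hchar (by rwa [Ne, AdjoinRoot.mk_eq_zero]), hcard]
    have h3 : Nat.card F ^ P.natDegree / 2 = (Nat.card F ^ P.natDegree - 1) / 2 := by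
      obtain ⟨k, hk⟩ := hodd
      omega
    rw [h3, ← map_pow]
    have h4 : (AdjoinRoot.mk P) (f ^ ((Nat.card F ^ P.natDegree - 1) / 2)) = 1 ↔
        P ∣ f ^ ((Nat.card F ^ P.natDegree - 1) / 2) - 1 := by
      rw [← AdjoinRoot.mk_eq_zero, map_sub, map_one, sub_eq_zero]
    simp only [h4, h2, if_true, if_false]
    simp

theorem residueSymbol_mul (hF : Odd (Nat.card F)) {P : F[X]} (hP : Irreducible P) (f h : F[X]) :
    residueSymbol (f * h) P = residueSymbol f P * residueSymbol h P := by
  obtain ⟨χ, h1, -⟩ := exists_quadraticChar_eq_residueSymbol hF hP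
  rw [h1, h1, h1, map_mul, map_mul, Int.cast_mul]

theorem residueSymbol_congr (hF : Odd (Nat.card F)) {P : F[X]} (hP : Irreducible P) {f h : F[X]}
    (hfh : P ∣ f - h) : residueSymbol f P = residueSymbol h P := by
  obtain ⟨χ, h1, -⟩ := exists_quadraticChar_eq_residueSymbol hF hP
  rw [h1, h1]
  congr 2
  rwa [← sub_eq_zero, ← map_sub, AdjoinRoot.mk_eq_zero]

theorem residueSymbol_one (hF : Odd (Nat.card F)) {P : F[X]} (hP : Irreducible P) :
    residueSymbol 1 P = 1 := by
  obtain ⟨χ, h1, -⟩ := exists_quadraticChar_eq_residueSymbol hF hP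
  rw [h1, map_one, map_one, Int.cast_one]

theorem exists_residueSymbol_eq_neg_one (hF : Odd (Nat.card F)) {P : F[X]} (hP : Irreducible P) :
    ∃ u, residueSymbol u P = -1 := by
  obtain ⟨χ, h1, u, hu⟩ := exists_quadraticChar_eq_residueSymbol hF hP
  obtain ⟨f, rfl⟩ := AdjoinRoot.mk_surjective u
  exact ⟨f, by rw [h1, hu]; simp⟩

end ResidueSymbol

/-! ### Sums over monic and over square-free polynomials -/

section Monic

variable (F : Type*) [Field F] [Finite F]

/-- The monic polynomials of degree `n`. -/
def monicsOfDegree (n : ℕ) : Finset F[X] :=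
  ((finite_natDegree_le F n).subset
    (fun _ h => h.2.le : {P : F[X] | P.Monic ∧ P.natDegree = n} ⊆ _)).toFinset

/-- The monic square-free polynomials of degree `n`. -/
def squarefreesOfDegree (n : ℕ) : Finset F[X] :=
  (Set.toFinite (squarefreeFamily F n)).toFinset

variable {F}

@[simp] theorem mem_monicsOfDegree {n : ℕ} {Q : F[X]} :
    Q ∈ monicsOfDegree F n ↔ Q.Monic ∧ Q.natDegree = n := by
  simp [monicsOfDegree]

@[simp] theorem mem_squarefreesOfDegree {n : ℕ} {Q : F[X]} :
    Q ∈ squarefreesOfDegree F n ↔ Q.Monic ∧ Squarefree Q ∧ Q.natDegree = n := by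
  simp [squarefreesOfDegree, squarefreeFamily]

theorem squarefreesOfDegree_subset (n : ℕ) : squarefreesOfDegree F n ⊆ monicsOfDegree F n := by
  intro Q hQ
  rw [mem_squarefreesOfDegree] at hQ
  exact mem_monicsOfDegree.2 ⟨hQ.1, hQ.2.2⟩

variable (F) in
theorem card_monicsOfDegree (n : ℕ) : (monicsOfDegree F n).card = Nat.card F ^ n := by
  have h1 : Nat.card (degreeLT F n) = Nat.card F ^ n := by
    rw [Nat.card_congr (degreeLTEquiv F n).toEquiv, Nat.card_fun,
      Nat.card_eq_fintype_card (α := Fin n), Fintype.card_fin]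
  have h2 : Nat.card (monicsOfDegree F n) = (monicsOfDegree F n).card := by
    rw [Nat.card_eq_fintype_card, Fintype.card_coe]
  have h3 : ∀ {P : F[X]}, P ∈ degreeLT F n → P.degree < ((X : F[X]) ^ n).degree := by
    intro P hP
    rwa [degree_X_pow, ← mem_degreeLT]
  rw [← h1, ← h2]
  refine Nat.card_congr
    { toFun := fun Q => ⟨(Q : F[X]) - X ^ n, ?_⟩
      invFun := fun P => ⟨X ^ n + (P : F[X]), ?_⟩
      left_inv := fun Q => by simp
      right_inv := fun P => by simp }
  · have hQ := mem_monicsOfDegree.1 Q.2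
    rw [mem_degreeLT]
    have hdeg : (Q : F[X]).degree = ((X : F[X]) ^ n).degree := by
      rw [degree_X_pow, degree_eq_natDegree hQ.1.ne_zero, hQ.2]
    have := degree_sub_lt_left hdeg hQ.1.ne_zero (by rw [hQ.1, (monic_X_pow n).leadingCoeff])
    rwa [degree_eq_natDegree hQ.1.ne_zero, hQ.2] at this
  · rw [mem_monicsOfDegree]
    refine ⟨(monic_X_pow n).add_of_left (h3 P.2), ?_⟩
    rw [natDegree_eq_of_degree_eq (degree_add_eq_left_of_degree_lt (h3 P.2)), natDegree_X_pow]

/-- Changing a monic polynomial of degree `n` by its residues modulo `h`, `deg h ≤ n`. -/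
theorem add_mod_mem_monicsOfDegree {n : ℕ} {h : F[X]} (hm : h.Monic) (hn : h.natDegree ≤ n)
    {Q : F[X]} (hQ : Q ∈ monicsOfDegree F n) (R : F[X]) :
    Q + (R - Q) %ₘ h ∈ monicsOfDegree F n := by
  rw [mem_monicsOfDegree] at hQ ⊢
  have h1 : ((R - Q) %ₘ h).degree < Q.degree := by
    refine (degree_modByMonic_lt _ hm).trans_le ?_
    rw [degree_eq_natDegree hQ.1.ne_zero, degree_eq_natDegree hm.ne_zero, hQ.2]
    exact_mod_cast hn
  refine ⟨hQ.1.add_of_left h1, ?_⟩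
  rw [natDegree_eq_of_degree_eq (degree_add_eq_left_of_degree_lt h1), hQ.2]

/-- A function which depends on the residue modulo `h` only and changes its sign under
multiplication by some `U` coprime to `h` has zero sum over the monic polynomials of any given
degree `n ≥ deg h`. -/
theorem sum_monicsOfDegree_eq_zero {n : ℕ} {h : F[X]} (hm : h.Monic) (hn : h.natDegree ≤ n)
    (Ψ : F[X] → ℝ) (hΨ : ∀ Q R, h ∣ Q - R → Ψ Q = Ψ R) {U : F[X]} (hU : IsCoprime h U)
    (hUΨ : ∀ Q, Ψ (U * Q) = -Ψ Q) : ∑ Q ∈ monicsOfDegree F n, Ψ Q = 0 := by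
  classical
  -- σ Q is congruent to U Q modulo h and differs from Q only in degrees below deg h ≤ n. It
  -- permutes the monic polynomials of degree n, and Ψ ∘ σ = -Ψ.
  set σ : F[X] → F[X] := fun Q => Q + (U * Q - Q) %ₘ h with hσ
  have hdvd : ∀ Q, h ∣ σ Q - U * Q := by
    intro Q
    have h1 := modByMonic_add_div (U * Q - Q) h
    refine ⟨-((U * Q - Q) /ₘ h), ?_⟩
    simp only [hσ]
    linear_combination h1
  have hmem : ∀ Q ∈ monicsOfDegree F n, σ Q ∈ monicsOfDegree F n := fun Q hQ =>
    add_mod_mem_monicsOfDegree hm hn hQ _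
  have hinj : Set.InjOn σ (monicsOfDegree F n) := by
    intro Q _ R _ hQR
    have h1 : h ∣ U * (Q - R) := by
      have := dvd_sub (hdvd R) (hdvd Q)
      rw [← hQR] at this
      convert this using 1
      ring
    -- U is invertible modulo h, so σ Q = σ R forces Q ≡ R; the two correction terms then coincide.
    have h2 : h ∣ Q - R := hU.dvd_of_dvd_mul_left h1
    have h3 : (U * Q - Q) %ₘ h = (U * R - R) %ₘ h := by
      rw [← sub_eq_zero, ← sub_modByMonic, modByMonic_eq_zero_iff_dvd hm]
      convert dvd_mul_of_dvd_right h2 (U - 1) using 1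
      ring
    simp only [hσ] at hQR
    rw [h3] at hQR
    exact add_right_cancel hQR
  have himg : (monicsOfDegree F n).image σ = monicsOfDegree F n :=
    Finset.eq_of_subset_of_card_le (Finset.image_subset_iff.2 hmem)
      (Finset.card_image_of_injOn hinj).ge
  have h1 : ∑ Q ∈ monicsOfDegree F n, Ψ Q = ∑ Q ∈ monicsOfDegree F n, Ψ (σ Q) := by
    conv_lhs => rw [← himg]
    exact Finset.sum_image hinj
  have h2 : ∑ Q ∈ monicsOfDegree F n, Ψ (σ Q) = -∑ Q ∈ monicsOfDegree F n, Ψ Q := by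
    rw [← Finset.sum_neg_distrib]
    exact Finset.sum_congr rfl fun Q _ => by rw [hΨ _ _ (hdvd Q), hUΨ]
  linarith

/-- By the Chinese remainder theorem some U is a non-residue modulo P and 1 modulo all the other
primes of the tuple. Multiplication by U multiplies the product of symbols by (-1) to the
multiplicity of P, which is -1. -/
theorem sum_monicsOfDegree_prod_residueSymbol_eq_zero [DecidableEq F[X]]
    (hF : Odd (Nat.card F)) {r n : ℕ}
    (p : Fin r → F[X]) (hp : ∀ i, (p i).Monic ∧ Irreducible (p i))
    (hn : ∑ i, (p i).natDegree ≤ n) {P : F[X]}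
    (hodd : Odd (Finset.univ.filter fun i => p i = P).card) :
    ∑ Q ∈ monicsOfDegree F n, ∏ i, residueSymbol Q (p i) = 0 := by
  obtain ⟨i₀, hi₀⟩ : ∃ i₀, p i₀ = P := by
    obtain ⟨i, hi⟩ := Finset.card_pos.1 hodd.pos
    exact ⟨i, (Finset.mem_filter.1 hi).2⟩
  have hPm : P.Monic := hi₀ ▸ (hp i₀).1
  have hPi : Irreducible P := hi₀ ▸ (hp i₀).2
  set s := Finset.univ.filter fun i => p i ≠ P with hs
  set R := ∏ i ∈ s, p i with hR
  have hRm : R.Monic := monic_prod_of_monic _ _ fun i _ => (hp i).1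
  have hcop : IsCoprime P R := by
    refine IsCoprime.prod_right fun i hi => ?_
    rw [hPi.coprime_iff_not_dvd]
    intro hdvd
    exact (Finset.mem_filter.1 hi).2
      (eq_of_monic_of_associated (hp i).1 hPm (hPi.associated_of_dvd (hp i).2 hdvd).symm)
  obtain ⟨u, hu⟩ := exists_residueSymbol_eq_neg_one hF hPi
  obtain ⟨a, b, hab⟩ := hcop
  -- With a P + b R = 1, this is u modulo P and 1 modulo R.
  set U := u * (b * R) + a * P with hU
  have hUP : P ∣ U - u := ⟨a * (1 - u), by rw [hU]; linear_combination u * hab⟩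
  have hUR : R ∣ U - 1 := ⟨b * (u - 1), by rw [hU]; linear_combination hab⟩
  have hsymP : residueSymbol U P = -1 := by rw [residueSymbol_congr hF hPi hUP, hu]
  have hsymR : ∀ i, p i ≠ P → residueSymbol U (p i) = 1 := by
    intro i hi
    have : p i ∣ R := Finset.dvd_prod_of_mem p (Finset.mem_filter.2 ⟨Finset.mem_univ i, hi⟩)
    rw [residueSymbol_congr hF (hp i).2 (this.trans hUR), residueSymbol_one hF (hp i).2]
  have hdvd : ∀ i, p i ∣ P * R := by
    intro i
    by_cases hi : p i = P
    · rw [hi]; exact dvd_mul_right _ _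
    · exact dvd_mul_of_dvd_right
        (Finset.dvd_prod_of_mem p (Finset.mem_filter.2 ⟨Finset.mem_univ i, hi⟩)) P
  have hprodU : ∏ i, residueSymbol U (p i) = -1 := by
    rw [← Finset.prod_filter_mul_prod_filter_not Finset.univ (fun i => p i = P)]
    have h1 : ∏ i ∈ Finset.univ.filter (fun i => p i = P), residueSymbol U (p i) = -1 := by
      rw [Finset.prod_congr rfl (g := fun _ => (-1 : ℝ)) fun i hi => by
        rw [(Finset.mem_filter.1 hi).2, hsymP], Finset.prod_const, hodd.neg_one_pow]
    rw [h1, Finset.prod_eq_one fun i hi => hsymR i (Finset.mem_filter.1 hi).2, mul_one]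
  refine sum_monicsOfDegree_eq_zero (h := P * R) (U := U) (hPm.mul hRm) ?_ _ ?_ ?_ ?_
  · rw [hPm.natDegree_mul hRm, hR, natDegree_prod_of_monic _ _ fun i _ => (hp i).1]
    refine le_trans ?_ hn
    -- The modulus P R uses P once, charged to the index i₀, and every other prime with its
    -- multiplicity, so its degree is at most the sum of all the degrees.
    have hnot : i₀ ∉ s := by simp [hs, hi₀]
    rw [← hi₀, ← Finset.sum_insert (f := fun i => (p i).natDegree) hnot]
    exact Finset.sum_le_sum_of_subset (Finset.subset_univ _)
  · intro Q Q' hQ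
    exact Finset.prod_congr rfl fun i _ => residueSymbol_congr hF (hp i).2 ((hdvd i).trans hQ)
  -- U is coprime to P because its symbol there is -1 and not 0, and to R because it is 1 modulo R.
  · refine IsCoprime.mul_left ?_ ?_
    · rw [hPi.coprime_iff_not_dvd]
      intro h
      rw [residueSymbol_eq_zero h] at hsymP
      norm_num at hsymP
    · obtain ⟨c, hc⟩ := hUR
      exact ⟨-c, 1, by linear_combination hc⟩
  · intro Q
    simp only [residueSymbol_mul hF (hp _).2]
    rw [Finset.prod_mul_distrib, hprodU, neg_one_mul]

end Monic

/-! ### Passage from monic to square-free polynomials -/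

section SquarefreePart

variable {F : Type*} [Field F]

theorem exists_sq_mul_squarefree {Q : F[X]} (hQ : Q.Monic) :
    ∃ D M : F[X], D.Monic ∧ M.Monic ∧ Squarefree M ∧ D ^ 2 * M = Q := by
  induction hn : Q.natDegree using Nat.strong_induction_on generalizing Q with
  | _ n ih =>
    by_cases hsq : Squarefree Q
    · exact ⟨1, Q, monic_one, hQ, hsq, by ring⟩
    · simp only [Squarefree, not_forall] at hsq
      obtain ⟨x, ⟨y, hy⟩, hx⟩ := hsq
      have hx0 : x ≠ 0 := by
        rintro rfl
        exact hQ.ne_zero (by rw [hy]; ring)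
      obtain ⟨c, hc, hc0⟩ : ∃ c : F, (C c * x).Monic ∧ c ≠ 0 :=
        ⟨x.leadingCoeff⁻¹, by rw [mul_comm]; exact monic_mul_leadingCoeff_inv hx0,
          inv_ne_zero (leadingCoeff_ne_zero.2 hx0)⟩
      -- The square factor is made monic and the constant c⁻² moves to the cofactor, which is then
      -- monic too; its degree drops because x is not a unit.
      set D := C c * x with hD
      have hQD : D ^ 2 * (C (c⁻¹ ^ 2) * y) = Q := by
        have : C c * C c⁻¹ = 1 := by rw [← C_mul, mul_inv_cancel₀ hc0, C_1]
        rw [hD, hy, C_pow]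
        linear_combination (x ^ 2 * y) * (C c * C c⁻¹ + 1) * this
      have hD2 : (D ^ 2).Monic := hc.pow 2
      have hM : (C (c⁻¹ ^ 2) * y).Monic := hD2.of_mul_monic_left (by rw [hQD]; exact hQ)
      have hdegD : 0 < D.natDegree := by
        rw [Nat.pos_iff_ne_zero]
        intro h
        have h1 := hc.natDegree_eq_zero.1 h
        exact hx (isUnit_of_mul_isUnit_right (x := C c) (by rw [← hD, h1]; exact isUnit_one))
      have hdeg : (C (c⁻¹ ^ 2) * y).natDegree < n := by
        rw [← hn, ← hQD, hD2.natDegree_mul hM, hc.natDegree_pow]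
        omega
      obtain ⟨D', M, h1, h2, h3, h4⟩ := ih _ hdeg hM rfl
      refine ⟨D * D', M, hc.mul h1, h2, h3, ?_⟩
      rw [← hQD, ← h4]
      ring

/-- Cancelling the gcd gives a² M = b² M' with a, b coprime. Then a² divides the square-free M', so
a is a unit. -/
theorem dvd_of_sq_mul_eq_sq_mul_squarefree {D D' M M' : F[X]} (hD' : D' ≠ 0)
    (hM' : Squarefree M') (h : D ^ 2 * M = D' ^ 2 * M') : D ∣ D' := by
  classical
  obtain ⟨a, b, hab, ha, hb⟩ : ∃ a b, IsCoprime a b ∧ D = EuclideanDomain.gcd D D' * a ∧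
      D' = EuclideanDomain.gcd D D' * b := by
    obtain ⟨a, ha⟩ := EuclideanDomain.gcd_dvd_left D D'
    obtain ⟨b, hb⟩ := EuclideanDomain.gcd_dvd_right D D'
    refine ⟨a, b, ?_, ha, hb⟩
    have hg : EuclideanDomain.gcd D D' ≠ 0 := by
      intro h0
      rw [h0, zero_mul] at hb
      exact hD' hb
    have h1 := EuclideanDomain.gcd_eq_gcd_ab D D'
    refine ⟨EuclideanDomain.gcdA D D', EuclideanDomain.gcdB D D', ?_⟩
    apply mul_left_cancel₀ hg
    linear_combination -h1 - EuclideanDomain.gcdA D D' * ha - EuclideanDomain.gcdB D D' * hb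
  set G := EuclideanDomain.gcd D D'
  have hG : G ^ 2 ≠ 0 := by
    refine pow_ne_zero 2 ?_
    intro h0
    rw [h0, zero_mul] at hb
    exact hD' hb
  have h1 : a ^ 2 * M = b ^ 2 * M' := by
    apply mul_left_cancel₀ hG
    rw [ha, hb] at h
    linear_combination h
  have h2 : a * a ∣ M' := by
    rw [← sq]
    exact (hab.pow (m := 2) (n := 2)).dvd_of_dvd_mul_left (Dvd.intro _ h1)
  rw [ha, hb]
  exact mul_dvd_mul_left G ((hM' a h2).dvd)

theorem sq_mul_squarefree_injective {D D' M M' : F[X]} (hD : D.Monic) (hD' : D'.Monic)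
    (hM : Squarefree M) (hM' : Squarefree M') (h : D ^ 2 * M = D' ^ 2 * M') :
    D = D' ∧ M = M' := by
  have h1 : D = D' := eq_of_monic_of_associated hD hD' (associated_of_dvd_dvd
    (dvd_of_sq_mul_eq_sq_mul_squarefree hD'.ne_zero hM' h)
    (dvd_of_sq_mul_eq_sq_mul_squarefree hD.ne_zero hM h.symm))
  refine ⟨h1, ?_⟩
  rw [h1] at h
  exact mul_left_cancel₀ (pow_ne_zero 2 hD'.ne_zero) h

variable [Finite F]

/-- Each monic Q is D²M with M square-free in exactly one way, and Ψ(D²M) = Ψ(D)² Ψ(M). The formula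
is a recursion for the square-free sums in terms of the complete ones. -/
theorem sum_monicsOfDegree_eq_sum_squarefreesOfDegree (Ψ : F[X] → ℝ)
    (hΨ : ∀ f h, Ψ (f * h) = Ψ f * Ψ h) (n : ℕ) :
    ∑ Q ∈ monicsOfDegree F n, Ψ Q = ∑ d ∈ Finset.range (n / 2 + 1),
      (∑ D ∈ monicsOfDegree F d, Ψ D ^ 2) * ∑ M ∈ squarefreesOfDegree F (n - 2 * d), Ψ M := by
  simp only [Finset.sum_mul_sum, ← Finset.sum_product', Finset.sum_sigma']
  symm
  refine Finset.sum_bij (fun x _ => x.2.1 ^ 2 * x.2.2) ?_ ?_ ?_ ?_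
  · rintro ⟨d, D, M⟩ hx
    simp only [Finset.mem_sigma, Finset.mem_product, Finset.mem_range, mem_monicsOfDegree,
      mem_squarefreesOfDegree] at hx ⊢
    obtain ⟨hd, ⟨h1, h2⟩, h3, h4, h5⟩ := hx
    refine ⟨(h1.pow 2).mul h3, ?_⟩
    rw [(h1.pow 2).natDegree_mul h3, h1.natDegree_pow, h2, h5]
    omega
  · rintro ⟨d, D, M⟩ hx ⟨d', D', M'⟩ hx' h
    simp only [Finset.mem_sigma, Finset.mem_product, Finset.mem_range, mem_monicsOfDegree,
      mem_squarefreesOfDegree] at hx hx'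
    obtain ⟨rfl, rfl⟩ := sq_mul_squarefree_injective hx.2.1.1 hx'.2.1.1 hx.2.2.2.1 hx'.2.2.2.1 h
    obtain rfl : d = d' := hx.2.1.2.symm.trans hx'.2.1.2
    rfl
  · intro Q hQ
    rw [mem_monicsOfDegree] at hQ
    obtain ⟨D, M, hD, hM, hsq, h⟩ := exists_sq_mul_squarefree hQ.1
    have hdeg : 2 * D.natDegree + M.natDegree = n := by
      rw [← hQ.2, ← h, (hD.pow 2).natDegree_mul hM, hD.natDegree_pow]
    refine ⟨⟨D.natDegree, D, M⟩, ?_, h⟩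
    simp only [Finset.mem_sigma, Finset.mem_product, Finset.mem_range, mem_monicsOfDegree,
      mem_squarefreesOfDegree]
    exact ⟨by omega, ⟨hD, trivial⟩, hM, hsq, by omega⟩
  · rintro ⟨d, D, M⟩ _
    simp only [hΨ, sq]

theorem abs_sum_squarefreesOfDegree_le_pow (Ψ : F[X] → ℝ) (hle : ∀ f, |Ψ f| ≤ 1) (n : ℕ) :
    |∑ M ∈ squarefreesOfDegree F n, Ψ M| ≤ (Nat.card F : ℝ) ^ n := by
  refine (Finset.abs_sum_le_sum_abs _ _).trans ((Finset.sum_le_card_nsmul _ _ 1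
    fun M _ => hle M).trans ?_)
  rw [nsmul_eq_mul, mul_one]
  have := Finset.card_le_card (squarefreesOfDegree_subset (F := F) n)
  rw [card_monicsOfDegree] at this
  exact_mod_cast this

theorem sum_half_pow_le_one (n : ℕ) : ∑ d ∈ Finset.range n, (1 / 2 : ℝ) ^ (d + 1) ≤ 1 := by
  have h : ∑ d ∈ Finset.range n, (1 / 2 : ℝ) ^ (d + 1) = 1 - (1 / 2) ^ n := by
    induction n with
    | zero => simp
    | succ n ih => rw [Finset.sum_range_succ, ih]; ring
  rw [h]
  have : (0 : ℝ) ≤ (1 / 2) ^ n := by positivity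
  linarith

/-- For n ≥ N the complete sum vanishes, so the square-free sum S(n) is minus the sum over d ≥ 1 of
(Σ Ψ(D)²) S(n - 2d), with inner factor at most q^d. The base 2q, rather than q, makes the induction
close: the weights q^d (2q)^(-d) = 2^(-d) add up to at most 1. For n < N the trivial bound q^n ≤ q^N
suffices. -/
theorem abs_sum_squarefreesOfDegree_le (Ψ : F[X] → ℝ) (hΨ : ∀ f h, Ψ (f * h) = Ψ f * Ψ h)
    (hle : ∀ f, |Ψ f| ≤ 1) (hone : Ψ 1 = 1) {N : ℕ}
    (hzero : ∀ n, N ≤ n → ∑ Q ∈ monicsOfDegree F n, Ψ Q = 0) (n : ℕ) :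
    |∑ M ∈ squarefreesOfDegree F n, Ψ M| ≤
      (Nat.card F : ℝ) ^ N * (2 * (Nat.card F : ℝ)) ^ (n / 2) := by
  have hq : (1 : ℝ) ≤ Nat.card F := by exact_mod_cast Nat.card_pos
  induction n using Nat.strong_induction_on with
  | _ n ih =>
    rcases lt_or_ge n N with hn | hn
    · refine (abs_sum_squarefreesOfDegree_le_pow Ψ hle n).trans ?_
      refine (pow_le_pow_right₀ hq hn.le).trans ?_
      exact le_mul_of_one_le_right (by positivity) (one_le_pow₀ (by linarith))
    · have h1 := hzero n hn
      rw [sum_monicsOfDegree_eq_sum_squarefreesOfDegree Ψ hΨ, Finset.sum_range_succ'] at h1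
      have h0 : ∑ D ∈ monicsOfDegree F 0, Ψ D ^ 2 = 1 := by
        have : monicsOfDegree F 0 = {1} := by
          ext Q
          rw [mem_monicsOfDegree, Finset.mem_singleton]
          exact ⟨fun h => h.1.natDegree_eq_zero.1 h.2, fun h => by simp [h]⟩
        rw [this, Finset.sum_singleton, hone, one_pow]
      rw [h0, one_mul, mul_zero, Nat.sub_zero] at h1
      rw [eq_neg_of_add_eq_zero_right h1, abs_neg]
      refine (Finset.abs_sum_le_sum_abs _ _).trans ?_
      calc _ ≤ ∑ d ∈ Finset.range (n / 2), (Nat.card F : ℝ) ^ N *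
            (2 * (Nat.card F : ℝ)) ^ (n / 2) * (1 / 2 : ℝ) ^ (d + 1) := by
            refine Finset.sum_le_sum fun d hd => ?_
            rw [Finset.mem_range] at hd
            rw [abs_mul]
            have h2 : |∑ D ∈ monicsOfDegree F (d + 1), Ψ D ^ 2| ≤ (Nat.card F : ℝ) ^ (d + 1) := by
              refine (Finset.abs_sum_le_sum_abs _ _).trans ((Finset.sum_le_card_nsmul _ _ 1
                fun M _ => ?_).trans ?_)
              · rw [abs_pow]; exact pow_le_one₀ (abs_nonneg _) (hle M)
              · rw [nsmul_eq_mul, mul_one, card_monicsOfDegree]; push_cast; rfl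
            have h3 := ih (n - 2 * (d + 1)) (by omega)
            rw [show (n - 2 * (d + 1)) / 2 = n / 2 - (d + 1) by omega] at h3
            have h4 : (2 * (Nat.card F : ℝ)) ^ (n / 2) = (2 * (Nat.card F : ℝ)) ^ (d + 1) *
                (2 * (Nat.card F : ℝ)) ^ (n / 2 - (d + 1)) := by
              rw [← pow_add]; congr 1; omega
            refine (mul_le_mul h2 h3 (abs_nonneg _) (by positivity)).trans (le_of_eq ?_)
            rw [h4, mul_pow 2 _ (d + 1), one_div, inv_pow]
            field_simp
        _ ≤ (Nat.card F : ℝ) ^ N * (2 * (Nat.card F : ℝ)) ^ (n / 2) * 1 := by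
            rw [← Finset.mul_sum]
            exact mul_le_mul_of_nonneg_left (sum_half_pow_le_one _) (by positivity)
        _ = _ := mul_one _

/-- In the decomposition of all q^n monic polynomials, those with deg D = d number at most q^(n-d).
As q ≥ 3, the terms with d ≥ 1 amount to at most q^n Σ 3^(-d) ≤ q^n/2. -/
theorem half_pow_le_card_squarefreesOfDegree (hF : Odd (Nat.card F)) (n : ℕ) :
    (Nat.card F : ℝ) ^ n / 2 ≤ (squarefreesOfDegree F n).card := by
  have hq : (3 : ℝ) ≤ Nat.card F := by exact_mod_cast three_le_natCard_of_odd hF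
  have hq0 : (0 : ℝ) < Nat.card F := by linarith
  have h1 := sum_monicsOfDegree_eq_sum_squarefreesOfDegree (F := F) (fun _ => 1) (by simp) n
  simp only [Finset.sum_const, nsmul_eq_mul, mul_one, one_pow, card_monicsOfDegree] at h1
  rw [Finset.sum_range_succ'] at h1
  simp only [pow_zero, Nat.cast_one, one_mul, mul_zero, Nat.sub_zero, Nat.cast_pow] at h1
  have h2 : ∑ d ∈ Finset.range (n / 2), (Nat.card F : ℝ) ^ (d + 1) *
      ((squarefreesOfDegree F (n - 2 * (d + 1))).card : ℝ) ≤
      ∑ d ∈ Finset.range (n / 2), (Nat.card F : ℝ) ^ n * (1 / 3 : ℝ) ^ (d + 1) := by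
    refine Finset.sum_le_sum fun d hd => ?_
    rw [Finset.mem_range] at hd
    have h3 : ((squarefreesOfDegree F (n - 2 * (d + 1))).card : ℝ) ≤
        (Nat.card F : ℝ) ^ (n - 2 * (d + 1)) := by
      have := Finset.card_le_card (squarefreesOfDegree_subset (F := F) (n - 2 * (d + 1)))
      rw [card_monicsOfDegree] at this
      exact_mod_cast this
    have h4 : (Nat.card F : ℝ) ^ n = (Nat.card F : ℝ) ^ (d + 1) *
        (Nat.card F : ℝ) ^ (n - 2 * (d + 1)) * (Nat.card F : ℝ) ^ (d + 1) := by
      rw [← pow_add, ← pow_add]; congr 1; omega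
    have h5 : 1 ≤ (Nat.card F : ℝ) ^ (d + 1) * (1 / 3 : ℝ) ^ (d + 1) := by
      rw [← mul_pow]
      exact one_le_pow₀ (by linarith)
    calc _ ≤ (Nat.card F : ℝ) ^ (d + 1) * (Nat.card F : ℝ) ^ (n - 2 * (d + 1)) := by gcongr
      _ ≤ (Nat.card F : ℝ) ^ (d + 1) * (Nat.card F : ℝ) ^ (n - 2 * (d + 1)) *
          ((Nat.card F : ℝ) ^ (d + 1) * (1 / 3 : ℝ) ^ (d + 1)) :=
          le_mul_of_one_le_right (by positivity) h5
      _ = _ := by rw [h4]; ring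
  have h6 : ∀ m : ℕ, ∑ d ∈ Finset.range m, (1 / 3 : ℝ) ^ (d + 1) ≤ 1 / 2 := by
    intro m
    have h : ∑ d ∈ Finset.range m, (1 / 3 : ℝ) ^ (d + 1) = 1 / 2 - (1 / 3) ^ m / 2 := by
      induction m with
      | zero => simp
      | succ m ih => rw [Finset.sum_range_succ, ih]; ring
    rw [h]
    have : (0 : ℝ) ≤ (1 / 3) ^ m := by positivity
    linarith
  rw [← Finset.mul_sum] at h2
  have h7 := mul_le_mul_of_nonneg_left (h6 (n / 2)) (pow_pos hq0 n).le
  linarith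

theorem card_filter_dvd_squarefreesOfDegree_le [DecidableEq F[X]] {P : F[X]} (hP : P.Monic)
    [DecidablePred fun Q : F[X] => P ∣ Q] (n : ℕ) :
    (((squarefreesOfDegree F n).filter fun Q => P ∣ Q).card : ℝ) ≤
      (Nat.card F : ℝ) ^ n / (Nat.card F : ℝ) ^ P.natDegree := by
  have hq0 : (0 : ℝ) < Nat.card F := by exact_mod_cast Nat.card_pos
  rcases lt_or_ge n P.natDegree with hn | hn
  · rw [Finset.filter_eq_empty_iff.2, Finset.card_empty, Nat.cast_zero]
    · positivity
    · intro Q hQ hdvd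
      rw [mem_squarefreesOfDegree] at hQ
      have := natDegree_le_of_dvd hdvd hQ.1.ne_zero
      omega
  · have hsub : (squarefreesOfDegree F n).filter (fun Q => P ∣ Q) ⊆
        (monicsOfDegree F (n - P.natDegree)).image (fun M => P * M) := by
      intro Q hQ
      rw [Finset.mem_filter, mem_squarefreesOfDegree] at hQ
      obtain ⟨⟨h1, -, h2⟩, M, rfl⟩ := hQ
      have hM : M.Monic := hP.of_mul_monic_left h1
      rw [hP.natDegree_mul hM] at h2
      exact Finset.mem_image.2 ⟨M, mem_monicsOfDegree.2 ⟨hM, by omega⟩, rfl⟩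
    have h1 := (Finset.card_le_card hsub).trans Finset.card_image_le
    rw [card_monicsOfDegree] at h1
    rw [div_eq_mul_inv, ← pow_sub₀ _ hq0.ne' hn]
    exact_mod_cast h1

end SquarefreePart

/-! ### Comparison of moments with Rademacher sums -/

section Moments

variable {Ω ι : Type*} [Fintype Ω] [Fintype ι] [DecidableEq ι]

open Classical in
theorem expect_prod_boolSign {r : ℕ} (p : Fin r → ι) :
    𝔼 ε : ι → Bool, ∏ k, boolSign (ε (p k)) =
      if ∀ j, Even (Finset.univ.filter fun k => p k = j).card then 1 else 0 := by
  have h1 : ∀ ε : ι → Bool, ∏ k, boolSign (ε (p k)) =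
      ∏ j, boolSign (ε j) ^ (Finset.univ.filter fun k => p k = j).card := by
    intro ε
    rw [← Finset.prod_fiberwise Finset.univ p]
    refine Finset.prod_congr rfl fun j _ => ?_
    rw [Finset.prod_congr rfl (g := fun _ => boolSign (ε j)) fun k hk => by
      rw [(Finset.mem_filter.1 hk).2], Finset.prod_const]
  simp only [h1]
  rw [expect_prod_eq_prod_expect
    (fun j x => boolSign x ^ (Finset.univ.filter fun k => p k = j).card)]
  split_ifs with h
  · refine Finset.prod_eq_one fun j _ => ?_
    simp [boolSign, (h j).neg_one_pow]
  · push Not at h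
    obtain ⟨j, hj⟩ := h
    refine Finset.prod_eq_zero (Finset.mem_univ j) ?_
    simp [boolSign, (Nat.not_even_iff_odd.1 hj).neg_one_pow]

open Classical in
-- The factors may have different coefficients: this allows a weight attached to a single entry of
-- the tuple to be placed in one factor.
theorem expect_prod_rademacherSum {r : ℕ} (f : Fin r → ι → ℝ) :
    𝔼 ε, ∏ k, rademacherSum (f k) ε = ∑ p : Fin r → ι, (∏ k, f k (p k)) *
      if ∀ j, Even (Finset.univ.filter fun k => p k = j).card then 1 else 0 := by
  have h1 : ∀ ε : ι → Bool, ∏ k, rademacherSum (f k) ε =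
      ∑ p : Fin r → ι, (∏ k, f k (p k)) * ∏ k, boolSign (ε (p k)) := by
    intro ε
    have h := Finset.prod_univ_sum (fun _ : Fin r => (Finset.univ : Finset ι))
      (fun k i => f k i * boolSign (ε i))
    rw [Fintype.piFinset_univ] at h
    simp only [rademacherSum]
    rw [h]
    simp only [Finset.prod_mul_distrib]
  simp only [h1]
  rw [Finset.expect_sum_comm]
  refine Finset.sum_congr rfl fun p _ => ?_
  rw [← Finset.mul_expect, expect_prod_boolSign]

theorem abs_rademacherSum_le {κ : Type*} [Fintype κ] (b : κ → ℝ) (ε : κ → Bool) :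
    |rademacherSum b ε| ≤ ∑ i, |b i| := by
  refine (Finset.abs_sum_le_sum_abs _ _).trans (Finset.sum_le_sum fun i _ => ?_)
  rw [abs_mul]
  refine mul_le_of_le_one_right (abs_nonneg _) ?_
  unfold boolSign
  split_ifs <;> simp

/-- Both powers are expanded over tuples. Tuples with an odd multiplicity can be bounded crudely,
since A will be tiny. For even tuples the crude bound (Σ |b|)^(r-1) would be far too large; the
evenness condition is kept by reading the sum over even tuples backwards as a Rademacher
expectation, whose moments are bounded in terms of Σ b² alone. -/
theorem abs_expect_pow_sub_expect_rademacherSum_pow_le (X : ι → Ω → ℝ) (b c : ι → ℝ)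
    (hc : ∀ i, 0 ≤ c i) {A : ℝ} (hA : 0 ≤ A) (r : ℕ)
    (hodd : ∀ p : Fin r → ι, (∃ j, Odd (Finset.univ.filter fun k => p k = j).card) →
      |𝔼 ω, ∏ k, X (p k) ω| ≤ A)
    (heven : ∀ p : Fin r → ι, (∀ j, Even (Finset.univ.filter fun k => p k = j).card) →
      |𝔼 ω, ∏ k, X (p k) ω - 1| ≤ ∑ k, c (p k)) :
    |𝔼 ω, (∑ i, b i * X i ω) ^ r - 𝔼 ε, rademacherSum b ε ^ r| ≤
      A * (∑ i, |b i|) ^ r + r * ((∑ i, |b i| * c i) *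
        (1 + 𝔼 ε, rademacherSum (fun i => |b i|) ε ^ (2 * (r - 1)))) := by
  classical
  set ev : (Fin r → ι) → ℝ := fun p =>
    if ∀ j, Even (Finset.univ.filter fun k => p k = j).card then 1 else 0 with hev
  have h1 : 𝔼 ω, (∑ i, b i * X i ω) ^ r =
      ∑ p : Fin r → ι, (∏ k, b (p k)) * 𝔼 ω, ∏ k, X (p k) ω := by
    simp only [Finset.mul_expect]
    rw [← Finset.expect_sum_comm]
    refine Finset.expect_congr rfl fun ω _ => ?_
    rw [Fintype.sum_pow]
    simp only [Finset.prod_mul_distrib]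
  have h2 : 𝔼 ε, rademacherSum b ε ^ r = ∑ p : Fin r → ι, (∏ k, b (p k)) * ev p := by
    rw [← expect_prod_rademacherSum (fun _ => b)]
    simp
  have h3 : ∀ p : Fin r → ι, |𝔼 ω, ∏ k, X (p k) ω - ev p| ≤ A + ev p * ∑ k, c (p k) := by
    intro p
    simp only [hev]
    split_ifs with h
    · rw [one_mul]
      exact (heven p h).trans (le_add_of_nonneg_left hA)
    · rw [zero_mul, add_zero, sub_zero]
      push Not at h
      obtain ⟨j, hj⟩ := h
      exact hodd p ⟨j, Nat.not_even_iff_odd.1 hj⟩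
  have h4 : ∀ k : Fin r, ∑ p : Fin r → ι, (∏ l, |b (p l)|) * (ev p * c (p k)) ≤
      (∑ i, |b i| * c i) * (1 + 𝔼 ε, rademacherSum (fun i => |b i|) ε ^ (2 * (r - 1))) := by
    intro k
    have h5 := expect_prod_rademacherSum
      (fun l i => |b i| * if l = k then c i else 1)
    -- The weight c (p k) goes into the k-th factor only; the other r - 1 factors are the plain sum
    -- with coefficients |b|.
    have h6 : ∑ p : Fin r → ι, (∏ l, |b (p l)|) * (ev p * c (p k)) =
        𝔼 ε, ∏ l : Fin r, rademacherSum (fun i => |b i| * if l = k then c i else 1) ε := by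
      rw [h5]
      refine Finset.sum_congr rfl fun p _ => ?_
      rw [Finset.prod_mul_distrib, Finset.prod_ite_eq' Finset.univ k (fun l => c (p l)),
        if_pos (Finset.mem_univ k)]
      simp only [hev]
      ring
    rw [h6]
    have h7 : ∀ ε : ι → Bool,
        ∏ l : Fin r, rademacherSum (fun i => |b i| * if l = k then c i else 1) ε ≤
        (∑ i, |b i| * c i) * (1 + rademacherSum (fun i => |b i|) ε ^ (2 * (r - 1))) := by
      intro ε
      rw [← Finset.mul_prod_erase Finset.univ _ (Finset.mem_univ k)]
      have h8 : ∏ l ∈ Finset.univ.erase k,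
          rademacherSum (fun i => |b i| * if l = k then c i else 1) ε =
          rademacherSum (fun i => |b i|) ε ^ (r - 1) := by
        rw [Finset.prod_congr rfl (g := fun _ => rademacherSum (fun i => |b i|) ε)
          fun l hl => by simp [Finset.ne_of_mem_erase hl], Finset.prod_const,
          Finset.card_erase_of_mem (Finset.mem_univ k), Finset.card_univ, Fintype.card_fin]
      rw [h8]
      simp only [if_true]
      refine (le_abs_self _).trans ?_
      rw [abs_mul, mul_comm 2, pow_mul]
      have h9 := abs_rademacherSum_le (fun i => |b i| * c i) ε
      have h10 : ∑ i, |(|b i| * c i)| = ∑ i, |b i| * c i :=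
        Finset.sum_congr rfl fun i _ => abs_of_nonneg (mul_nonneg (abs_nonneg _) (hc i))
      rw [h10] at h9
      refine mul_le_mul h9 ?_ (abs_nonneg _)
        (Finset.sum_nonneg fun i _ => mul_nonneg (abs_nonneg _) (hc i))
      -- The inequality |y| ≤ 1 + y² replaces the exponent r - 1, of unknown parity, by an even one.
      set y := rademacherSum (fun i => |b i|) ε ^ (r - 1)
      rw [← sq_abs y]
      nlinarith [sq_nonneg (|y| - 1), abs_nonneg y]
    refine (Finset.expect_le_expect fun ε _ => h7 ε).trans (le_of_eq ?_)
    rw [← Finset.mul_expect, Finset.expect_add_distrib, Fintype.expect_const]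
  rw [h1, h2, ← Finset.sum_sub_distrib]
  simp only [← mul_sub]
  refine (Finset.abs_sum_le_sum_abs _ _).trans ?_
  calc ∑ p : Fin r → ι, |(∏ k, b (p k)) * (𝔼 ω, ∏ k, X (p k) ω - ev p)|
      ≤ ∑ p : Fin r → ι, (∏ k, |b (p k)|) * (A + ev p * ∑ k, c (p k)) := by
        refine Finset.sum_le_sum fun p _ => ?_
        rw [abs_mul, Finset.abs_prod]
        exact mul_le_mul_of_nonneg_left (h3 p) (Finset.prod_nonneg fun k _ => abs_nonneg _)
    _ = A * (∑ i, |b i|) ^ r +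
        ∑ k : Fin r, ∑ p : Fin r → ι, (∏ l, |b (p l)|) * (ev p * c (p k)) := by
        rw [Fintype.sum_pow, Finset.mul_sum, Finset.sum_comm, ← Finset.sum_add_distrib]
        refine Finset.sum_congr rfl fun p _ => ?_
        rw [mul_add, Finset.mul_sum, Finset.mul_sum]
        ring
    _ ≤ A * (∑ i, |b i|) ^ r + ∑ k : Fin r, ((∑ i, |b i| * c i) *
        (1 + 𝔼 ε, rademacherSum (fun i => |b i|) ε ^ (2 * (r - 1)))) := by
        gcongr with k
        exact h4 k
    _ = _ := by
        rw [Finset.sum_const, Finset.card_univ, Fintype.card_fin, nsmul_eq_mul]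

end Moments

/-! ### Mixed moments of the residue symbols over the square-free family -/

section FamilyMoments

variable {F : Type*} [Field F] [Finite F]

scoped instance squarefreeFamily_fintype (d : ℕ) : Fintype (squarefreeFamily F d) :=
  Fintype.ofFinite _

theorem expect_squarefreeFamily (d : ℕ) (f : F[X] → ℝ) :
    𝔼 Q : squarefreeFamily F d, f Q =
      (∑ Q ∈ squarefreesOfDegree F d, f Q) / (squarefreesOfDegree F d).card := by
  have h : ∀ h : F[X] → ℝ, ∑ Q : squarefreeFamily F d, h Q = ∑ Q ∈ squarefreesOfDegree F d, h Q :=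
    fun h => (Finset.sum_subtype _ (fun Q => by simp [squarefreesOfDegree]) h).symm
  rw [Fintype.expect_eq_sum_div_card, h f]
  congr 1
  have := h fun _ => 1
  simpa using this

theorem mem_primesUpTo {K : ℕ} {P : F[X]} :
    P ∈ primesUpTo F K ↔ P.Monic ∧ Irreducible P ∧ P.natDegree ≤ K := by
  simp [primesUpTo]

theorem card_squarefreesOfDegree_pos (hF : Odd (Nat.card F)) (n : ℕ) :
    (0 : ℝ) < (squarefreesOfDegree F n).card := by
  have hq0 : (0 : ℝ) < Nat.card F := by exact_mod_cast Nat.card_pos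
  exact (by positivity : (0 : ℝ) < (Nat.card F : ℝ) ^ n / 2).trans_le
    (half_pow_le_card_squarefreesOfDegree hF n)

/-- The complete sums vanish from degree rK on, so the square-free sum is at most q^(rK) (2q)^(g+1);
it is divided by a cardinality of at least q^(2g+2)/2. -/
theorem abs_expect_prod_residueSymbol_le [DecidableEq F[X]] (hF : Odd (Nat.card F)) {r K g : ℕ}
    (p : Fin r → primesUpTo F K)
    (hodd : ∃ j, Odd (Finset.univ.filter fun k => p k = j).card) :
    |𝔼 Q : squarefreeFamily F (2 * g + 2), ∏ k, residueSymbol (Q : F[X]) (p k)| ≤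
      2 * (Nat.card F : ℝ) ^ (r * K) * (2 / (Nat.card F : ℝ)) ^ (g + 1) := by
  have hq : (1 : ℝ) ≤ Nat.card F := by exact_mod_cast Nat.card_pos
  have hq0 : (0 : ℝ) < Nat.card F := by linarith
  have hp : ∀ k, ((p k : F[X])).Monic ∧ Irreducible (p k : F[X]) := fun k =>
    ⟨(mem_primesUpTo.1 (p k).2).1, (mem_primesUpTo.1 (p k).2).2.1⟩
  obtain ⟨j, hj⟩ := hodd
  have hj' : Odd (Finset.univ.filter fun k => (p k : F[X]) = j).card := by
    simpa only [Subtype.ext_iff] using hj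
  have hN : ∑ k, (p k : F[X]).natDegree ≤ r * K := by
    refine (Finset.sum_le_card_nsmul _ _ K fun k _ => (mem_primesUpTo.1 (p k).2).2.2).trans ?_
    simp
  have h1 := abs_sum_squarefreesOfDegree_le (F := F) (fun Q => ∏ k, residueSymbol Q (p k))
    (fun f h => by
      rw [← Finset.prod_mul_distrib]
      exact Finset.prod_congr rfl fun k _ => residueSymbol_mul hF (hp k).2 f h)
    (fun f => by
      rw [Finset.abs_prod]
      exact Finset.prod_le_one (fun k _ => abs_nonneg _) fun k _ => abs_residueSymbol_le _ _)
    (Finset.prod_eq_one fun k _ => residueSymbol_one hF (hp k).2)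
    (N := r * K) (fun n hn => sum_monicsOfDegree_prod_residueSymbol_eq_zero hF
      (fun k => (p k : F[X])) hp (hN.trans hn) hj') (2 * g + 2)
  have h2 := half_pow_le_card_squarefreesOfDegree hF (2 * g + 2)
  have h3 := card_squarefreesOfDegree_pos hF (2 * g + 2)
  rw [expect_squarefreeFamily _ (fun Q : F[X] => ∏ k, residueSymbol Q (p k : F[X])), abs_div,
    abs_of_pos h3, div_le_iff₀ h3]
  refine h1.trans ?_
  rw [show (2 * g + 2) / 2 = g + 1 by omega]
  calc _ = 2 * (Nat.card F : ℝ) ^ (r * K) * (2 / (Nat.card F : ℝ)) ^ (g + 1) *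
        ((Nat.card F : ℝ) ^ (2 * g + 2) / 2) := by
        rw [show 2 * g + 2 = (g + 1) + (g + 1) by ring, pow_add, div_pow, mul_pow]
        field_simp
        ring
    _ ≤ _ := by gcongr

theorem expect_dvd_le [DecidableEq F[X]] (hF : Odd (Nat.card F)) {P : F[X]} (hP : P.Monic)
    [DecidablePred fun Q : F[X] => P ∣ Q] (n : ℕ) :
    𝔼 Q : squarefreeFamily F n, (if P ∣ (Q : F[X]) then (1 : ℝ) else 0) ≤
      2 / (Nat.card F : ℝ) ^ P.natDegree := by
  have hq0 : (0 : ℝ) < Nat.card F := by exact_mod_cast Nat.card_pos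
  have h1 := card_filter_dvd_squarefreesOfDegree_le hP n
  have h2 := half_pow_le_card_squarefreesOfDegree hF n
  have h3 := card_squarefreesOfDegree_pos hF n
  rw [expect_squarefreeFamily _ (fun Q : F[X] => if P ∣ Q then (1 : ℝ) else 0), div_le_iff₀ h3,
    Finset.sum_boole]
  refine h1.trans ?_
  calc _ = 2 / (Nat.card F : ℝ) ^ P.natDegree * ((Nat.card F : ℝ) ^ n / 2) := by ring
    _ ≤ _ := by gcongr

open Classical in
-- Even powers of nonzero symbols are 1. If some entry divides Q, the product is 0 and the error 1
-- is already paid for by that entry.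
theorem abs_prod_residueSymbol_sub_one_le {r K : ℕ} (p : Fin r → primesUpTo F K)
    (heven : ∀ j, Even (Finset.univ.filter fun k => p k = j).card) (Q : F[X]) :
    |∏ k, residueSymbol Q (p k) - 1| ≤ ∑ k, if (p k : F[X]) ∣ Q then (1 : ℝ) else 0 := by
  by_cases h : ∃ k, (p k : F[X]) ∣ Q
  · obtain ⟨k, hk⟩ := h
    rw [Finset.prod_eq_zero (Finset.mem_univ k) (residueSymbol_eq_zero hk), zero_sub, abs_neg,
      abs_one]
    have := Finset.single_le_sum (f := fun k => if (p k : F[X]) ∣ Q then (1 : ℝ) else 0)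
      (fun i _ => by split_ifs <;> simp) (Finset.mem_univ k)
    simpa only [hk, if_true] using this
  · push Not at h
    have h1 : ∏ k, residueSymbol Q (p k) = 1 := by
      rw [← Finset.prod_fiberwise Finset.univ p]
      refine Finset.prod_eq_one fun j _ => ?_
      rw [Finset.prod_congr rfl (g := fun _ => residueSymbol Q j) fun k hk => by
        rw [(Finset.mem_filter.1 hk).2], Finset.prod_const]
      obtain ⟨m, hm⟩ := heven j
      rw [hm, ← two_mul, pow_mul]
      rcases Nat.eq_zero_or_pos m with rfl | hm0
      · rw [pow_zero]
      · obtain ⟨k, hk⟩ := Finset.card_pos.1 (by omega :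
          0 < (Finset.univ.filter fun k => p k = j).card)
        have hj : ¬(j : F[X]) ∣ Q := by
          rw [← (Finset.mem_filter.1 hk).2]
          exact h k
        rw [residueSymbol_sq hj, one_pow]
    rw [h1, sub_self, abs_zero]
    exact Finset.sum_nonneg fun i _ => by split_ifs <;> simp

theorem abs_expect_prod_residueSymbol_sub_one_le [DecidableEq F[X]] (hF : Odd (Nat.card F))
    {r K n : ℕ} (p : Fin r → primesUpTo F K)
    (heven : ∀ j, Even (Finset.univ.filter fun k => p k = j).card) :
    |𝔼 Q : squarefreeFamily F n, ∏ k, residueSymbol (Q : F[X]) (p k) - 1| ≤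
      ∑ k, 2 / (Nat.card F : ℝ) ^ (p k : F[X]).natDegree := by
  classical
  have h1 : 𝔼 Q : squarefreeFamily F n, ∏ k, residueSymbol (Q : F[X]) (p k) - 1 =
      𝔼 Q : squarefreeFamily F n, (∏ k, residueSymbol (Q : F[X]) (p k) - 1) := by
    rw [Finset.expect_sub_distrib, Fintype.expect_const]
  have h2 : ∀ Q : squarefreeFamily F n, |∏ k, residueSymbol (Q : F[X]) (p k) - 1| ≤
      ∑ k, if (p k : F[X]) ∣ (Q : F[X]) then (1 : ℝ) else 0 := by
    intro Q
    refine abs_prod_residueSymbol_sub_one_le p (fun j => ?_) Q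
    convert heven j
  have h3 : 𝔼 Q : squarefreeFamily F n, |∏ k, residueSymbol (Q : F[X]) (p k) - 1| ≤
      𝔼 Q : squarefreeFamily F n, ∑ k, if (p k : F[X]) ∣ (Q : F[X]) then (1 : ℝ) else 0 :=
    Finset.expect_le_expect fun Q _ => h2 Q
  have h4 : ∀ k, 𝔼 Q : squarefreeFamily F n, (if (p k : F[X]) ∣ (Q : F[X]) then (1 : ℝ) else 0) ≤
      2 / (Nat.card F : ℝ) ^ (p k : F[X]).natDegree :=
    fun k => expect_dvd_le hF (mem_primesUpTo.1 (p k).2).1 n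
  rw [h1]
  refine (Finset.abs_expect_le _ _).trans (h3.trans ?_)
  rw [Finset.expect_sum_comm]
  exact Finset.sum_le_sum fun k _ => h4 k

theorem abs_expect_primeSum_pow_sub_le [DecidableEq F[X]] (hF : Odd (Nat.card F)) {K : ℕ} (g : ℕ)
    (b : primesUpTo F K → ℝ) (r : ℕ) :
    |𝔼 Q : squarefreeFamily F (2 * g + 2), (∑ P, b P * residueSymbol (Q : F[X]) P) ^ r -
        𝔼 ε, rademacherSum b ε ^ r| ≤
      2 * (Nat.card F : ℝ) ^ (r * K) * (2 / (Nat.card F : ℝ)) ^ (g + 1) * (∑ P, |b P|) ^ r +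
        r * ((∑ P, |b P| * (2 / (Nat.card F : ℝ) ^ (P : F[X]).natDegree)) *
        (1 + 𝔼 ε, rademacherSum (fun i => |b i|) ε ^ (2 * (r - 1)))) :=
  abs_expect_pow_sub_expect_rademacherSum_pow_le
    (fun (P : primesUpTo F K) (Q : squarefreeFamily F (2 * g + 2)) => residueSymbol (Q : F[X]) P)
    b _ (fun P => by positivity) (by positivity) r
    (fun p hp => abs_expect_prod_residueSymbol_le hF p hp)
    (fun p hp => abs_expect_prod_residueSymbol_sub_one_le hF p hp)

end FamilyMoments

/-! ### Counting primes -/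

section PrimeCount

variable (F : Type*) [Field F] [Finite F]

/-- The primes of degree `d` in `F[X]`. -/
def primesOfDegree (d : ℕ) : Finset F[X] :=
  (primesUpTo F d).filter fun P => P.natDegree = d

variable {F}

theorem mem_primesOfDegree {d : ℕ} {P : F[X]} :
    P ∈ primesOfDegree F d ↔ P.Monic ∧ Irreducible P ∧ P.natDegree = d := by
  rw [primesOfDegree, Finset.mem_filter, mem_primesUpTo]
  constructor
  · rintro ⟨⟨h1, h2, -⟩, h3⟩; exact ⟨h1, h2, h3⟩
  · rintro ⟨h1, h2, h3⟩; exact ⟨⟨h1, h2, h3.le⟩, h3⟩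

theorem sum_primesUpTo_natDegree (K : ℕ) (f : ℕ → ℝ) :
    ∑ P ∈ primesUpTo F K, f P.natDegree =
      ∑ d ∈ Finset.Ioc 0 K, ((primesOfDegree F d).card : ℝ) * f d := by
  rw [← Finset.sum_fiberwise_of_maps_to (t := Finset.Ioc 0 K) (g := fun P : F[X] => P.natDegree)]
  · refine Finset.sum_congr rfl fun d hd => ?_
    have h : (primesUpTo F K).filter (fun P => P.natDegree = d) = primesOfDegree F d := by
      ext P
      rw [Finset.mem_filter, mem_primesUpTo, mem_primesOfDegree]
      rw [Finset.mem_Ioc] at hd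
      constructor
      · rintro ⟨⟨h1, h2, -⟩, h3⟩; exact ⟨h1, h2, h3⟩
      · rintro ⟨h1, h2, h3⟩; exact ⟨⟨h1, h2, h3.trans_le hd.2⟩, h3⟩
    rw [h, Finset.sum_congr rfl (g := fun _ => f d) fun P hP => by
      rw [(mem_primesOfDegree.1 hP).2.2], Finset.sum_const, nsmul_eq_mul]
  · intro P hP
    rw [mem_primesUpTo] at hP
    exact Finset.mem_Ioc.2 ⟨hP.2.1.natDegree_pos, hP.2.2⟩

variable (F) in
/-- The Gauss formula for the number of primes in `F[X]`. -/
theorem sum_divisors_mul_card_primesOfDegree {n : ℕ} (hn : n ≠ 0) :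
    ∑ d ∈ n.divisors, d * (primesOfDegree F d).card = Nat.card F ^ n := by
  classical
  -- A is square-free, its derivative being -1, and its monic irreducible factors are exactly the
  -- primes of degree dividing n. Comparing degrees gives the formula.
  set A : F[X] := X ^ (Nat.card F ^ n) - X with hA
  have hq : 1 < Nat.card F := Finite.one_lt_card
  have hqn : 1 < Nat.card F ^ n := Nat.one_lt_pow hn hq
  have hdeg : A.natDegree = Nat.card F ^ n := FiniteField.X_pow_card_sub_X_natDegree_eq F hqn
  have hmonic : A.Monic := monic_X_pow_sub (by rw [degree_X]; exact_mod_cast hqn)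
  have hsq : Squarefree A := by
    refine Separable.squarefree ⟨0, -1, ?_⟩
    have h0 : ((Nat.card F ^ n : ℕ) : F) = 0 := by
      let _ : Fintype F := Fintype.ofFinite F
      rw [Nat.cast_pow, Nat.card_eq_fintype_card, Nat.cast_card_eq_zero, zero_pow hn]
    simp [hA, derivative_X_pow, h0]
  have hmem : ∀ P, P ∈ (UniqueFactorizationMonoid.normalizedFactors A).toFinset ↔
      P ∈ n.divisors.biUnion (primesOfDegree F) := by
    intro P
    rw [Multiset.mem_toFinset, UniqueFactorizationMonoid.mem_normalizedFactors_iff' hmonic.ne_zero,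
      Finset.mem_biUnion]
    simp only [mem_primesOfDegree, Nat.mem_divisors]
    constructor
    · rintro ⟨h1, h2, h3⟩
      have hPm : P.Monic := by
        rw [← h2]; exact monic_normalize h1.ne_zero
      exact ⟨_, ⟨h1.natDegree_dvd_iff_dvd_X_pow_card_pow_sub_X.2 h3, hn⟩, hPm, h1, rfl⟩
    · rintro ⟨d, ⟨h1, -⟩, h2, h3, rfl⟩
      exact ⟨h3, h2.normalize_eq_self, h3.natDegree_dvd_iff_dvd_X_pow_card_pow_sub_X.1 h1⟩
  have hnodup := (UniqueFactorizationMonoid.squarefree_iff_nodup_normalizedFactors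
    hmonic.ne_zero).1 hsq
  have hprod : ∏ P ∈ n.divisors.biUnion (primesOfDegree F), P = A := by
    have h := Finset.prod_val (UniqueFactorizationMonoid.normalizedFactors A).toFinset
    rw [Multiset.toFinset_val, hnodup.dedup,
      UniqueFactorizationMonoid.prod_normalizedFactors_eq hmonic.ne_zero,
      hmonic.normalize_eq_self] at h
    rw [← Finset.ext hmem]
    exact h.symm
  rw [← hdeg, ← hprod, natDegree_prod_of_monic _ _ fun P hP => by
    obtain ⟨d, -, hd⟩ := Finset.mem_biUnion.1 hP
    exact (mem_primesOfDegree.1 hd).1, Finset.sum_biUnion]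
  · refine Finset.sum_congr rfl fun d _ => ?_
    rw [Finset.sum_congr rfl (g := fun _ => d) fun P hP => (mem_primesOfDegree.1 hP).2.2,
      Finset.sum_const, smul_eq_mul, mul_comm]
  · intro d _ e _ hde
    rw [Function.onFun, Finset.disjoint_left]
    intro P hP hP'
    exact hde ((mem_primesOfDegree.1 hP).2.2.symm.trans (mem_primesOfDegree.1 hP').2.2)

variable (F) in
theorem mul_card_primesOfDegree_le (n : ℕ) :
    n * (primesOfDegree F n).card ≤ Nat.card F ^ n := by
  rcases Nat.eq_zero_or_pos n with rfl | hn
  · simp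
  · rw [← sum_divisors_mul_card_primesOfDegree F hn.ne']
    exact Finset.single_le_sum (f := fun d => d * (primesOfDegree F d).card)
      (fun _ _ => Nat.zero_le _) (Nat.mem_divisors_self n hn.ne')

variable (F) in
-- In the Gauss formula the proper divisors of n are at most n/2, and a geometric sum of ratio at
-- least 2 is at most twice its last term.
theorem pow_le_mul_card_primesOfDegree_add (n : ℕ) :
    Nat.card F ^ n ≤ n * (primesOfDegree F n).card + 2 * Nat.card F ^ (n / 2) := by
  have hq : 1 < Nat.card F := Finite.one_lt_card
  rcases Nat.eq_zero_or_pos n with rfl | hn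
  · simp
  · rw [← sum_divisors_mul_card_primesOfDegree F hn.ne', ← Nat.cons_self_properDivisors hn.ne',
      Finset.sum_cons]
    gcongr
    have hsub : n.properDivisors ⊆ Finset.range (n / 2 + 1) := by
      intro d hd
      rw [Nat.mem_properDivisors] at hd
      obtain ⟨⟨k, hk⟩, hlt⟩ := hd
      rw [Finset.mem_range]
      have : 2 ≤ k := by
        by_contra h
        have : k = 0 ∨ k = 1 := by omega
        rcases this with rfl | rfl <;> omega
      have : d * 2 ≤ n := by rw [hk]; exact Nat.mul_le_mul_left d this
      omega
    have hgeom : ∀ m, ∑ d ∈ Finset.range (m + 1), Nat.card F ^ d ≤ 2 * Nat.card F ^ m := by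
      intro m
      induction m with
      | zero => simp
      | succ m ih =>
        rw [Finset.sum_range_succ, pow_succ]
        have := Nat.mul_le_mul_left (Nat.card F ^ m) hq
        omega
    calc ∑ d ∈ n.properDivisors, d * (primesOfDegree F d).card
        ≤ ∑ d ∈ n.properDivisors, Nat.card F ^ d :=
          Finset.sum_le_sum fun d _ => mul_card_primesOfDegree_le F d
      _ ≤ ∑ d ∈ Finset.range (n / 2 + 1), Nat.card F ^ d := Finset.sum_le_sum_of_subset hsub
      _ ≤ _ := hgeom _

end PrimeCount

/-! ### Fourier coefficients of Beurling–Selberg polynomials -/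

section Fourier

theorem IsTrigPoly.periodic {K : ℕ} {f : ℝ → ℝ} (h : IsTrigPoly K f) : Function.Periodic f 1 := by
  obtain ⟨c, hc⟩ := h
  intro x
  have h1 : ((f (x + 1) : ℝ) : ℂ) = f x := by
    rw [hc, hc]
    refine Finset.sum_congr rfl fun k _ => ?_
    congr 1
    rw [Complex.exp_eq_exp_iff_exists_int]
    exact ⟨k, by push_cast; ring⟩
  exact_mod_cast h1

theorem fourierCoefficient_eq_integral_cos {f : ℝ → ℝ} (hc : Continuous f)
    (hp : Function.Periodic f 1) (k : ℤ) :
    fourierCoefficient f k =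
      ∫ x in (-(1 / 2) : ℝ)..(1 / 2), f x * Real.cos (2 * Real.pi * k * x) := by
  have h1 : fourierCoefficient f k = ∫ x in (0 : ℝ)..1, f x * Real.cos (2 * Real.pi * k * x) := by
    unfold fourierCoefficient
    rw [← Complex.reCLM_apply, ← ContinuousLinearMap.intervalIntegral_comp_comm]
    · refine intervalIntegral.integral_congr fun x _ => ?_
      simp only [Complex.reCLM_apply]
      rw [Complex.re_ofReal_mul]
      congr 1
      have : -(2 * Real.pi * Complex.I * k * x) =
          ((-(2 * Real.pi * k * x) : ℝ) : ℂ) * Complex.I := by push_cast; ring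
      rw [this, Complex.exp_ofReal_mul_I_re, Real.cos_neg]
    · exact Continuous.intervalIntegrable (by fun_prop) _ _
  have h2 : Function.Periodic (fun x => f x * Real.cos (2 * Real.pi * k * x)) 1 := by
    intro x
    simp only [hp x]
    congr 1
    rw [mul_add, mul_one, ← Real.cos_add_int_mul_two_pi (2 * Real.pi * k * x) k]
    congr 1
    ring
  rw [h1, ← zero_add (1 : ℝ), h2.intervalIntegral_add_eq 0 (-(1 / 2))]
  norm_num

/-- As β < 1, only the translate n = 0 of the arc meets this period apart from no further points. -/
theorem arcIndicator_eq_indicator {β x : ℝ} (hβ : β < 1)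
    (hx : x ∈ Set.Ioc (-(1 / 2) : ℝ) (1 / 2)) :
    arcIndicator β x = (Set.Icc (-(β / 2)) (β / 2)).indicator 1 x := by
  unfold arcIndicator
  by_cases h : x ∈ Set.Icc (-(β / 2)) (β / 2)
  · rw [Set.indicator_of_mem h, Set.indicator_of_mem]
    exact ⟨0, by simpa using h⟩
  · rw [Set.indicator_of_notMem h, Set.indicator_of_notMem]
    rintro ⟨n, hn1, hn2⟩
    have h1 : (n : ℝ) < 1 := by linarith [hx.2]
    have h2 : (-1 : ℝ) < n := by linarith [hx.1]
    have h3 : n < 1 := by exact_mod_cast h1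
    have h4 : -1 < n := by exact_mod_cast h2
    obtain rfl : n = 0 := by omega
    exact h (by simpa using And.intro hn1 hn2)

theorem integral_indicator_mul {β : ℝ} (h0 : 0 < β) (h1 : β < 1) (h : ℝ → ℝ) :
    ∫ x in (-(1 / 2) : ℝ)..(1 / 2), (Set.Icc (-(β / 2)) (β / 2)).indicator 1 x * h x =
      ∫ x in (-(β / 2))..(β / 2), h x := by
  have h2 : (fun x => (Set.Icc (-(β / 2)) (β / 2)).indicator (1 : ℝ → ℝ) x * h x) =
      (Set.Icc (-(β / 2)) (β / 2)).indicator h := by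
    funext x
    by_cases hx : x ∈ Set.Icc (-(β / 2)) (β / 2)
    · simp [Set.indicator_of_mem hx]
    · simp [Set.indicator_of_notMem hx]
  rw [h2, intervalIntegral.integral_of_le (by norm_num),
    intervalIntegral.integral_of_le (by linarith), setIntegral_indicator measurableSet_Icc,
    ← integral_Icc_eq_integral_Ioc]
  congr 2
  ext x
  constructor
  · exact fun hx => hx.2
  · exact fun hx => ⟨⟨by linarith [hx.1], by linarith [hx.2]⟩, hx⟩

/-- The difference between f and the indicator has constant sign s, so its L¹ norm is its integral
up to sign, namely 1/(K+1), and this bounds all its Fourier coefficients. Those of the indicator are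
sin(πkβ)/(πk). The sign s treats majorants and minorants together. -/
theorem abs_fourierCoefficient_sub_le {K : ℕ} {f : ℝ → ℝ} {β s : ℝ} (h0 : 0 < β) (h1 : β < 1)
    (hf : IsTrigPoly K f) (hs : |s| = 1) (hle : ∀ x, 0 ≤ s * (f x - arcIndicator β x))
    (hmean : ∫ x in (0 : ℝ)..1, f x = β + s * (1 / ((K : ℝ) + 1))) {k : ℕ} (hk : 0 < k) :
    |fourierCoefficient f k - Real.sin (Real.pi * k * β) / (Real.pi * k)| ≤ 1 / ((K : ℝ) + 1) := by
  have hc := hf.continuous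
  have hp := hf.periodic
  have hss : s * s = 1 := by rw [← abs_mul_abs_self, hs, one_mul]
  set J : ℝ → ℝ := (Set.Icc (-(β / 2)) (β / 2)).indicator 1 with hJ
  have hJint : IntervalIntegrable J volume (-(1 / 2)) (1 / 2) := by
    rw [intervalIntegrable_iff]
    exact (integrableOn_const (by simp)).indicator measurableSet_Icc
  have hk0 : (0 : ℝ) < k := by exact_mod_cast hk
  have hsin : ∫ x in (-(1 / 2) : ℝ)..(1 / 2), J x * Real.cos (2 * Real.pi * (k : ℤ) * x) =
      Real.sin (Real.pi * k * β) / (Real.pi * k) := by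
    rw [hJ, integral_indicator_mul h0 h1,
      intervalIntegral.integral_comp_mul_left (fun x => Real.cos x) (by positivity), integral_cos]
    have e1 : 2 * Real.pi * ((k : ℤ) : ℝ) * (β / 2) = Real.pi * k * β := by push_cast; ring
    have e2 : 2 * Real.pi * ((k : ℤ) : ℝ) * -(β / 2) = -(Real.pi * k * β) := by push_cast; ring
    rw [e1, e2, Real.sin_neg, smul_eq_mul]
    push_cast
    field_simp
    ring
  have hJ1 : ∫ x in (-(1 / 2) : ℝ)..(1 / 2), J x = β := by
    have := integral_indicator_mul h0 h1 (fun _ => 1)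
    simp only [mul_one] at this
    rw [hJ, this]
    simp
  have hf1 : ∫ x in (-(1 / 2) : ℝ)..(1 / 2), f x = β + s * (1 / ((K : ℝ) + 1)) := by
    rw [← hmean]
    have := hp.intervalIntegral_add_eq (-(1 / 2)) 0
    norm_num at this ⊢
    exact this
  have hfint : IntervalIntegrable f volume (-(1 / 2)) (1 / 2) := hc.intervalIntegrable _ _
  have hcos : Continuous fun x : ℝ => Real.cos (2 * Real.pi * (k : ℤ) * x) := by fun_prop
  have hk' : fourierCoefficient f k = ∫ x in (-(1 / 2) : ℝ)..(1 / 2),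
      f x * Real.cos (2 * Real.pi * (k : ℤ) * x) := fourierCoefficient_eq_integral_cos hc hp k
  rw [hk', ← hsin, ← intervalIntegral.integral_sub (hfint.mul_continuousOn hcos.continuousOn)
    (hJint.mul_continuousOn hcos.continuousOn)]
  have hbound : ∀ x ∈ Set.Ioc (-(1 / 2) : ℝ) (1 / 2),
      ‖f x * Real.cos (2 * Real.pi * (k : ℤ) * x) - J x * Real.cos (2 * Real.pi * (k : ℤ) * x)‖ ≤
        s * (f x - J x) := by
    intro x hx
    have h3 := hle x
    rw [arcIndicator_eq_indicator h1 hx] at h3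
    rw [← sub_mul, norm_mul, Real.norm_eq_abs, Real.norm_eq_abs]
    have h4 : |f x - J x| = s * (f x - J x) := by
      rw [← abs_of_nonneg h3, abs_mul, hs, one_mul]
    rw [h4]
    exact mul_le_of_le_one_right h3 (Real.abs_cos_le_one _)
  rw [← Real.norm_eq_abs]
  refine (intervalIntegral.norm_integral_le_of_norm_le (by norm_num)
    (Filter.Eventually.of_forall hbound) ((hfint.sub hJint).const_mul s)).trans (le_of_eq ?_)
  rw [intervalIntegral.integral_const_mul, intervalIntegral.integral_sub hfint hJint, hf1, hJ1]
  linear_combination (1 / ((K : ℝ) + 1)) * hss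

end Fourier

/-! ### The sum `∑ sin²(πdβ) / d` -/

section SineSum

theorem log_sub_log_le_sum_Ioc {M K : ℕ} (h : M ≤ K) :
    Real.log (K + 1) - Real.log (M + 1) ≤ ∑ d ∈ Finset.Ioc M K, 1 / (d : ℝ) := by
  induction K, h using Nat.le_induction with
  | base => simp
  | succ K hK ih =>
    rw [Finset.sum_Ioc_succ_top hK]
    have h1 : (0 : ℝ) < K + 1 := by positivity
    have h2 := Real.log_le_sub_one_of_pos (show (0 : ℝ) < (K + 1 + 1) / (K + 1) by positivity)
    rw [Real.log_div (by positivity) h1.ne'] at h2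
    have h3 : ((K : ℝ) + 1 + 1) / (K + 1) - 1 = 1 / (K + 1) := by field_simp; ring
    push_cast
    linarith

theorem sum_Ioc_le_log_sub_log {M K : ℕ} (hM : 0 < M) (h : M ≤ K) :
    ∑ d ∈ Finset.Ioc M K, 1 / (d : ℝ) ≤ Real.log K - Real.log M := by
  induction K, h using Nat.le_induction with
  | base => simp
  | succ K hK ih =>
    rw [Finset.sum_Ioc_succ_top hK]
    have h0 : (0 : ℝ) < K := by exact_mod_cast hM.trans_le hK
    have h2 := Real.log_le_sub_one_of_pos (show (0 : ℝ) < K / (K + 1) by positivity)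
    rw [Real.log_div h0.ne' (by positivity)] at h2
    have h3 : (K : ℝ) / (K + 1) - 1 = -(1 / (K + 1)) := by field_simp; ring
    push_cast
    linarith

/-- Summation by parts against the decreasing weights 1/d. -/
theorem abs_sum_Ioc_sub_div_le (u : ℕ → ℝ) (hu : ∀ n, |u n| ≤ 1) {M K : ℕ} (h : M ≤ K) :
    |∑ d ∈ Finset.Ioc M K, (u (d + 1) - u d) / d| ≤ 2 / ((M : ℝ) + 1) := by
  -- With the boundary term removed, each induction step adds u(K+2) (1/(K+1) - 1/(K+2)), which the
  -- slack 1/(K+1) in the bound absorbs.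
  have key : |∑ d ∈ Finset.Ioc M K, (u (d + 1) - u d) / d - u (K + 1) / (K + 1)| ≤
      2 / ((M : ℝ) + 1) - 1 / ((K : ℝ) + 1) := by
    induction K, h using Nat.le_induction with
    | base =>
      have h1 : (0 : ℝ) < M + 1 := by positivity
      simp only [Finset.Ioc_self, Finset.sum_empty, zero_sub, abs_neg]
      rw [abs_div, abs_of_pos h1, ← sub_div]
      exact div_le_div_of_nonneg_right ((hu _).trans (by norm_num)) h1.le
    | succ K hK ih =>
      rw [Finset.sum_Ioc_succ_top hK]
      push_cast
      have h1 : (0 : ℝ) < K + 1 := by positivity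
      have h2 : (0 : ℝ) ≤ 1 / ((K : ℝ) + 1) - 1 / (K + 1 + 1) := by
        rw [sub_nonneg]
        exact one_div_le_one_div_of_le h1 (by linarith)
      have h3 : |u (K + 1 + 1) * (1 / ((K : ℝ) + 1) - 1 / (K + 1 + 1))| ≤
          1 / ((K : ℝ) + 1) - 1 / (K + 1 + 1) := by
        rw [abs_mul, abs_of_nonneg h2]
        exact mul_le_of_le_one_left h2 (hu _)
      set S := ∑ d ∈ Finset.Ioc M K, (u (d + 1) - u d) / d
      have h4 : S + (u (K + 1 + 1) - u (K + 1)) / ((K : ℝ) + 1) - u (K + 1 + 1) / (K + 1 + 1) =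
          (S - u (K + 1) / (K + 1)) +
            u (K + 1 + 1) * (1 / ((K : ℝ) + 1) - 1 / (K + 1 + 1)) := by ring
      rw [h4]
      refine (abs_add_le _ _).trans ?_
      linarith
  have h1 : |u (K + 1) / ((K : ℝ) + 1)| ≤ 1 / ((K : ℝ) + 1) := by
    have h2 : (0 : ℝ) < K + 1 := by positivity
    rw [abs_div, abs_of_pos h2]
    exact div_le_div_of_nonneg_right (hu _) h2.le
  have h2 := abs_sub_abs_le_abs_sub (∑ d ∈ Finset.Ioc M K, (u (d + 1) - u d) / d)
    (u (K + 1) / ((K : ℝ) + 1))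
  linarith

/-- The sum is cut at d ≈ 1/β. Below, sin² x ≤ x² gives at most π². Above, sin² = (1 - cos)/2: the
constant part is half a harmonic sum, hence log(Kβ)/2 up to (log 2)/2 ≤ 1/2, and the cosine part is
bounded by cancellation. -/
theorem abs_sum_sin_sq_div_sub_log_le {β c : ℝ} (h0 : 0 < β) (h1 : β < 1) (hc : 0 < c)
    (hcβ : c * β ≤ Real.sin (Real.pi * β)) {K : ℕ} (hK : 1 ≤ K * β) :
    |∑ d ∈ Finset.Ioc 0 K, Real.sin (Real.pi * d * β) ^ 2 / d - Real.log (K * β) / 2| ≤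
      Real.pi ^ 2 + 1 / 2 + 1 / (2 * c) := by
  set M := ⌊1 / β⌋₊ with hM
  have hM1 : (M : ℝ) ≤ 1 / β := Nat.floor_le (by positivity)
  have hM2 : 1 / β < M + 1 := Nat.lt_floor_add_one _
  have hMpos : 0 < M := Nat.floor_pos.2 (by rw [le_div_iff₀ h0]; linarith)
  have hMβ : M * β ≤ 1 := by rwa [le_div_iff₀ h0] at hM1
  have hMβ' : 1 < (M + 1) * β := by rwa [div_lt_iff₀ h0] at hM2
  have hMK : M ≤ K := by
    have : (M : ℝ) ≤ K := hM1.trans (by rwa [div_le_iff₀ h0])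
    exact_mod_cast this
  have hMr : (1 : ℝ) ≤ M := by exact_mod_cast hMpos
  have hKr : (0 : ℝ) < K := by exact_mod_cast hMpos.trans_le hMK
  rw [← Finset.sum_Ioc_consecutive _ (Nat.zero_le M) hMK]
  have hA0 : 0 ≤ ∑ d ∈ Finset.Ioc 0 M, Real.sin (Real.pi * d * β) ^ 2 / (d : ℝ) :=
    Finset.sum_nonneg fun d _ => by positivity
  have hA : ∑ d ∈ Finset.Ioc 0 M, Real.sin (Real.pi * d * β) ^ 2 / (d : ℝ) ≤ Real.pi ^ 2 := by
    calc _ ≤ ∑ d ∈ Finset.Ioc 0 M, Real.pi ^ 2 * β := by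
          refine Finset.sum_le_sum fun d hd => ?_
          rw [Finset.mem_Ioc] at hd
          have hd0 : (0 : ℝ) < d := by exact_mod_cast hd.1
          have hdM : (d : ℝ) ≤ M := by exact_mod_cast hd.2
          rw [div_le_iff₀ hd0]
          have h3 : Real.sin (Real.pi * d * β) ^ 2 ≤ (Real.pi * d * β) ^ 2 := by
            rw [← sq_abs (Real.sin _), ← sq_abs (Real.pi * d * β)]
            exact pow_le_pow_left₀ (abs_nonneg _) Real.abs_sin_le_abs 2
          refine h3.trans ?_
          have h4 : d * β ≤ 1 := (mul_le_mul_of_nonneg_right hdM h0.le).trans hMβ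
          calc (Real.pi * d * β) ^ 2 = Real.pi ^ 2 * β * d * (d * β) := by ring
            _ ≤ Real.pi ^ 2 * β * d * 1 := by gcongr
            _ = _ := by ring
      _ = Real.pi ^ 2 * (M * β) := by
          rw [Finset.sum_const, Nat.card_Ioc, Nat.sub_zero, nsmul_eq_mul]; ring
      _ ≤ Real.pi ^ 2 * 1 := by gcongr
      _ = _ := mul_one _
  have hsplit : ∑ d ∈ Finset.Ioc M K, Real.sin (Real.pi * d * β) ^ 2 / (d : ℝ) =
      (∑ d ∈ Finset.Ioc M K, 1 / (d : ℝ)) / 2 -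
        (∑ d ∈ Finset.Ioc M K, Real.cos (2 * (Real.pi * d * β)) / d) / 2 := by
    rw [← sub_div, ← Finset.sum_sub_distrib, Finset.sum_div]
    refine Finset.sum_congr rfl fun d _ => ?_
    rw [Real.sin_sq, Real.cos_sq]
    ring
  have hsin0 : 0 < Real.sin (Real.pi * β) := (mul_pos hc h0).trans_le hcβ
  have hcos : |∑ d ∈ Finset.Ioc M K, Real.cos (2 * (Real.pi * d * β)) / d| ≤ 1 / c := by
    -- 2 sin(πβ) cos(2πdβ) is the increment of sin((2d-1)πβ). The resulting bound 1/((M+1) sin(πβ))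
    -- is at most 1/c because (M+1)β > 1 and sin(πβ) ≥ cβ.
    have h3 := abs_sum_Ioc_sub_div_le (fun d => Real.sin ((2 * d - 1) * (Real.pi * β)))
      (fun n => Real.abs_sin_le_one _) hMK
    have h4 : ∑ d ∈ Finset.Ioc M K, (Real.sin ((2 * ((d + 1 : ℕ) : ℝ) - 1) * (Real.pi * β)) -
        Real.sin ((2 * (d : ℝ) - 1) * (Real.pi * β))) / d =
        2 * Real.sin (Real.pi * β) *
          ∑ d ∈ Finset.Ioc M K, Real.cos (2 * (Real.pi * d * β)) / d := by
      rw [Finset.mul_sum]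
      refine Finset.sum_congr rfl fun d _ => ?_
      rw [Real.sin_sub_sin, ← mul_div_assoc]
      congr 3
      · congr 1
        push_cast
        ring
      · push_cast
        ring
    rw [h4, abs_mul, abs_of_pos (by positivity)] at h3
    set Y := |∑ d ∈ Finset.Ioc M K, Real.cos (2 * (Real.pi * d * β)) / d|
    have hY : 0 ≤ Y := abs_nonneg _
    rw [le_div_iff₀ (by positivity)] at h3
    rw [le_div_iff₀ hc]
    have h5 : Y * c * 1 ≤ Y * c * ((M + 1) * β) := by gcongr
    have h6 : Y * (M + 1) * (c * β) ≤ Y * (M + 1) * Real.sin (Real.pi * β) := by gcongr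
    nlinarith
  have hlog2 : Real.log 2 ≤ 1 := by linarith [Real.log_two_lt_d9]
  have hlogKβ : Real.log (K * β) = Real.log K + Real.log β := Real.log_mul hKr.ne' h0.ne'
  have hup := sum_Ioc_le_log_sub_log hMpos hMK
  have hlo := log_sub_log_le_sum_Ioc hMK
  have hlogM : -Real.log M ≤ Real.log β + Real.log 2 := by
    have h3 : Real.log 1 ≤ Real.log (M * (β * 2)) := by
      apply Real.log_le_log one_pos
      nlinarith
    rw [Real.log_one, Real.log_mul (by positivity) (by positivity),
      Real.log_mul h0.ne' two_ne_zero] at h3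
    linarith
  have hlogM' : Real.log β - Real.log 2 ≤ -Real.log (M + 1) := by
    have h3 : Real.log ((M + 1) * β) ≤ Real.log 2 := by
      apply Real.log_le_log (by positivity)
      nlinarith
    rw [Real.log_mul (by positivity) h0.ne'] at h3
    linarith
  have hlogK : Real.log K ≤ Real.log (K + 1) := Real.log_le_log hKr (by linarith)
  rw [hsplit, hlogKβ]
  have h1c : 1 / (2 * c) = 1 / c / 2 := by field_simp
  rw [h1c]
  rw [abs_le] at hcos ⊢
  have hpi : 0 ≤ Real.pi ^ 2 := by positivity
  constructor <;> linarith [hcos.1, hcos.2]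

end SineSum

/-! ### Sums over primes -/

section PrimeSums

theorem sum_Ioc_geometric_le (K : ℕ) : ∑ d ∈ Finset.Ioc 0 K, (3 / 5 : ℝ) ^ d ≤ 5 / 2 := by
  have h := Summable.sum_le_tsum (Finset.Ioc 0 K) (fun d _ => by positivity)
    (summable_geometric_of_lt_one (r := (3 / 5 : ℝ)) (by norm_num) (by norm_num))
  rw [tsum_geometric_of_lt_one (by norm_num) (by norm_num)] at h
  norm_num at h ⊢
  exact h

/-- The main term contributes at most 1/π ≤ 1, and the error at most d/(K+1) ≤ 1. -/
theorem abs_mul_le_two {a : ℕ → ℝ} {K : ℕ} {β : ℝ}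
    (ha : ∀ d : ℕ, 0 < d → |a d - Real.sin (Real.pi * d * β) / (Real.pi * d)| ≤ 1 / ((K : ℝ) + 1))
    {d : ℕ} (hd : d ∈ Finset.Ioc 0 K) :
    |a d * d| ≤ 2 ∧ |Real.sin (Real.pi * d * β) / (Real.pi * d) * d| ≤ 1 := by
  rw [Finset.mem_Ioc] at hd
  have hd0 : (0 : ℝ) < d := by exact_mod_cast hd.1
  have hdK : (d : ℝ) ≤ K := by exact_mod_cast hd.2
  have hpi : 1 ≤ Real.pi := by linarith [Real.pi_gt_three]
  have h1 : |Real.sin (Real.pi * d * β) / (Real.pi * d) * d| ≤ 1 := by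
    have h2 : Real.sin (Real.pi * d * β) / (Real.pi * d) * d =
        Real.sin (Real.pi * d * β) / Real.pi := by field_simp
    rw [h2, abs_div, abs_of_pos Real.pi_pos, div_le_one Real.pi_pos]
    exact (Real.abs_sin_le_one _).trans hpi
  refine ⟨?_, h1⟩
  have h3 : |(a d - Real.sin (Real.pi * d * β) / (Real.pi * d)) * d| ≤ 1 := by
    rw [abs_mul, abs_of_pos hd0]
    refine (mul_le_mul_of_nonneg_right (ha d hd.1) hd0.le).trans ?_
    rw [div_mul_eq_mul_div, one_mul, div_le_one (by positivity)]
    linarith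
  have h4 : a d * d = (a d - Real.sin (Real.pi * d * β) / (Real.pi * d)) * d +
      Real.sin (Real.pi * d * β) / (Real.pi * d) * d := by ring
  rw [h4]
  exact (abs_add_le _ _).trans (by linarith)

/-- Writing w for the main term, d a² - d w² = (a - w)(ad + wd) is at most 3/(K+1) in absolute
value, and there are K terms. -/
theorem abs_sum_mul_sq_sub_le {a : ℕ → ℝ} {K : ℕ} {β : ℝ}
    (ha : ∀ d : ℕ, 0 < d →
      |a d - Real.sin (Real.pi * d * β) / (Real.pi * d)| ≤ 1 / ((K : ℝ) + 1)) :
    |∑ d ∈ Finset.Ioc 0 K, d * a d ^ 2 -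
      (∑ d ∈ Finset.Ioc 0 K, Real.sin (Real.pi * d * β) ^ 2 / d) / Real.pi ^ 2| ≤ 3 := by
  rw [Finset.sum_div, ← Finset.sum_sub_distrib]
  refine (Finset.abs_sum_le_sum_abs _ _).trans ?_
  have hK1 : (0 : ℝ) < K + 1 := by positivity
  calc _ ≤ ∑ d ∈ Finset.Ioc 0 K, 3 / ((K : ℝ) + 1) := by
        refine Finset.sum_le_sum fun d hd => ?_
        obtain ⟨h1, h2⟩ := abs_mul_le_two ha hd
        rw [Finset.mem_Ioc] at hd
        have hd0 : (0 : ℝ) < d := by exact_mod_cast hd.1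
        have h3 := ha d hd.1
        set w := Real.sin (Real.pi * d * β) / (Real.pi * d) with hw
        have h4 : Real.sin (Real.pi * d * β) ^ 2 / d / Real.pi ^ 2 = d * w ^ 2 := by
          rw [hw]; field_simp
        have h5 : d * a d ^ 2 - d * w ^ 2 = (a d - w) * (a d * d + w * d) := by ring
        rw [h4, h5, abs_mul]
        calc _ ≤ 1 / ((K : ℝ) + 1) * 3 :=
              mul_le_mul h3 ((abs_add_le _ _).trans (by linarith)) (abs_nonneg _) (by positivity)
          _ = _ := by ring
    _ = K * 3 / ((K : ℝ) + 1) := by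
        rw [Finset.sum_const, Nat.card_Ioc, Nat.sub_zero, nsmul_eq_mul, mul_div_assoc]
    _ ≤ 3 := by
        rw [div_le_iff₀ hK1]
        linarith

variable {F : Type*} [Field F] [Finite F]

/-- The number 3/5 is a rational upper bound for 1/√3 ≥ q^(-1/2). -/
theorem inv_pow_sub_half_le (hF : Odd (Nat.card F)) (d : ℕ) :
    (Nat.card F : ℝ) ^ (d / 2) / (Nat.card F : ℝ) ^ d ≤ (3 / 5) ^ d := by
  have hq : (3 : ℝ) ≤ Nat.card F := by exact_mod_cast three_le_natCard_of_odd hF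
  have hq0 : (0 : ℝ) < Nat.card F := by linarith
  rw [div_le_iff₀ (by positivity)]
  refine (pow_le_pow_iff_left₀ (by positivity) (by positivity) two_ne_zero).1 ?_
  calc ((Nat.card F : ℝ) ^ (d / 2)) ^ 2 = (Nat.card F : ℝ) ^ (d / 2 * 2) := (pow_mul _ _ _).symm
    _ ≤ (Nat.card F : ℝ) ^ d := pow_le_pow_right₀ (by linarith) (Nat.div_mul_le_self d 2)
    _ ≤ (Nat.card F : ℝ) ^ d * ((3 / 5) ^ 2 * (Nat.card F : ℝ)) ^ d :=
        le_mul_of_one_le_right (by positivity) (one_le_pow₀ (by linarith))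
    _ = _ := by rw [mul_pow _ (Nat.card F : ℝ) d, pow_right_comm]; ring

theorem inv_sqrt_pow_le (hF : Odd (Nat.card F)) (d : ℕ) :
    1 / √((Nat.card F : ℝ) ^ d) ≤ (3 / 5) ^ d := by
  have hq : (3 : ℝ) ≤ Nat.card F := by exact_mod_cast three_le_natCard_of_odd hF
  have hq0 : (0 : ℝ) < Nat.card F := by linarith
  rw [div_le_iff₀ (by positivity)]
  have h1 : (5 / 3 : ℝ) ^ d ≤ √((Nat.card F : ℝ) ^ d) := by
    apply Real.le_sqrt_of_sq_le
    rw [← pow_mul, mul_comm, pow_mul]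
    exact pow_le_pow_left₀ (by norm_num) (by linarith) d
  calc (1 : ℝ) = (3 / 5) ^ d * (5 / 3) ^ d := by rw [← mul_pow]; norm_num
    _ ≤ _ := by gcongr

theorem abs_sum_card_primesOfDegree_sub_le (hF : Odd (Nat.card F)) {a : ℕ → ℝ} {K : ℕ}
    (ha : ∀ d ∈ Finset.Ioc 0 K, |a d * d| ≤ 2) :
    |∑ d ∈ Finset.Ioc 0 K,
        ((primesOfDegree F d).card : ℝ) * ((a d * d) ^ 2 / (Nat.card F : ℝ) ^ d) -
      ∑ d ∈ Finset.Ioc 0 K, d * a d ^ 2| ≤ 20 := by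
  have hq0 : (0 : ℝ) < Nat.card F := by exact_mod_cast Nat.card_pos
  rw [← Finset.sum_sub_distrib]
  refine (Finset.abs_sum_le_sum_abs _ _).trans ?_
  calc _ ≤ ∑ d ∈ Finset.Ioc 0 K, 8 * (3 / 5 : ℝ) ^ d := by
        refine Finset.sum_le_sum fun d hd => ?_
        have h1 := ha d hd
        rw [Finset.mem_Ioc] at hd
        have hd1 : (1 : ℝ) ≤ d := by exact_mod_cast hd.1
        have hup : d * ((primesOfDegree F d).card : ℝ) ≤ (Nat.card F : ℝ) ^ d := by
          exact_mod_cast mul_card_primesOfDegree_le F d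
        have hlo : (Nat.card F : ℝ) ^ d ≤ d * ((primesOfDegree F d).card : ℝ) +
            2 * (Nat.card F : ℝ) ^ (d / 2) := by
          exact_mod_cast pow_le_mul_card_primesOfDegree_add F d
        set N : ℝ := ((primesOfDegree F d).card : ℝ)
        have h2 := inv_pow_sub_half_le hF d
        have hqd : (0 : ℝ) < (Nat.card F : ℝ) ^ d := by positivity
        -- The error is the relative defect of d N from q^d, at most 2 (3/5)^d, times d a² ≤ 4; this
        -- is the source of the 8 and, after summation, of the 20.
        have h3 : N * ((a d * d) ^ 2 / (Nat.card F : ℝ) ^ d) - d * a d ^ 2 =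
            -(((Nat.card F : ℝ) ^ d - d * N) / (Nat.card F : ℝ) ^ d * (d * a d ^ 2)) := by
          field_simp
          ring
        have h4 : 0 ≤ ((Nat.card F : ℝ) ^ d - d * N) / (Nat.card F : ℝ) ^ d :=
          div_nonneg (by linarith) hqd.le
        have h5 : ((Nat.card F : ℝ) ^ d - d * N) / (Nat.card F : ℝ) ^ d ≤ 2 * (3 / 5) ^ d := by
          calc _ ≤ (2 * (Nat.card F : ℝ) ^ (d / 2)) / (Nat.card F : ℝ) ^ d := by
                gcongr
                linarith
            _ = 2 * ((Nat.card F : ℝ) ^ (d / 2) / (Nat.card F : ℝ) ^ d) := by ring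
            _ ≤ _ := by gcongr
        have h6 : d * a d ^ 2 ≤ 4 := by
          have h7 : (a d * d) ^ 2 ≤ 2 ^ 2 := by
            rw [← sq_abs]; exact pow_le_pow_left₀ (abs_nonneg _) h1 2
          nlinarith [sq_nonneg (a d)]
        have h8 : 0 ≤ d * a d ^ 2 := by positivity
        rw [h3, abs_neg, abs_of_nonneg (mul_nonneg h4 h8)]
        calc _ ≤ 2 * (3 / 5 : ℝ) ^ d * 4 := mul_le_mul h5 h6 h8 (by positivity)
          _ = _ := by ring
    _ ≤ 8 * (5 / 2) := by
        rw [← Finset.mul_sum]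
        exact mul_le_mul_of_nonneg_left (sum_Ioc_geometric_le K) (by norm_num)
    _ = 20 := by norm_num

/-- The variance of the prime sum is `(2 / π²) log (K β)` up to a bounded error. -/
theorem abs_variance_sub_log_le (hF : Odd (Nat.card F)) {a : ℕ → ℝ} {K : ℕ} {β c : ℝ}
    (h0 : 0 < β) (h1 : β < 1) (hc : 0 < c) (hcβ : c * β ≤ Real.sin (Real.pi * β))
    (hK : 1 ≤ K * β)
    (ha : ∀ d : ℕ, 0 < d →
      |a d - Real.sin (Real.pi * d * β) / (Real.pi * d)| ≤ 1 / ((K : ℝ) + 1)) :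
    |∑ P ∈ primesUpTo F K, 4 * ((a P.natDegree * P.natDegree) ^ 2 /
        (Nat.card F : ℝ) ^ P.natDegree) - 2 / Real.pi ^ 2 * Real.log (K * β)| ≤
      4 * (20 + 3 + (Real.pi ^ 2 + 1 / 2 + 1 / (2 * c)) / Real.pi ^ 2) := by
  rw [← Finset.mul_sum, sum_primesUpTo_natDegree K
    (fun d => (a d * d) ^ 2 / (Nat.card F : ℝ) ^ d)]
  have e1 := abs_sum_card_primesOfDegree_sub_le hF fun d hd => (abs_mul_le_two ha hd).1
  have e2 := abs_sum_mul_sq_sub_le ha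
  have e3 := abs_sum_sin_sq_div_sub_log_le h0 h1 hc hcβ hK
  set A := ∑ d ∈ Finset.Ioc 0 K,
    ((primesOfDegree F d).card : ℝ) * ((a d * d) ^ 2 / (Nat.card F : ℝ) ^ d)
  set B := ∑ d ∈ Finset.Ioc 0 K, (d : ℝ) * a d ^ 2
  set S := ∑ d ∈ Finset.Ioc 0 K, Real.sin (Real.pi * d * β) ^ 2 / (d : ℝ)
  have hpi : 0 < Real.pi ^ 2 := by positivity
  have h2 : 4 * A - 2 / Real.pi ^ 2 * Real.log (K * β) =
      4 * ((A - B) + (B - S / Real.pi ^ 2) + (S - Real.log (K * β) / 2) / Real.pi ^ 2) := by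
    field_simp
    ring
  rw [h2, abs_mul, abs_of_pos (by norm_num : (0 : ℝ) < 4)]
  gcongr
  refine (abs_add_le _ _).trans (add_le_add ((abs_add_le _ _).trans (add_le_add e1 e2)) ?_)
  rw [abs_div, abs_of_pos hpi]
  gcongr

/-- A bound for 2 Σ ‖P‖^(-3/2) uniform in K: it controls the total cost of the primes that divide Q.
The crude count of q^d primes of degree d leaves a geometric series in q^(-1/2). -/
theorem sum_primesUpTo_inv_le (hF : Odd (Nat.card F)) (K : ℕ) :
    ∑ P ∈ primesUpTo F K, 1 / √((Nat.card F : ℝ) ^ P.natDegree) *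
      (2 / (Nat.card F : ℝ) ^ P.natDegree) ≤ 5 := by
  have hq0 : (0 : ℝ) < Nat.card F := by exact_mod_cast Nat.card_pos
  rw [sum_primesUpTo_natDegree K
    (fun d => 1 / √((Nat.card F : ℝ) ^ d) * (2 / (Nat.card F : ℝ) ^ d))]
  calc _ ≤ ∑ d ∈ Finset.Ioc 0 K, 2 * (3 / 5 : ℝ) ^ d := by
        refine Finset.sum_le_sum fun d hd => ?_
        rw [Finset.mem_Ioc] at hd
        have h1 : ((primesOfDegree F d).card : ℝ) ≤ (Nat.card F : ℝ) ^ d := by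
          have := (Nat.le_mul_of_pos_left _ hd.1).trans (mul_card_primesOfDegree_le F d)
          exact_mod_cast this
        calc _ ≤ (Nat.card F : ℝ) ^ d * ((3 / 5 : ℝ) ^ d * (2 / (Nat.card F : ℝ) ^ d)) := by
              gcongr
              exact inv_sqrt_pow_le hF d
          _ = _ := by field_simp
    _ ≤ 2 * (5 / 2) := by
        rw [← Finset.mul_sum]
        exact mul_le_mul_of_nonneg_left (sum_Ioc_geometric_le K) (by norm_num)
    _ = 5 := by norm_num

variable (F) in
theorem card_primesUpTo_le (K : ℕ) :
    ((primesUpTo F K).card : ℝ) ≤ (Nat.card F : ℝ) ^ (2 * K) := by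
  have hq : 1 < Nat.card F := Finite.one_lt_card
  have h := sum_primesUpTo_natDegree (F := F) K (fun _ => 1)
  simp only [Finset.sum_const, nsmul_eq_mul, mul_one] at h
  rw [h]
  calc _ ≤ ∑ d ∈ Finset.Ioc 0 K, (Nat.card F : ℝ) ^ K := by
        refine Finset.sum_le_sum fun d hd => ?_
        rw [Finset.mem_Ioc] at hd
        have h1 := ((Nat.le_mul_of_pos_left _ hd.1).trans (mul_card_primesOfDegree_le F d)).trans
          (Nat.pow_le_pow_right (zero_lt_one.trans hq) hd.2)
        exact_mod_cast h1
    _ = K * (Nat.card F : ℝ) ^ K := by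
        rw [Finset.sum_const, Nat.card_Ioc, Nat.sub_zero, nsmul_eq_mul]
    _ ≤ (Nat.card F : ℝ) ^ K * (Nat.card F : ℝ) ^ K := by
        gcongr
        exact_mod_cast (Nat.lt_pow_self hq).le
    _ = _ := by rw [two_mul, pow_add]

end PrimeSums

/-! ### Asymptotics of the parameters -/

section Parameters

variable {β : ℕ → ℝ} {K : ℕ → ℕ}

theorem tendsto_natCast_mul_atTop (hβ : ∀ g, 0 < β g)
    (hreg : (∃ b : ℝ, ∀ g, β g = b) ∨
      (Tendsto β atTop (𝓝 0) ∧ Tendsto (fun g : ℕ => β g * g) atTop atTop)) :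
    Tendsto (fun g : ℕ => (g : ℝ) * β g) atTop atTop := by
  rcases hreg with ⟨b, hb⟩ | ⟨-, h⟩
  · simp only [hb]
    exact tendsto_natCast_atTop_atTop.atTop_mul_const (hb 0 ▸ hβ 0)
  · simpa only [mul_comm] using h

/-- For fixed β the constant depends on β, since sin(πβ) is small near β = 1; for β → 0, Jordan's
inequality gives 2. -/
theorem exists_mul_le_sin (hβ : ∀ g, 0 < β g ∧ β g < 1)
    (hreg : (∃ b : ℝ, ∀ g, β g = b) ∨
      (Tendsto β atTop (𝓝 0) ∧ Tendsto (fun g : ℕ => β g * g) atTop atTop)) :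
    ∃ c : ℝ, 0 < c ∧ ∀ᶠ g in atTop, c * β g ≤ Real.sin (Real.pi * β g) := by
  rcases hreg with ⟨b, hb⟩ | ⟨h, -⟩
  · have hb0 : 0 < b := hb 0 ▸ (hβ 0).1
    have hb1 : b < 1 := hb 0 ▸ (hβ 0).2
    have hsin : 0 < Real.sin (Real.pi * b) :=
      Real.sin_pos_of_pos_of_lt_pi (by positivity) (by nlinarith [Real.pi_pos])
    refine ⟨Real.sin (Real.pi * b) / b, by positivity, Eventually.of_forall fun g => ?_⟩
    rw [hb g, div_mul_cancel₀ _ hb0.ne']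
  · refine ⟨2, two_pos, ?_⟩
    filter_upwards [h.eventually_le_const (show (0 : ℝ) < 1 / 2 by norm_num)] with g hg
    have h1 := Real.mul_le_sin (x := Real.pi * β g)
      (mul_nonneg Real.pi_pos.le (hβ g).1.le) (by nlinarith [Real.pi_pos])
    refine le_trans (le_of_eq ?_) h1
    field_simp

theorem tendsto_natCast_div_zero (hx : Tendsto (fun g : ℕ => (g : ℝ) * β g) atTop atTop)
    (hK : (fun g : ℕ => (K g : ℝ)) =Θ[atTop]
      (fun g : ℕ => (g : ℝ) / Real.log (Real.log (g * β g)))) :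
    Tendsto (fun g => (K g : ℝ) / g) atTop (𝓝 0) := by
  have hll : Tendsto (fun g : ℕ => Real.log (Real.log (g * β g))) atTop atTop :=
    Real.tendsto_log_atTop.comp (Real.tendsto_log_atTop.comp hx)
  have h1 : (fun g : ℕ => (Real.log (Real.log (g * β g)))⁻¹) =o[atTop] fun _ => (1 : ℝ) :=
    (isLittleO_one_iff ℝ).2 (tendsto_inv_atTop_zero.comp hll)
  have h2 : (fun g : ℕ => (g : ℝ) / Real.log (Real.log (g * β g))) =o[atTop]
      fun g : ℕ => (g : ℝ) := by
    have := (isBigO_refl (fun g : ℕ => (g : ℝ)) atTop).mul_isLittleO h1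
    simpa only [div_eq_mul_inv, mul_one] using this
  exact (hK.1.trans_isLittleO h2).tendsto_div_nhds_zero

/-- From g ≤ C K log log(gβ), log(gβ) exceeds log(Kβ) by at most log C + log log log(gβ), which is
o(log(gβ)). In the other direction, K ≤ g eventually. -/
theorem tendsto_log_div_log (hβ : ∀ g, 0 < β g)
    (hx : Tendsto (fun g : ℕ => (g : ℝ) * β g) atTop atTop)
    (hK : (fun g : ℕ => (K g : ℝ)) =Θ[atTop]
      (fun g : ℕ => (g : ℝ) / Real.log (Real.log (g * β g)))) :
    Tendsto (fun g => Real.log (K g * β g) / Real.log (g * β g)) atTop (𝓝 1) := by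
  have hl : Tendsto (fun g : ℕ => Real.log (g * β g)) atTop atTop :=
    Real.tendsto_log_atTop.comp hx
  have hll : Tendsto (fun g : ℕ => Real.log (Real.log (g * β g))) atTop atTop :=
    Real.tendsto_log_atTop.comp hl
  obtain ⟨C, hC, hbound⟩ := hK.2.exists_pos
  have hKg := tendsto_natCast_div_zero hx hK
  have hratio : Tendsto (fun g : ℕ => Real.log (Real.log (g * β g)) / Real.log (g * β g)) atTop
      (𝓝 0) := (Real.isLittleO_log_id_atTop.tendsto_div_nhds_zero).comp hl
  have hlow : Tendsto (fun g : ℕ => 1 - (Real.log C / Real.log (g * β g) +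
      Real.log (Real.log (g * β g)) / Real.log (g * β g))) atTop (𝓝 1) := by
    simpa using ((tendsto_const_nhds.div_atTop hl).add hratio).const_sub 1
  have hev : ∀ᶠ g : ℕ in atTop, 0 < Real.log (g * β g) ∧ 0 < Real.log (Real.log (g * β g)) ∧
      0 < (g : ℝ) ∧ 0 < (K g : ℝ) ∧ (K g : ℝ) ≤ g ∧
      (g : ℝ) / Real.log (Real.log (g * β g)) ≤ C * K g := by
    filter_upwards [hl.eventually_gt_atTop 0, hll.eventually_gt_atTop 0, eventually_gt_atTop 0,
      hKg.eventually_le_const zero_lt_one, hbound.bound] with g h1 h2 h3 h4 h5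
    have h3' : (0 : ℝ) < g := by exact_mod_cast h3
    rw [Real.norm_of_nonneg (by positivity), Real.norm_of_nonneg (by positivity)] at h5
    refine ⟨h1, h2, h3', ?_, by rwa [div_le_one h3'] at h4, h5⟩
    exact pos_of_mul_pos_right ((div_pos h3' h2).trans_le h5) hC.le
  refine tendsto_of_tendsto_of_tendsto_of_le_of_le' hlow tendsto_const_nhds ?_ ?_
  · filter_upwards [hev] with g ⟨h1, h2, h3, h4, h5, h6⟩
    rw [le_div_iff₀ h1, ← add_div, sub_mul, div_mul_cancel₀ _ h1.ne', one_mul]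
    have hb := hβ g
    have h7 : Real.log (g * β g) ≤ Real.log (C * Real.log (Real.log (g * β g)) * (K g * β g)) := by
      apply Real.log_le_log (by positivity)
      rw [div_le_iff₀ h2] at h6
      calc (g : ℝ) * β g ≤ C * K g * Real.log (Real.log (g * β g)) * β g := by gcongr
        _ = _ := by ring
    rw [Real.log_mul (mul_pos hC h2).ne' (mul_pos h4 hb).ne', Real.log_mul hC.ne' h2.ne'] at h7
    -- The triple logarithm is replaced by the larger double one, which is still o(log(gβ)).
    have h8 := Real.log_le_self h2.le
    linarith
  · filter_upwards [hev] with g ⟨h1, h2, h3, h4, h5, h6⟩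
    rw [div_le_one h1]
    have hb := hβ g
    exact Real.log_le_log (by positivity) (by gcongr)

end Parameters

/-! ### The limit theorem -/

section Limit

variable {F : Type*} [Field F] [Finite F]

scoped instance squarefreeFamily_discreteMeasurableSpace (d : ℕ) :
    DiscreteMeasurableSpace (squarefreeFamily F d) := ⟨fun _ => trivial⟩

/-- The coefficient of `χ_Q(P)` in the prime sum attached to `I`, divided by `σ`. -/
def primeCoefficient (I : ℝ → ℝ) (σ : ℝ) (P : F[X]) : ℝ :=
  -2 * (fourierCoefficient I P.natDegree * P.natDegree / √((Nat.card F : ℝ) ^ P.natDegree)) / σ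

theorem primeSum_div_eq (K : ℕ) (I : ℝ → ℝ) (σ : ℝ) (Q : F[X]) :
    primeSum K I Q / σ =
      ∑ P : primesUpTo F K, primeCoefficient I σ (P : F[X]) * residueSymbol Q P := by
  rw [Finset.sum_coe_sort (primesUpTo F K) (fun P => primeCoefficient I σ P * residueSymbol Q P),
    primeSum, Finset.mul_sum, Finset.sum_div]
  refine Finset.sum_congr rfl fun P _ => ?_
  rw [primeCoefficient]
  ring

theorem abs_primeCoefficient_le {I : ℝ → ℝ} {σ : ℝ} (hσ : 0 < σ) {P : F[X]}
    (h : |fourierCoefficient I P.natDegree * P.natDegree| ≤ 2) :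
    |primeCoefficient I σ P| ≤ 4 / σ * (1 / √((Nat.card F : ℝ) ^ P.natDegree)) := by
  have hq0 : (0 : ℝ) < Nat.card F := by exact_mod_cast Nat.card_pos
  rw [primeCoefficient, abs_div, abs_of_pos hσ, abs_mul, abs_div,
    abs_of_pos (Real.sqrt_pos.2 (pow_pos hq0 _))]
  norm_num
  calc _ ≤ 2 * (2 / √((Nat.card F : ℝ) ^ P.natDegree)) / σ := by
        gcongr
        rwa [abs_mul, Nat.abs_cast] at h
    _ = _ := by ring

/-- Since K = o(g), q^(mK) is eventually below (5/4)^g, while q ≥ 3 gives (2/q)^(g+1) ≤ (2/3)^g; and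
(5/4)(2/3) = 5/6 < 1. -/
theorem tendsto_pow_mul_pow_zero (hF : Odd (Nat.card F)) {K : ℕ → ℕ}
    (hK : Tendsto (fun g => (K g : ℝ) / g) atTop (𝓝 0)) (m : ℕ) :
    Tendsto (fun g => (Nat.card F : ℝ) ^ (m * K g) * (2 / (Nat.card F : ℝ)) ^ (g + 1)) atTop
      (𝓝 0) := by
  have hq : (3 : ℝ) ≤ Nat.card F := by exact_mod_cast three_le_natCard_of_odd hF
  have hq0 : (0 : ℝ) < Nat.card F := by linarith
  have hlim : Tendsto (fun g : ℕ => (5 / 6 : ℝ) ^ g) atTop (𝓝 0) :=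
    tendsto_pow_atTop_nhds_zero_of_lt_one (by norm_num) (by norm_num)
  have hm : Tendsto (fun g => m * Real.log (Nat.card F) * ((K g : ℝ) / g)) atTop (𝓝 0) := by
    simpa using hK.const_mul (m * Real.log (Nat.card F))
  refine squeeze_zero' (Eventually.of_forall fun g => by positivity) ?_ hlim
  filter_upwards [hm.eventually_le_const (Real.log_pos (by norm_num : (1 : ℝ) < 5 / 4)),
    eventually_gt_atTop 0] with g hg hg0
  have hg0' : (0 : ℝ) < g := by exact_mod_cast hg0
  have h1 : (Nat.card F : ℝ) ^ (m * K g) ≤ (5 / 4) ^ g := by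
    rw [← Real.log_le_log_iff (by positivity) (by positivity), Real.log_pow, Real.log_pow]
    rw [← mul_div_assoc, div_le_iff₀ hg0'] at hg
    push_cast
    linarith
  have h2 : (2 / (Nat.card F : ℝ)) ^ (g + 1) ≤ (2 / 3) ^ g := by
    have h3 : 2 / (Nat.card F : ℝ) ≤ 2 / 3 := by gcongr
    calc (2 / (Nat.card F : ℝ)) ^ (g + 1) ≤ (2 / 3) ^ (g + 1) := by gcongr
      _ ≤ (2 / 3) ^ g := pow_le_pow_of_le_one (by norm_num) (by norm_num) (Nat.le_succ g)
  calc _ ≤ (5 / 4 : ℝ) ^ g * (2 / 3) ^ g := by gcongr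
    _ = _ := by rw [← mul_pow]; norm_num

/-- The limit theorem for prime sums attached to one-sided approximations of the indicator function;
`s = 1` for majorants and `s = -1` for minorants. -/
theorem tendstoInDistribution_primeSum (hF : Odd (Nat.card F))
    (β : ℕ → ℝ) (hβ : ∀ g, 0 < β g ∧ β g < 1)
    (hreg : (∃ b : ℝ, ∀ g, β g = b) ∨
      (Tendsto β atTop (𝓝 0) ∧ Tendsto (fun g : ℕ => β g * g) atTop atTop))
    (K : ℕ → ℕ)
    (hK : (fun g : ℕ => (K g : ℝ)) =Θ[atTop]
      (fun g : ℕ => (g : ℝ) / Real.log (Real.log (g * β g))))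
    (I : ℕ → ℝ → ℝ) {s : ℝ} (hs : |s| = 1) (htrig : ∀ g, IsTrigPoly (K g) (I g))
    (hle : ∀ g x, 0 ≤ s * (I g x - arcIndicator (β g) x))
    (hmean : ∀ g, ∫ x in (0 : ℝ)..1, I g x = β g + s * (1 / ((K g : ℝ) + 1))) :
    TendstoInDistribution
      (fun (g : ℕ) (Q : squarefreeFamily F (2 * g + 2)) =>
        primeSum (K g) (I g) (Q : F[X]) / √(2 / Real.pi ^ 2 * Real.log (g * β g)))
      atTop (id : ℝ → ℝ) (fun _ => uniformOn Set.univ) (gaussianReal 0 1) := by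
  classical
  have hq0 : (0 : ℝ) < Nat.card F := by exact_mod_cast Nat.card_pos
  have hx := tendsto_natCast_mul_atTop (fun g => (hβ g).1) hreg
  have hl : Tendsto (fun g : ℕ => Real.log (g * β g)) atTop atTop :=
    Real.tendsto_log_atTop.comp hx
  have hKg := tendsto_natCast_div_zero hx hK
  have hloglog := tendsto_log_div_log (fun g => (hβ g).1) hx hK
  obtain ⟨c, hc, hsin⟩ := exists_mul_le_sin hβ hreg
  set σ : ℕ → ℝ := fun g => √(2 / Real.pi ^ 2 * Real.log (g * β g)) with hσ
  have hσtop : Tendsto σ atTop atTop :=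
    Real.tendsto_sqrt_atTop.comp (hl.const_mul_atTop (by positivity))
  have hcoef : ∀ g, ∀ d : ℕ, 0 < d → |fourierCoefficient (I g) d -
      Real.sin (Real.pi * d * β g) / (Real.pi * d)| ≤ 1 / ((K g : ℝ) + 1) := fun g d hd =>
    abs_fourierCoefficient_sub_le (hβ g).1 (hβ g).2 (htrig g) hs (hle g) (hmean g) hd
  have hcoef2 : ∀ g, ∀ P ∈ primesUpTo F (K g),
      |fourierCoefficient (I g) P.natDegree * P.natDegree| ≤ 2 := fun g P hP => by
    rw [mem_primesUpTo] at hP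
    exact (abs_mul_le_two (a := fun d => fourierCoefficient (I g) d) (hcoef g)
      (Finset.mem_Ioc.2 ⟨hP.2.1.natDegree_pos, hP.2.2⟩)).1
  set b : ∀ g, primesUpTo F (K g) → ℝ := fun g P => primeCoefficient (I g) (σ g) (P : F[X]) with hb
  have hσpos : ∀ᶠ g in atTop, 0 < σ g := hσtop.eventually_gt_atTop 0
  have hble : ∀ᶠ g in atTop, ∀ P, |b g P| ≤ 4 / σ g := by
    filter_upwards [hσpos] with g hg P
    refine (abs_primeCoefficient_le hg (hcoef2 g P P.2)).trans ?_
    refine mul_le_of_le_one_right (by positivity) ?_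
    exact (inv_sqrt_pow_le hF _).trans (pow_le_one₀ (by norm_num) (by norm_num))
  have hδ : Tendsto (fun g => 4 / σ g) atTop (𝓝 0) := tendsto_const_nhds.div_atTop hσtop
  have hV : Tendsto (fun g => ∑ P, b g P ^ 2) atTop (𝓝 1) := by
    set V : ℕ → ℝ := fun g => ∑ P ∈ primesUpTo F (K g),
      4 * ((fourierCoefficient (I g) P.natDegree * P.natDegree) ^ 2 /
        (Nat.card F : ℝ) ^ P.natDegree) with hVdef
    have hVb : ∀ g, ∑ P, b g P ^ 2 = V g / σ g ^ 2 := by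
      intro g
      rw [hb, Finset.sum_coe_sort (primesUpTo F (K g))
        (fun P => primeCoefficient (I g) (σ g) P ^ 2), hVdef, Finset.sum_div]
      refine Finset.sum_congr rfl fun P _ => ?_
      rw [primeCoefficient, div_pow, mul_pow, div_pow, Real.sq_sqrt (by positivity)]
      norm_num
    -- If Kβ < 1 then log(Kβ) ≤ 0, against the ratio of logarithms tending to 1.
    have hone : ∀ᶠ g in atTop, 1 ≤ K g * β g := by
      filter_upwards [hloglog.eventually_const_lt zero_lt_one, hl.eventually_gt_atTop 0]
        with g h1 h2
      by_contra h
      have h3 : Real.log (K g * β g) ≤ 0 :=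
        Real.log_nonpos (mul_nonneg (Nat.cast_nonneg _) (hβ g).1.le) (not_le.1 h).le
      exact absurd h1 (not_lt.2 (div_nonpos_of_nonpos_of_nonneg h3 h2.le))
    have hσ2 : Tendsto (fun g => σ g ^ 2) atTop atTop :=
      (tendsto_pow_atTop two_ne_zero).comp hσtop
    have hdiff : Tendsto (fun g => (V g - 2 / Real.pi ^ 2 * Real.log (K g * β g)) / σ g ^ 2)
        atTop (𝓝 0) := by
      have h0 : Tendsto (fun g => 4 * (20 + 3 + (Real.pi ^ 2 + 1 / 2 + 1 / (2 * c)) /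
          Real.pi ^ 2) / σ g ^ 2) atTop (𝓝 0) := tendsto_const_nhds.div_atTop hσ2
      refine squeeze_zero_norm' ?_ h0
      filter_upwards [hone, hsin, hσpos] with g h1 h2 h3
      rw [norm_div, Real.norm_eq_abs, Real.norm_of_nonneg (sq_nonneg (σ g))]
      gcongr
      exact abs_variance_sub_log_le hF (a := fun d => fourierCoefficient (I g) d)
        (hβ g).1 (hβ g).2 hc h2 h1 (hcoef g)
    have hsum := hdiff.add hloglog
    rw [zero_add] at hsum
    refine hsum.congr' ?_
    filter_upwards [hl.eventually_gt_atTop 0] with g h1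
    rw [hVb, hσ]
    simp only
    rw [Real.sq_sqrt (by positivity)]
    field_simp
    ring
  have hX : (fun (g : ℕ) (Q : squarefreeFamily F (2 * g + 2)) =>
      primeSum (K g) (I g) (Q : F[X]) / √(2 / Real.pi ^ 2 * Real.log (g * β g))) =
      fun (g : ℕ) (Q : squarefreeFamily F (2 * g + 2)) =>
        ∑ P, b g P * residueSymbol (Q : F[X]) P := by
    funext g Q
    exact primeSum_div_eq (K g) (I g) (σ g) (Q : F[X])
  rw [hX]
  refine tendstoInDistribution_gaussian_of_moments _ b hV hδ hble fun r => ?_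
  -- The bound of `expect_rademacherSum_pow_le` with L = 1 and Σ b² ≤ 2, independent of g.
  set B : ℝ := 2 * (2 * (r - 1)).factorial / 1 ^ (2 * (r - 1)) * Real.exp (1 ^ 2 * 2 / 2) with hB
  have hbound : Tendsto (fun g => 2 * ((Nat.card F : ℝ) ^ (3 * r * K g) *
      (2 / (Nat.card F : ℝ)) ^ (g + 1)) + r * (4 / σ g * 5 * (1 + B))) atTop (𝓝 0) := by
    have h1 := (tendsto_pow_mul_pow_zero hF hKg (3 * r)).const_mul 2
    have h2 := (((hδ.mul_const 5).mul_const (1 + B)).const_mul (r : ℝ))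
    simpa using h1.add h2
  refine squeeze_zero_norm' ?_ hbound
  filter_upwards [hσpos, hble, hδ.eventually_le_const zero_lt_one,
    hV.eventually_le_const one_lt_two] with g h1 h2 h3 h4
  rw [Real.norm_eq_abs]
  refine (abs_expect_primeSum_pow_sub_le hF g (b g) r).trans ?_
  -- Eventually each |b_P| ≤ 1, so the number of primes is a bound. Its r-th power q^(2Kr), times
  -- q^(rK) from the odd tuples, yields the exponent 3rK.
  have hsumb : ∑ P, |b g P| ≤ (Nat.card F : ℝ) ^ (2 * K g) := by
    refine le_trans ?_ (card_primesUpTo_le F (K g))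
    refine (Finset.sum_le_card_nsmul _ _ 1 fun P _ => (h2 P).trans h3).trans (le_of_eq ?_)
    simp
  have hsumc : ∑ P, |b g P| * (2 / (Nat.card F : ℝ) ^ (P : F[X]).natDegree) ≤ 4 / σ g * 5 := by
    calc _ ≤ ∑ P : primesUpTo F (K g), 4 / σ g * (1 / √((Nat.card F : ℝ) ^ (P : F[X]).natDegree) *
          (2 / (Nat.card F : ℝ) ^ (P : F[X]).natDegree)) := by
          refine Finset.sum_le_sum fun P _ => ?_
          rw [← mul_assoc]
          exact mul_le_mul_of_nonneg_right (abs_primeCoefficient_le h1 (hcoef2 g P P.2))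
            (by positivity)
      _ ≤ _ := by
          rw [← Finset.mul_sum, Finset.sum_coe_sort (primesUpTo F (K g)) (fun P =>
            1 / √((Nat.card F : ℝ) ^ P.natDegree) * (2 / (Nat.card F : ℝ) ^ P.natDegree))]
          gcongr
          exact sum_primesUpTo_inv_le hF (K g)
  have hmom : 𝔼 ε, rademacherSum (fun P => |b g P|) ε ^ (2 * (r - 1)) ≤ B := by
    refine (expect_rademacherSum_pow_le _ (r - 1) one_pos).trans ?_
    simp only [sq_abs]
    rw [hB]
    gcongr
  have hmom0 : 0 ≤ 𝔼 ε, rademacherSum (fun P => |b g P|) ε ^ (2 * (r - 1)) :=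
    Finset.expect_nonneg fun ε _ => (even_two_mul _).pow_nonneg _
  have hsumb0 : 0 ≤ ∑ P, |b g P| := Finset.sum_nonneg fun P _ => abs_nonneg _
  calc _ ≤ 2 * (Nat.card F : ℝ) ^ (r * K g) * (2 / (Nat.card F : ℝ)) ^ (g + 1) *
        ((Nat.card F : ℝ) ^ (2 * K g)) ^ r + r * (4 / σ g * 5 * (1 + B)) := by
        gcongr
    _ = _ := by
        rw [← pow_mul, show 3 * r * K g = r * K g + 2 * K g * r by ring, pow_add]
        ring

end Limit

end HyperellipticFamily

end

theorem corollary8p2 {F : Type*} [Field F] [Finite F] (hF : Odd (Nat.card F))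
    (β : ℕ → ℝ) (hβ : ∀ g, 0 < β g ∧ β g < 1)
    (hreg : (∃ b : ℝ, ∀ g, β g = b) ∨
      (Tendsto β atTop (𝓝 0) ∧ Tendsto (fun g : ℕ => β g * g) atTop atTop))
    (K : ℕ → ℕ)
    (hK : (fun g : ℕ => (K g : ℝ)) =Θ[atTop]
      (fun g : ℕ => (g : ℝ) / Real.log (Real.log (g * β g))))
    (Iplus Iminus : ℕ → ℝ → ℝ)
    (hplus : ∀ g, HyperellipticFamily.IsSelbergMajorant (β g) (K g) (Iplus g))
    (hminus : ∀ g, HyperellipticFamily.IsSelbergMinorant (β g) (K g) (Iminus g)) :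
    TendstoInDistribution
      (fun (g : ℕ) (Q : HyperellipticFamily.squarefreeFamily F (2 * g + 2)) =>
        HyperellipticFamily.primeSum (K g) (Iplus g) (Q : F[X]) /
          √(2 / Real.pi ^ 2 * Real.log (g * β g)))
      atTop (id : ℝ → ℝ) (fun _ => uniformOn Set.univ) (gaussianReal 0 1) ∧
    TendstoInDistribution
      (fun (g : ℕ) (Q : HyperellipticFamily.squarefreeFamily F (2 * g + 2)) =>
        HyperellipticFamily.primeSum (K g) (Iminus g) (Q : F[X]) /
          √(2 / Real.pi ^ 2 * Real.log (g * β g)))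
      atTop (id : ℝ → ℝ) (fun _ => uniformOn Set.univ) (gaussianReal 0 1) := by
  refine ⟨HyperellipticFamily.tendstoInDistribution_primeSum hF β hβ hreg K hK Iplus (s := 1)
    abs_one (fun g => (hplus g).isTrigPoly) (fun g x => ?_) (fun g => ?_),
    HyperellipticFamily.tendstoInDistribution_primeSum hF β hβ hreg K hK Iminus (s := -1)
    (by simp) (fun g => (hminus g).isTrigPoly) (fun g x => ?_) (fun g => ?_)⟩
  · linarith [(hplus g).majorant x]
  · rw [(hplus g).integral, one_mul]
  · linarith [(hminus g).minorant x]
  · rw [(hminus g).integral]; ring
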